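/- **Setting.** Let $\mathfrak g$ be a complex Banach–Lie algebra which is weakly root graded: it contains a finite-dimensional complex semisimple Lie subalgebra $\mathfrak g_\Delta$ such that, for a Cartan subalgebra $\mathfrak h$ of $\mathfrak g_\Delta$, $\mathfrak g$ is a finite direct sum of simultaneous eigenspaces $\mathfrak g=\mathfrak g_0\oplus\bigoplus_{\alpha\in\mathcal R}\mathfrak g_\alpha$, where $\mathfrak g_\alpha=\{y\in\mathfrak g : [h,y]=\alpha(h)y \text{ for all } h\in\mathfrak h\}$ and $\mathcal R\subseteq\mathfrak h^*\setminus\{0\}$ is the set of non-zero $\alpha$ with $\mathfrak g_\alpha\neq 0$. Let $x\in\mathfrak h$ be such that $\alpha(x)\in\mathbb R$ for all $\alpha\in\mathcal R$, and put $$\Sigma=\{\alpha\in\mathcal R:\alpha(x)\ge 0\},\quad \Sigma^{+}=\{\alpha\in\mathcal R:\alpha(x)>0\},\quad \Sigma^{0}=\{\alpha\in\mathcal R:\alpha(x)=0\},\quad \Sigma^{-}=\{\alpha\in\mathcal R:\alpha(x)<0\}=\mathcal R\setminus\Sigma$$ (if $\mathcal R=-\mathcal R$, then $\Sigma^+=\Sigma\setminus-\Sigma$,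 $\Sigma^0=\Sigma\cap-\Sigma$ and $\Sigma^-=-\Sigma^+$). Put $$\mathfrak p=\mathfrak g_0+\sum_{\alpha\in\Sigma}\mathfrak g_\alpha,\quad \mathfrak l=\mathfrak g_0+\sum_{\alpha\in\Sigma^0}\mathfrak g_\alpha,\quad \mathfrak u=\sum_{\alpha\in\Sigma^+}\mathfrak g_\alpha,\quad \mathfrak n=\sum_{\alpha\in\Sigma^-}\mathfrak g_\alpha .$$ Let $G$ be a complex Banach–Lie group with Lie algebra $\mathfrak g$ and exponential function $\exp_G$. For a subspace $V\subseteq\mathfrak g$ put $N_G(V)=\{g\in G:\mathrm{Ad}(g)V=V\}$. Let $P$ be a parabolic subgroup of $G$, i.e. an open subgroup of $N_G(\mathfrak p)$, and put $$U=\exp_G\mathfrak u,\qquad N=\exp_G\mathfrak n,\qquad L=P\cap N_G(\mathfrak l)\cap N_G(\mathfrak n).$$ A Lie subgroup of $G$ with Lie algebra $V$ is a closed subgroup $H$ with $V=\{y\in\mathfrak g:\exp_G(\mathbb R y)\subseteq H\}$ a closed complex subspace, such that $\exp_G$ maps some open $0$-neighborhood $O\subseteq\mathfrak g$ biholomorphically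 onto an open subset with $\exp_G(O\cap V)=\exp_G(O)\cap H$; it carries a structure of a complex Banach–Lie group modelled on $V$, compatible with the subspace topology, for which the inclusion into $G$ is holomorphic with derivative at the identity the inclusion $V\hookrightarrow\mathfrak g$. **Proposition.** $P$ is a Lie subgroup of $G$ with Lie algebra $\mathfrak p$, and the following assertions hold. (a) $U$ is a Lie subgroup of $G$ with Lie algebra $\mathfrak u$, and its exponential function $\exp_U=\exp_G|_{\mathfrak u}:\mathfrak u\to U$ is biholomorphic (in particular a diffeomorphism). (b) $N$ is a Lie subgroup of $G$ with Lie algebra $\mathfrak n$, and its exponential function $\exp_N=\exp_G|_{\mathfrak n}:\mathfrak n\to N$ is biholomorphic (in particular a diffeomorphism). (c) $L$ is a Lie subgroup of $G$ with Lie algebra $\mathfrak l$; conjugation by elements of $L$ preserves $N$ and $U$, and the resulting actions $L\times N\to N$ and $L\times U\to U$ by automorphisms are holomorphic. (d) The multiplication map $U\rtimes L\to P$, $(u,l)\mapsto ul$, is a group homomorphism that is biholomorphic onto an open subgroup of $P$. (e) The multiplication map $N\times L\times U\to G$, $(n,l,u)\mapsto nlu$, is biholomorphic onto an open subset of $G$.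 -/

import Mathlib

open Set Topology
open scoped Manifold ContDiff

/-! ### Weakly root graded Lie algebras and parabolic subalgebras -/

section LieAlgebras

variable (𝔤 : Type*) [LieRing 𝔤] [LieAlgebra ℂ 𝔤]

/-- The simultaneous eigenspace `𝔤_α = {x ∈ 𝔤 : [h, x] = α(h) x for all h ∈ 𝔥}`, for a subalgebra
`𝔥` of a subalgebra `𝔤Δ` of `𝔤` and a linear functional `α` on `𝔥`. -/
def weightSubspace {𝔤 : Type*} [LieRing 𝔤] [LieAlgebra ℂ 𝔤] {𝔤Δ : LieSubalgebra ℂ 𝔤}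
    (𝔥 : LieSubalgebra ℂ 𝔤Δ) (α : Module.Dual ℂ 𝔥) : Submodule ℂ 𝔤 where
  carrier := {x | ∀ h : 𝔥, ⁅((h : 𝔤Δ) : 𝔤), x⁆ = α h • x}
  add_mem' := fun {x y} hx hy h => by rw [lie_add, hx h, hy h, smul_add]
  zero_mem' := fun h => by rw [lie_zero, smul_zero]
  smul_mem' := fun c x hx h => by rw [lie_smul, hx h, smul_comm]

/-- A weak root grading of a complex Lie algebra `𝔤`: a finite-dimensional semisimple subalgebra
`𝔤Δ` with a Cartan subalgebra `𝔥` such that `𝔤` is the direct sum of finitely many simultaneous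
`ad 𝔥`-eigenspaces. The reduced root system `Δ` is the one of `(𝔤Δ, 𝔥)`. -/
structure WeakRootGrading where
  /-- the grading subalgebra -/
  𝔤Δ : LieSubalgebra ℂ 𝔤
  finiteDimensional : FiniteDimensional ℂ 𝔤Δ
  isSemisimple : LieAlgebra.IsSemisimple ℂ 𝔤Δ
  /-- the Cartan subalgebra of the grading subalgebra -/
  𝔥 : LieSubalgebra ℂ 𝔤Δ
  isCartan : 𝔥.IsCartanSubalgebra
  finite_weights : {α : Module.Dual ℂ 𝔥 | weightSubspace 𝔥 α ≠ ⊥}.Finite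
  iSupIndep_weights : iSupIndep fun α : Module.Dual ℂ 𝔥 => weightSubspace 𝔥 α
  iSup_weights : ⨆ α : Module.Dual ℂ 𝔥, weightSubspace 𝔥 α = ⊤

namespace WeakRootGrading

variable {𝔤}
variable (Γ : WeakRootGrading 𝔤)

/-- The set `R` of roots: the non-zero weights `α` with `𝔤_α ≠ 0`. -/
def roots : Set (Module.Dual ℂ Γ.𝔥) := {α | α ≠ 0 ∧ weightSubspace Γ.𝔥 α ≠ ⊥}

/-- `x ∈ 𝔥` is real if all roots take real values on it. -/
def IsReal (x : Γ.𝔥) : Prop := ∀ α ∈ Γ.roots, (α x).im = 0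

/-- The parabolic system `Σ = {α ∈ R : α(x) ≥ 0}` of a real element `x`. -/
def parabolicSystem (x : Γ.𝔥) : Set (Module.Dual ℂ Γ.𝔥) := {α ∈ Γ.roots | 0 ≤ (α x).re}

/-- `Σ⁺ = {α ∈ R : α(x) > 0}`. -/
def systemPos (x : Γ.𝔥) : Set (Module.Dual ℂ Γ.𝔥) := {α ∈ Γ.roots | 0 < (α x).re}

/-- `Σ⁰ = {α ∈ R : α(x) = 0}`. -/
def systemZero (x : Γ.𝔥) : Set (Module.Dual ℂ Γ.𝔥) := {α ∈ Γ.roots | (α x).re = 0}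

/-- `Σ⁻ = {α ∈ R : α(x) < 0}`. -/
def systemNeg (x : Γ.𝔥) : Set (Module.Dual ℂ Γ.𝔥) := {α ∈ Γ.roots | (α x).re < 0}

/-- If `R = -R`, then `Σ⁺ = Σ \ -Σ`. -/
lemma systemPos_eq (hR : ∀ α ∈ Γ.roots, -α ∈ Γ.roots) (x : Γ.𝔥) :
    Γ.systemPos x = Γ.parabolicSystem x \ {α | -α ∈ Γ.parabolicSystem x} := by
  ext α
  simp only [systemPos, parabolicSystem, mem_ofPred_eq, mem_sdiff, LinearMap.neg_apply,
    Complex.neg_re]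
  constructor
  · rintro ⟨h, h'⟩
    exact ⟨⟨h, h'.le⟩, fun h2 => by linarith [h2.2]⟩
  · rintro ⟨⟨h, h'⟩, h2⟩
    refine ⟨h, lt_of_not_ge fun h3 => h2 ⟨hR α h, by linarith⟩⟩

/-- If `R = -R`, then `Σ⁰ = Σ ∩ -Σ`. -/
lemma systemZero_eq (hR : ∀ α ∈ Γ.roots, -α ∈ Γ.roots) (x : Γ.𝔥) :
    Γ.systemZero x = Γ.parabolicSystem x ∩ {α | -α ∈ Γ.parabolicSystem x} := by
  ext α
  simp only [systemZero, parabolicSystem, mem_ofPred_eq, mem_inter_iff, LinearMap.neg_apply,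
    Complex.neg_re]
  constructor
  · rintro ⟨h, h'⟩
    exact ⟨⟨h, h'.ge⟩, hR α h, by linarith⟩
  · rintro ⟨⟨h, h'⟩, h2⟩
    exact ⟨h, by linarith [h2.2]⟩

/-- `Σ⁻ = R \ Σ`. -/
lemma systemNeg_eq (x : Γ.𝔥) : Γ.systemNeg x = Γ.roots \ Γ.parabolicSystem x := by
  ext α
  simp only [systemNeg, parabolicSystem, mem_ofPred_eq, mem_sdiff]
  constructor
  · rintro ⟨h, h'⟩
    exact ⟨h, fun h2 => by linarith [h2.2]⟩
  · rintro ⟨h, h2⟩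
    exact ⟨h, lt_of_not_ge fun h3 => h2 ⟨h, h3⟩⟩

/-- If `R = -R`, then `Σ⁻ = -Σ⁺`. -/
lemma systemNeg_eq_neg (hR : ∀ α ∈ Γ.roots, -α ∈ Γ.roots) (x : Γ.𝔥) :
    Γ.systemNeg x = {α | -α ∈ Γ.systemPos x} := by
  ext α
  simp only [systemNeg, systemPos, mem_ofPred_eq, LinearMap.neg_apply, Complex.neg_re]
  constructor
  · rintro ⟨h, h'⟩
    exact ⟨hR α h, by linarith⟩
  · rintro ⟨h, h'⟩
    exact ⟨by simpa using hR _ h, by linarith⟩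

/-- The parabolic subalgebra `𝔭 = 𝔤₀ + ∑_{α ∈ Σ} 𝔤_α`. -/
def parabolic (x : Γ.𝔥) : Submodule ℂ 𝔤 :=
  weightSubspace Γ.𝔥 0 ⊔ ⨆ α ∈ Γ.parabolicSystem x, weightSubspace Γ.𝔥 α

/-- `𝔩 = 𝔤₀ + ∑_{α ∈ Σ⁰} 𝔤_α`. -/
def levi (x : Γ.𝔥) : Submodule ℂ 𝔤 :=
  weightSubspace Γ.𝔥 0 ⊔ ⨆ α ∈ Γ.systemZero x, weightSubspace Γ.𝔥 α

/-- `𝔲 = ∑_{α ∈ Σ⁺} 𝔤_α`. -/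
def nilPos (x : Γ.𝔥) : Submodule ℂ 𝔤 := ⨆ α ∈ Γ.systemPos x, weightSubspace Γ.𝔥 α

/-- `𝔫 = ∑_{α ∈ Σ⁻} 𝔤_α`. -/
def nilNeg (x : Γ.𝔥) : Submodule ℂ 𝔤 := ⨆ α ∈ Γ.systemNeg x, weightSubspace Γ.𝔥 α

end WeakRootGrading

end LieAlgebras

/-! ### Complex Banach–Lie groups

A complex Banach–Lie group is a holomorphic Lie group `G` modelled on a complex Banach space `E`.
Its Lie algebra `GroupLieAlgebra 𝓘(ℂ, E) G` is the tangent space at `1`, which is the vector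
space `E` with the bracket of left invariant vector fields. -/

section LieGroups

variable {E : Type*} [NormedAddCommGroup E] [NormedSpace ℂ E]
  {G : Type*} [TopologicalSpace G] [ChartedSpace E G] [Group G]

/-- `γ : ℝ → G` is the one-parameter group with `γ'(0) = x ∈ T₁(G) = E`. -/
def IsOneParameterGroup (γ : ℝ → G) (x : E) : Prop :=
  (∀ s t, γ (s + t) = γ s * γ t) ∧
    HasMFDerivAt 𝓘(ℝ, ℝ) 𝓘(ℝ, E) γ 0 (ContinuousLinearMap.toSpanSingleton ℝ x : ℝ →L[ℝ] E)

open Classical in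
variable (G) in
/-- The exponential function of `G`: `exp_G x = γ(1)` for the one-parameter group `γ` of `G` with
`γ'(0) = x` (which exists and is unique in every Banach–Lie group). -/
noncomputable def lieExp (x : E) : G :=
  if h : ∃ γ : ℝ → G, IsOneParameterGroup γ x then h.choose 1 else 1

/-- The adjoint action `Ad(g)`: the derivative at `1` of the conjugation `h ↦ g h g⁻¹`. -/
noncomputable def lieAd (g : G) :
    GroupLieAlgebra 𝓘(ℂ, E) G →L[ℂ] GroupLieAlgebra 𝓘(ℂ, E) G :=
  (mfderiv 𝓘(ℂ, E) 𝓘(ℂ, E) (fun h : G => g * h * g⁻¹) 1 : E →L[ℂ] E)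

lemma lieAd_hasMFDerivAt [LieGroup 𝓘(ℂ, E) ω G] (g : G) :
    HasMFDerivAt 𝓘(ℂ, E) 𝓘(ℂ, E) (fun h : G => g * h * g⁻¹) 1
      (lieAd g : E →L[ℂ] E) := by
  have h : ContMDiff 𝓘(ℂ, E) 𝓘(ℂ, E) ω (fun h : G => g * h * g⁻¹) :=
    (contMDiff_const.mul contMDiff_id).mul contMDiff_const
  exact ((h 1).mdifferentiableAt (by simp)).hasMFDerivAt

lemma lieAd_one [LieGroup 𝓘(ℂ, E) ω G] :
    lieAd (1 : G) = ContinuousLinearMap.id ℂ (GroupLieAlgebra 𝓘(ℂ, E) G) := by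
  have h : (fun h : G => 1 * h * 1⁻¹) = id := by ext; simp
  have h1 := lieAd_hasMFDerivAt (E := E) (1 : G)
  rw [h] at h1
  exact hasMFDerivAt_unique h1 (hasMFDerivAt_id (1 : G))

lemma lieAd_mul [LieGroup 𝓘(ℂ, E) ω G] (a b : G) :
    lieAd (E := E) (a * b) = (lieAd a).comp (lieAd b) := by
  have hb := lieAd_hasMFDerivAt (E := E) b
  have ha : HasMFDerivAt 𝓘(ℂ, E) 𝓘(ℂ, E) (fun h : G => a * h * a⁻¹) (b * 1 * b⁻¹)
      (lieAd a : E →L[ℂ] E) := by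
    have e : b * 1 * b⁻¹ = 1 := by group
    rw [e]
    exact lieAd_hasMFDerivAt a
  have hc := HasMFDerivAt.comp (1 : G) ha hb
  have e : ((fun h : G => a * h * a⁻¹) ∘ fun h : G => b * h * b⁻¹) =
      fun h : G => (a * b) * h * (a * b)⁻¹ := by
    ext h
    simp [mul_assoc]
  rw [e] at hc
  exact hasMFDerivAt_unique (lieAd_hasMFDerivAt (a * b)) hc

/-- The normalizer `N_G(V) = {g ∈ G : Ad(g) V = V}` of a subspace `V` of the Lie algebra. -/
def adNormalizer [LieGroup 𝓘(ℂ, E) ω G] (V : Submodule ℂ (GroupLieAlgebra 𝓘(ℂ, E) G)) :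
    Subgroup G where
  carrier := {g | lieAd g '' (V : Set (GroupLieAlgebra 𝓘(ℂ, E) G)) = V}
  one_mem' := by
    simp only [mem_ofPred_eq, lieAd_one]
    simp
  mul_mem' := fun {a b} ha hb => by
    simp only [mem_ofPred_eq] at ha hb ⊢
    rw [lieAd_mul, ContinuousLinearMap.coe_comp, image_comp, hb, ha]
  inv_mem' := fun {a} ha => by
    simp only [mem_ofPred_eq] at ha ⊢
    conv_lhs => rw [← ha]
    rw [← image_comp, ← ContinuousLinearMap.coe_comp, ← lieAd_mul, inv_mul_cancel, lieAd_one]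
    simp

/-- A subspace of the Lie algebra of `G`, viewed as a subspace of the normed space `E`. -/
def toModel (V : Submodule ℂ (GroupLieAlgebra 𝓘(ℂ, E) G)) : Submodule ℂ E := V

/-- `H` is a Lie subgroup of `G` with Lie algebra `V`: `H` and `V` are closed,
`V = {x : exp_G(ℝ x) ⊆ H}`, and `exp_G` restricts to a biholomorphic map from some open
`0`-neighborhood `O` onto an open set such that `exp_G(O ∩ V) = exp_G(O) ∩ H`. -/
structure IsLieSubgroup (H : Subgroup G) (V : Submodule ℂ (GroupLieAlgebra 𝓘(ℂ, E) G)) :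
    Prop where
  isClosed : IsClosed (H : Set G)
  isClosed_algebra : IsClosed (toModel V : Set E)
  mem_iff : ∀ x : E, x ∈ toModel V ↔ ∀ t : ℝ, lieExp G (t • x) ∈ H
  adapted : ∃ Φ : OpenPartialHomeomorph E G,
    0 ∈ Φ.source ∧
    (∀ x ∈ Φ.source, Φ x = lieExp G x) ∧
    ContMDiffOn 𝓘(ℂ, E) 𝓘(ℂ, E) ω Φ Φ.source ∧
    ContMDiffOn 𝓘(ℂ, E) 𝓘(ℂ, E) ω Φ.symm Φ.target ∧
    lieExp G '' (Φ.source ∩ toModel V) = lieExp G '' Φ.source ∩ H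

/-- The given atlas on `H` (with its subspace topology) is the one of the Lie subgroup `H` of `G`
with Lie algebra `V`: it turns `H` into a complex Banach–Lie group modelled on `V` for which the
inclusion into `G` is holomorphic, and the derivative of the inclusion at `1` is the inclusion of
`V`, so that `T₁(H)` is identified with `V`. -/
structure IsLieSubgroupAtlas (H : Subgroup G) (V : Submodule ℂ (GroupLieAlgebra 𝓘(ℂ, E) G))
    [ChartedSpace (toModel V) H] : Prop where
  lieGroup : LieGroup 𝓘(ℂ, toModel V) ω H
  contMDiff_incl : ContMDiff 𝓘(ℂ, toModel V) 𝓘(ℂ, E) ω (Subtype.val : H → G)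
  hasMFDerivAt_incl : HasMFDerivAt 𝓘(ℂ, toModel V) 𝓘(ℂ, E) (Subtype.val : H → G) 1
    ((toModel V).subtypeL : toModel V →L[ℂ] E)

end LieGroups

/-! ### Biholomorphic maps -/

section Biholomorphic

variable {E₁ E₂ H₁ H₂ M₁ M₂ : Type*}
  [NormedAddCommGroup E₁] [NormedSpace ℂ E₁] [TopologicalSpace H₁]
  [NormedAddCommGroup E₂] [NormedSpace ℂ E₂] [TopologicalSpace H₂]
  [TopologicalSpace M₁] [ChartedSpace H₁ M₁] [TopologicalSpace M₂] [ChartedSpace H₂ M₂]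

/-- `f` is biholomorphic: a holomorphic bijection with holomorphic inverse. -/
def IsBiholomorphic (I₁ : ModelWithCorners ℂ E₁ H₁) (I₂ : ModelWithCorners ℂ E₂ H₂)
    (f : M₁ → M₂) : Prop :=
  ∃ e : Diffeomorph I₁ I₂ M₁ M₂ ω, ⇑e = f

/-- `f` is biholomorphic onto an open subset: it is holomorphic with open range, and has a
holomorphic inverse on its range. -/
def IsBiholomorphicOntoOpen (I₁ : ModelWithCorners ℂ E₁ H₁) (I₂ : ModelWithCorners ℂ E₂ H₂)
    (f : M₁ → M₂) : Prop :=
  IsOpen (range f) ∧ ContMDiff I₁ I₂ ω f ∧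
    ∃ g : M₂ → M₁, (∀ x, g (f x) = x) ∧ ContMDiffOn I₂ I₁ ω g (range f)

end Biholomorphic

/-! ### Parabolic subgroups -/

section Parabolic

variable {E : Type*} [NormedAddCommGroup E] [NormedSpace ℂ E] [CompleteSpace E]
  {G : Type*} [TopologicalSpace G] [ChartedSpace E G] [Group G] [LieGroup 𝓘(ℂ, E) ω G]

/-- A parabolic subgroup: an open subgroup `P` of `N_G(𝔭)`. -/
def IsParabolicSubgroup (Γ : WeakRootGrading (GroupLieAlgebra 𝓘(ℂ, E) G)) (x : Γ.𝔥)
    (P : Subgroup G) : Prop :=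
  P ≤ adNormalizer (Γ.parabolic x) ∧
    IsOpen (P.subgroupOf (adNormalizer (Γ.parabolic x)) : Set (adNormalizer (Γ.parabolic x)))

/-- `L = P ∩ N_G(𝔩) ∩ N_G(𝔫)`. -/
noncomputable def leviSubgroup (Γ : WeakRootGrading (GroupLieAlgebra 𝓘(ℂ, E) G)) (x : Γ.𝔥)
    (P : Subgroup G) : Subgroup G :=
  P ⊓ adNormalizer (Γ.levi x) ⊓ adNormalizer (Γ.nilNeg x)

end Parabolic

/-! Everything is governed by the single operator `D = ad x`. The algebra `𝔤` is a finite sum of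
weight spaces and `x` acts on `𝔤_α` by the real number `α(x)`, so `D` is diagonalizable with
finitely many real eigenvalues. The subspaces `𝔭`, `𝔩`, `𝔲`, `𝔫` are the sums of the eigenspaces for
the eigenvalues `≥ 0`, `= 0`, `> 0`, `< 0`. Polynomials in `D` provide continuous projections onto
them and the operators `exp(tD) = Ad(exp tx)`. After this translation no roots remain, and
`exists_parabolic_structure` is a statement about `D` alone.

The group `U` is controlled by the orbit of `x`. The map `u ↦ Ad(exp u)x - x` sends `𝔲` to `𝔲`, its
derivative at `0` is `-D|𝔲`, which is invertible, and it commutes with `exp(tD)`. As `t → -∞` these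
operators contract `𝔲` pointwise to `0`, so the local inverse at `0` spreads to a global analytic
inverse. This yields an analytic `σ : G → 𝔲` with `σ(exp u) = u` (`exists_unipotent_coordinate`),
hence the biholomorphy of the exponential function and the closedness of `U`. The same contraction
shows that `U` is closed under products, without a Baker–Campbell–Hausdorff series. The group `N` is
the same construction for `-x`.

The groups `P` and `L` are closed subgroups of the normalizers of `𝔭` and `𝔩`. If `y` is small and
`exp y` normalizes such a subspace, then `exp(ad y)` preserves it, hence so does `ad y`
(`eventually_invariant_of_exp_invariant`). As the subspace contains `x`, it contains `[y, x]`, and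
therefore `y`, because the eigenvalue `0` belongs to it. So the Lie algebras are not larger than
expected.

For the product maps, an element of `N ∩ P` moves `x` by an element of `𝔫 ∩ 𝔭 = 0`, and `N` acts
freely on `x`; hence `N ∩ P = 1`, and likewise `U ∩ L = 1`. This gives injectivity. Holomorphic
local sections exist at `1` by the inverse function theorem (`exists_triangular_coordinate`) and are
carried to all other points by translation.

The Lie theory underneath is built from the differential equation of left invariant vector fields:
the existence and analyticity of the exponential function, `Ad(exp y) = exp(ad y)`, the
identification of the bracket with the derivative of `Ad`, and the atlas of a Lie subgroup with
complemented Lie algebra. -/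

set_option linter.unusedSectionVars false

/-! ### Analyticity of superposition operators on spaces of continuous functions. -/

section Nemytskii

open Filter

variable {K : Type*} [TopologicalSpace K] [CompactSpace K]
  {E F : Type*} [NormedAddCommGroup E] [NormedSpace ℂ E] [NormedAddCommGroup F] [NormedSpace ℂ F]

/-- A continuous multilinear map acts pointwise on continuous functions. -/
noncomputable def ContinuousMultilinearMap.pointwise (K : Type*) [TopologicalSpace K]
    [CompactSpace K] {n : ℕ} (p : E [×n]→L[ℂ] F) : C(K, E) [×n]→L[ℂ] C(K, F) :=
  MultilinearMap.mkContinuous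
    { toFun := fun g => ⟨fun s => p fun i => g i s, by fun_prop⟩
      map_update_add' := fun g i a b => by
        ext s
        have (c : C(K, E)) : (fun j => (Function.update g i c) j s) =
            Function.update (fun j => g j s) i (c s) := by
          ext j
          by_cases h : j = i
          · subst h; simp
          · simp [h]
        simp [this]
      map_update_smul' := fun g i c a => by
        ext s
        have (c : C(K, E)) : (fun j => (Function.update g i c) j s) =
            Function.update (fun j => g j s) i (c s) := by
          ext j
          by_cases h : j = i
          · subst h; simp
          · simp [h]
        simp [this] } ‖p‖ (fun g => by
      rw [ContinuousMap.norm_le _ (by positivity)]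
      intro s
      refine (p.le_opNorm _).trans ?_
      gcongr with i
      exact (g i).norm_coe_le_norm s)

lemma ContinuousMultilinearMap.norm_pointwise_le {n : ℕ} (p : E [×n]→L[ℂ] F) :
    ‖p.pointwise K‖ ≤ ‖p‖ :=
  MultilinearMap.mkContinuous_norm_le _ (norm_nonneg _) _

/-- The superposition operator `g ↦ f ∘ g` on continuous functions on a compact space is analytic
at `0` if `f` is. -/
theorem exists_analyticAt_superposition [CompleteSpace F] {f : E → F} (hf : AnalyticAt ℂ f 0) :
    ∃ N : C(K, E) → C(K, F), AnalyticAt ℂ N 0 ∧ (∀ᶠ g in 𝓝 0, ∀ s, N g s = f (g s)) ∧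
      ∀ g s, fderiv ℂ N 0 g s = fderiv ℂ f 0 (g s) := by
  obtain ⟨p, r, hp⟩ := hf
  let P : FormalMultilinearSeries ℂ C(K, E) C(K, F) := fun n => (p n).pointwise K
  have hr : r ≤ P.radius := by
    refine hp.r_le.trans ?_
    refine ENNReal.le_of_forall_nnreal_lt fun ρ hρ => ?_
    obtain ⟨C, -, hC⟩ := p.norm_mul_pow_le_of_lt_radius hρ
    refine P.le_radius_of_bound C fun n => le_trans ?_ (hC n)
    gcongr
    exact (p n).norm_pointwise_le
  have hP : HasFPowerSeriesOnBall P.sum P 0 P.radius :=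
    P.hasFPowerSeriesOnBall (hp.r_pos.trans_le hr)
  have hN : ∀ᶠ g in 𝓝 (0 : C(K, E)), ∀ s, P.sum g s = f (g s) := by
    filter_upwards [Metric.eball_mem_nhds (0 : C(K, E)) hp.r_pos] with g hg s
    have h1 := hP.hasSum (Metric.eball_subset_eball hr hg)
    rw [zero_add] at h1
    have h2 := (ContinuousMap.evalCLM ℂ s : C(K, F) →L[ℂ] F).hasSum h1
    have hgs : g s ∈ Metric.eball (0 : E) r := by
      rw [Metric.mem_eball, edist_zero_right] at hg ⊢
      refine lt_of_le_of_lt ?_ hg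
      rw [enorm_le_iff_norm_le]
      exact g.norm_coe_le_norm s
    have h3 := hp.hasSum hgs
    rw [zero_add] at h3
    exact h2.unique h3
  refine ⟨P.sum, hP.analyticAt, hN, fun g s => ?_⟩
  have hd := hP.analyticAt.differentiableAt.hasFDerivAt
  -- Evaluation at `s` is linear and intertwines `P.sum` with `f` near `0`, so the chain rule on
  -- both sides computes the derivative pointwise.
  have h1 := (ContinuousMap.evalCLM ℂ s : C(K, F) →L[ℂ] F).hasFDerivAt.comp (0 : C(K, E)) hd
  have hf' : HasFDerivAt f (fderiv ℂ f 0) ((ContinuousMap.evalCLM ℂ s : C(K, E) →L[ℂ] E) 0) := by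
    rw [map_zero]
    exact hp.analyticAt.differentiableAt.hasFDerivAt
  have h2 := hf'.comp (0 : C(K, E)) (ContinuousMap.evalCLM ℂ s : C(K, E) →L[ℂ] E).hasFDerivAt
  have h3 := h1.congr_of_eventuallyEq (f₁ := f ∘ (ContinuousMap.evalCLM ℂ s : C(K, E) →L[ℂ] E))
    (by filter_upwards [hN] with g hg using (hg s).symm)
  exact DFunLike.congr_fun (h3.unique h2) g

end Nemytskii

/-! ### Analytic dependence of solutions of ordinary differential equations on a parameter. -/

section Flow

open Filter MeasureTheory

variable {E : Type*} [NormedAddCommGroup E] [NormedSpace ℂ E] [CompleteSpace E]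

/-- The primitive vanishing at `0` of a continuous function on `[-1, 1]`, extended to `ℝ`. -/
noncomputable def primitive (g : C(Icc (-1 : ℝ) 1, E)) (t : ℝ) : E :=
  ∫ s in (0 : ℝ)..t, g (projIcc (-1) 1 (by norm_num) s)

lemma hasDerivAt_primitive (g : C(Icc (-1 : ℝ) 1, E)) (t : ℝ) :
    HasDerivAt (primitive g) (g (projIcc (-1) 1 (by norm_num) t)) t := by
  have hc : Continuous fun s : ℝ => g (projIcc (-1) 1 (by norm_num) s) :=
    g.continuous.comp continuous_projIcc
  exact intervalIntegral.integral_hasDerivAt_right (hc.intervalIntegrable _ _)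
    (hc.stronglyMeasurableAtFilter _ _) hc.continuousAt

/-- The primitive vanishing at `0`, as an operator on continuous functions. -/
noncomputable def primitiveCLM : C(Icc (-1 : ℝ) 1, E) →L[ℂ] C(Icc (-1 : ℝ) 1, E) :=
  LinearMap.mkContinuous
    { toFun := fun g => ⟨fun t => primitive g t,
        (continuous_iff_continuousAt.2 fun t =>
          (hasDerivAt_primitive g t).continuousAt).comp continuous_subtype_val⟩
      map_add' := fun g h => by
        ext t
        have hc (g : C(Icc (-1 : ℝ) 1, E)) :
            Continuous fun s : ℝ => g (projIcc (-1) 1 (by norm_num) s) :=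
          g.continuous.comp continuous_projIcc
        exact intervalIntegral.integral_add ((hc g).intervalIntegrable _ _)
          ((hc h).intervalIntegrable _ _)
      map_smul' := fun c g => by
        ext t
        exact intervalIntegral.integral_smul c _ } 1 (fun g => by
      rw [ContinuousMap.norm_le _ (by positivity)]
      intro t
      have h := intervalIntegral.norm_integral_le_of_norm_le_const (a := 0) (b := t)
        (f := fun s => g (projIcc (-1) 1 (by norm_num) s)) (C := ‖g‖)
        (fun s _ => g.norm_coe_le_norm _)
      refine h.trans ?_
      rw [mul_comm]
      gcongr
      rw [sub_zero, abs_le]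
      exact t.2)

/-- The solutions of `γ' = f(γ, y)`, `γ(0) = 0`, on `[-1, 1]`, for an analytic `f` that vanishes on
`E × {0}`, exist for small `y` and depend analytically on `y`. -/
theorem exists_analytic_flow {f : E × E → E} (hf : AnalyticAt ℂ f 0)
    (h0 : ∀ᶠ a in 𝓝 (0 : E), f (a, 0) = 0) :
    ∃ γ : E → ℝ → E, (∀ y, γ y 0 = 0) ∧
      (∀ᶠ y in 𝓝 0, ∀ t ∈ Icc (-1 : ℝ) 1, HasDerivAt (γ y) (f (γ y t, y)) t) ∧
      (∀ W ∈ 𝓝 (0 : E), ∀ᶠ y in 𝓝 0, ∀ t ∈ Icc (-1 : ℝ) 1, γ y t ∈ W) ∧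
      AnalyticAt ℂ (fun y => γ y 1) 0 := by
  obtain ⟨N, hN, hNf, hN'⟩ := exists_analyticAt_superposition (K := Icc (-1 : ℝ) 1) hf
  -- Since `f` vanishes along `E × {0}`, its derivative in the unknown function is zero at the
  -- origin. This makes the partial derivative of the integral equation below the identity.
  have hfd (a : E) : fderiv ℂ f 0 (a, 0) = 0 := by
    have h1 : HasFDerivAt f (fderiv ℂ f 0) (ContinuousLinearMap.inl ℂ E E 0) :=
      hf.differentiableAt.hasFDerivAt
    have h2 : HasFDerivAt (fun a : E => f (a, 0))
        ((fderiv ℂ f 0).comp (ContinuousLinearMap.inl ℂ E E)) 0 := by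
      have := HasFDerivAt.comp (g := f) (0 : E) h1
        (ContinuousLinearMap.inl ℂ E E).hasFDerivAt
      exact this
    have h3 : HasFDerivAt (fun a : E => f (a, 0)) (0 : E →L[ℂ] E) 0 :=
      (hasFDerivAt_const (0 : E) (0 : E)).congr_of_eventuallyEq h0
    simpa using DFunLike.congr_fun (h2.unique h3) a
  let C := C(Icc (-1 : ℝ) 1, E)
  -- the pair `(γ, y)` as a continuous function with values in `E × E`
  let J : E × C →L[ℂ] C(Icc (-1 : ℝ) 1, E × E) := LinearMap.mkContinuous
    { toFun := fun q => ⟨fun t => (q.2 t, q.1), by fun_prop⟩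
      map_add' := fun _ _ => rfl
      map_smul' := fun _ _ => rfl } 1 (fun q => by
        rw [ContinuousMap.norm_le _ (by positivity)]
        intro t
        rw [one_mul]
        refine max_le ?_ (le_max_left _ _)
        exact (q.2.norm_coe_le_norm t).trans (le_max_right _ _))
  have hJ (q : E × C) (t) : J q t = (q.2 t, q.1) := rfl
  -- For small arguments, the zeros of `Φ (y, ·)` are the solutions of the integral equation `γ(t) =
  -- ∫₀ᵗ f(γ, y)`. The implicit function theorem solves it for `γ` near the zero solution at `y =
  -- 0`.
  let Φ : E × C → C := fun q => q.2 - primitiveCLM (N (J q))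
  have hNJ : AnalyticAt ℂ (fun q : E × C => N (J q)) 0 :=
    AnalyticAt.comp (g := N) (by simpa using hN) (J.analyticAt 0)
  have hΦ : AnalyticAt ℂ Φ 0 :=
    analyticAt_snd.sub ((primitiveCLM (E := E)).analyticAt _ |>.comp hNJ)
  have hΦ' : fderiv ℂ Φ 0 ∘L .inr ℂ E C = ContinuousLinearMap.id ℂ C := by
    have h1 : HasFDerivAt Φ (ContinuousLinearMap.snd ℂ E C -
        primitiveCLM ∘L (fderiv ℂ N 0) ∘L J) 0 := by
      refine hasFDerivAt_snd.sub ?_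
      refine (primitiveCLM (E := E)).hasFDerivAt.comp (0 : E × C) ?_
      refine HasFDerivAt.comp (g := N) (0 : E × C) ?_ J.hasFDerivAt
      rw [map_zero]
      exact hN.differentiableAt.hasFDerivAt
    rw [h1.fderiv]
    ext g t
    have : fderiv ℂ N 0 (J (0, g)) = 0 := by
      ext s
      rw [hN', hJ]
      exact hfd _
    simp [this]
  have hinv : (fderiv ℂ Φ 0 ∘L .inr ℂ E C).IsInvertible := by
    rw [hΦ']
    exact ⟨ContinuousLinearEquiv.refl ℂ C, rfl⟩
  have hΦc : ContDiffAt ℂ ω Φ 0 := hΦ.contDiffAt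
  have hN0 : N 0 = 0 := by
    ext t
    rw [hNf.self_of_nhds t]
    exact h0.self_of_nhds
  have hΦ0 : Φ 0 = 0 := by simp [Φ, hN0]
  let ψ : E → C := hΦc.implicitFunction (by simp) hinv
  have hψ : ContDiffAt ℂ ω ψ 0 := hΦc.contDiffAt_implicitFunction (by simp) hinv
  have hψ0 : ψ 0 = 0 := hΦc.implicitFunction_apply_self (by simp) hinv
  have hψΦ : ∀ᶠ y in 𝓝 (0 : E), Φ (y, ψ y) = 0 := by
    have := hΦc.eventually_apply_implicitFunction (by simp) hinv
    rwa [hΦ0] at this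
  have hψc : Tendsto (fun y => (y, ψ y)) (𝓝 0) (𝓝 (0 : E × C)) := by
    have := (continuousAt_id (x := (0 : E))).prodMk hψ.continuousAt
    simpa [ContinuousAt, hψ0] using! this
  have hJψ : Tendsto (fun y => J (y, ψ y)) (𝓝 0) (𝓝 0) := by
    have := (J.continuous.tendsto 0).comp hψc
    simpa using! this
  have hψe : ∀ᶠ y in 𝓝 (0 : E), ψ y = primitiveCLM (N (J (y, ψ y))) :=
    hψΦ.mono fun y hy => sub_eq_zero.1 hy
  -- The primitive agrees with `ψ y` on `[-1, 1]` but is defined on all of `ℝ`, so that it has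
  -- two-sided derivatives at the endpoints as well.
  refine ⟨fun y => primitive (N (J (y, ψ y))), fun y => intervalIntegral.integral_same, ?_, ?_, ?_⟩
  · filter_upwards [hψe, hJψ.eventually hNf] with y hy hy2 t ht
    have h := hasDerivAt_primitive (N (J (y, ψ y))) t
    rw [projIcc_of_mem _ ht, hy2, hJ] at h
    have e : ψ y ⟨t, ht⟩ = primitive (N (J (y, ψ y))) t := by
      conv_lhs => rw [hy]
      rfl
    rwa [e] at h
  · intro W hW
    obtain ⟨ε, hε, hWε⟩ := Metric.mem_nhds_iff.1 hW
    have hψ0' : Tendsto ψ (𝓝 0) (𝓝 0) := by simpa [ContinuousAt, hψ0] using! hψ.continuousAt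
    filter_upwards [hψe, hψ0'.eventually (Metric.ball_mem_nhds 0 hε)] with y hy hy2 t ht
    refine hWε ?_
    have e : ψ y ⟨t, ht⟩ = primitive (N (J (y, ψ y))) t := by
      conv_lhs => rw [hy]
      rfl
    rw [← e, mem_ball_zero_iff]
    exact ((ψ y).norm_coe_le_norm _).trans_lt (mem_ball_zero_iff.1 hy2)
  · have h1 : AnalyticAt ℂ ψ 0 := hψ.analyticAt
    have h2 : AnalyticAt ℂ (fun y => ψ y ⟨1, by norm_num⟩) 0 :=
      ((ContinuousMap.evalCLM ℂ (⟨1, by norm_num⟩ : Icc (-1 : ℝ) 1) : C →L[ℂ] E).analyticAt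
        (ψ 0)).comp h1
    refine h2.congr ?_
    filter_upwards [hψe] with y hy
    conv_lhs => rw [hy]
    rfl

end Flow

/-! ### Coordinates at the unit element and left logarithmic derivatives. -/

section Coordinates

open Filter

variable {E : Type*} [NormedAddCommGroup E] [NormedSpace ℂ E]
  {G : Type*} [TopologicalSpace G] [ChartedSpace E G] [Group G]

/-- The coordinate at the unit element, centered at `0`. -/
noncomputable def unitCoord (g : G) : E := chartAt E (1 : G) g - chartAt E (1 : G) 1

variable (G) in
/-- The inverse of the centered coordinate at the unit element. -/
noncomputable def unitPoint (a : E) : G := (chartAt E (1 : G)).symm (a + chartAt E (1 : G) 1)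

variable (E G) in
/-- The domain of the coordinate at the unit element. -/
def unitDomain : Set G := (chartAt E (1 : G)).source

lemma isOpen_unitDomain : IsOpen (unitDomain E G) := (chartAt E (1 : G)).open_source

lemma one_mem_unitDomain : (1 : G) ∈ unitDomain E G := mem_chart_source E (1 : G)

lemma unitDomain_mem_nhds : unitDomain E G ∈ 𝓝 (1 : G) :=
  isOpen_unitDomain.mem_nhds one_mem_unitDomain

@[simp] lemma unitCoord_one : (unitCoord (1 : G) : E) = 0 := sub_self _

@[simp] lemma unitPoint_zero : unitPoint G (0 : E) = 1 := by
  rw [unitPoint, zero_add]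
  exact (chartAt E (1 : G)).left_inv (mem_chart_source E (1 : G))

lemma unitPoint_unitCoord {g : G} (hg : g ∈ unitDomain E G) :
    unitPoint G (unitCoord g : E) = g := by
  rw [unitPoint, unitCoord, sub_add_cancel]
  exact (chartAt E (1 : G)).left_inv hg

lemma eventually_add_mem_target :
    ∀ᶠ a in 𝓝 (0 : E), a + chartAt E (1 : G) 1 ∈ (chartAt E (1 : G)).target := by
  have h : Continuous fun a : E => a + chartAt E (1 : G) 1 := by fun_prop
  refine h.continuousAt.preimage_mem_nhds ?_
  rw [zero_add]
  exact chart_target_mem_nhds E (1 : G)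

lemma eventually_unitCoord_unitPoint :
    ∀ᶠ a in 𝓝 (0 : E), unitCoord (unitPoint G a) = a := by
  filter_upwards [eventually_add_mem_target (G := G)] with a ha
  rw [unitPoint, unitCoord, (chartAt E (1 : G)).right_inv ha, add_sub_cancel_right]

lemma eventually_unitPoint_mem :
    ∀ᶠ a in 𝓝 (0 : E), unitPoint G a ∈ unitDomain E G := by
  filter_upwards [eventually_add_mem_target (G := G)] with a ha
  exact (chartAt E (1 : G)).map_target ha

lemma continuousAt_unitCoord {g : G} (hg : g ∈ unitDomain E G) :
    ContinuousAt (unitCoord : G → E) g :=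
  ((chartAt E (1 : G)).continuousAt hg).sub continuousAt_const

/-- The coordinate `unitCoord` is the preferred chart at `1` up to a translation, which does not
affect derivatives. This reduces derivatives at `1` to calculus in the model space. -/
lemma hasMFDerivAt_real_iff {γ : ℝ → G} {x : E} (h0 : γ 0 = 1) :
    HasMFDerivAt 𝓘(ℝ, ℝ) 𝓘(ℝ, E) γ 0 (ContinuousLinearMap.toSpanSingleton ℝ x : ℝ →L[ℝ] E) ↔
      ContinuousAt γ 0 ∧ HasDerivAt (fun t => (unitCoord (γ t) : E)) x 0 := by
  simp only [HasMFDerivAt, writtenInExtChartAt, unitCoord, h0]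
  simp only [mfld_simps]
  refine and_congr Iff.rfl ?_
  rw [hasDerivAt_sub_const_iff]
  exact hasFDerivWithinAt_univ (𝕜 := ℝ) (E := ℝ) (F := E) (f := fun t => chartAt E (1 : G) (γ t))
    (f' := ContinuousLinearMap.toSpanSingleton ℝ x) (x := 0)

section Manifold

variable [IsManifold 𝓘(ℂ, E) ω G]

lemma contMDiffAt_unitCoord {g : G} (hg : g ∈ unitDomain E G) :
    ContMDiffAt 𝓘(ℂ, E) 𝓘(ℂ, E) ω (unitCoord : G → E) g := by
  have h := contMDiffAt_of_mem_maximalAtlas (I := 𝓘(ℂ, E)) (n := ω)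
    (IsManifold.chart_mem_maximalAtlas (1 : G)) hg
  exact h.sub contMDiffAt_const

lemma eventually_contMDiffAt_unitPoint :
    ∀ᶠ a in 𝓝 (0 : E), ContMDiffAt 𝓘(ℂ, E) 𝓘(ℂ, E) ω (unitPoint G) a := by
  filter_upwards [eventually_add_mem_target (G := G)] with a ha
  have h := contMDiffAt_symm_of_mem_maximalAtlas (I := 𝓘(ℂ, E)) (n := ω)
    (IsManifold.chart_mem_maximalAtlas (1 : G)) ha
  refine ContMDiffAt.comp (g := (chartAt E (1 : G)).symm)
    (f := fun a : E => a + chartAt E (1 : G) 1) a h ?_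
  exact contMDiffAt_id.add contMDiffAt_const

lemma contMDiffAt_unitPoint_zero : ContMDiffAt 𝓘(ℂ, E) 𝓘(ℂ, E) ω (unitPoint G) (0 : E) :=
  eventually_contMDiffAt_unitPoint.self_of_nhds

lemma contDiffAt_unitCoord_comp {F : Type*} [NormedAddCommGroup F] [NormedSpace ℂ F] {f : F → G}
    {p : F} (hf : ContMDiffAt 𝓘(ℂ, F) 𝓘(ℂ, E) ω f p) (hp : f p ∈ unitDomain E G) :
    ContDiffAt ℂ ω (fun q => (unitCoord (f q) : E)) p :=
  contMDiffAt_iff_contDiffAt.1 ((contMDiffAt_unitCoord hp).comp p hf)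

lemma hasMFDerivAt_complex_iff {F : Type*} [NormedAddCommGroup F] [NormedSpace ℂ F] {f : F → G}
    {p : F} {f' : F →L[ℂ] E} (h0 : f p = 1) :
    HasMFDerivAt 𝓘(ℂ, F) 𝓘(ℂ, E) f p f' ↔
      ContinuousAt f p ∧ HasFDerivAt (fun t => (unitCoord (f t) : E)) f' p := by
  simp only [HasMFDerivAt, writtenInExtChartAt, unitCoord, h0]
  simp only [mfld_simps]
  refine and_congr Iff.rfl ?_
  rw [hasFDerivAt_sub_const_iff]
  exact hasFDerivWithinAt_univ (𝕜 := ℂ) (E := F) (F := E) (f := fun t => chartAt E (1 : G) (f t))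
    (f' := f') (x := p)

end Manifold

/-- The curve `h` has left logarithmic derivative `y` at `t`. -/
def HasLeftLogDerivAt (h : ℝ → G) (y : E) (t : ℝ) : Prop :=
  ContinuousAt h t ∧ HasDerivAt (fun ε => (unitCoord ((h t)⁻¹ * h (t + ε)) : E)) y 0

lemma IsOneParameterGroup.map_zero {γ : ℝ → G} {x : E} (h : IsOneParameterGroup γ x) :
    γ 0 = 1 := by
  have := h.1 0 0
  simpa using this

lemma isOneParameterGroup_iff {γ : ℝ → G} {x : E} : IsOneParameterGroup γ x ↔
    (∀ s t, γ (s + t) = γ s * γ t) ∧ HasLeftLogDerivAt γ x 0 := by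
  refine and_congr_right fun h => ?_
  have h0 : γ 0 = 1 := by simpa using h 0 0
  rw [hasMFDerivAt_real_iff h0]
  simp [HasLeftLogDerivAt, h0]

lemma IsOneParameterGroup.hasLeftLogDerivAt [ContinuousMul G] {γ : ℝ → G} {x : E}
    (h : IsOneParameterGroup γ x) (t : ℝ) : HasLeftLogDerivAt γ x t := by
  have h1 := isOneParameterGroup_iff.1 h
  constructor
  · have e : γ = fun s => γ t * γ (s - t) := by
      ext s
      rw [← h.1]
      congr 1
      ring
    rw [e]
    refine continuousAt_const.mul ?_
    refine ContinuousAt.comp (g := γ) (f := fun s => s - t) ?_ (by fun_prop)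
    rw [sub_self]
    exact h1.2.1
  · have h2 := h1.2.2
    simp only [zero_add, h.map_zero, inv_one, one_mul] at h2
    have e : (fun ε => (unitCoord ((γ t)⁻¹ * γ (t + ε)) : E)) = fun ε => unitCoord (γ ε) := by
      ext ε
      rw [h.1, inv_mul_cancel_left]
    rwa [e]

/-! ### Uniqueness of curves with a given left logarithmic derivative. -/

section LieGroup

variable [LieGroup 𝓘(ℂ, E) ω G]

/-- Infinitesimally both curves are multiplied on the right by the same element `k`, which cancels
in `h₂ k k⁻¹ h₁⁻¹`. It is the infinitesimal form of the uniqueness of integral curves. -/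
lemma hasDerivAt_mul_inv_of_hasLeftLogDerivAt {h₁ h₂ : ℝ → G} {y : E} {t : ℝ}
    (H₁ : HasLeftLogDerivAt h₁ y t) (H₂ : HasLeftLogDerivAt h₂ y t)
    (hW : h₂ t * (h₁ t)⁻¹ ∈ unitDomain E G) :
    HasDerivAt (fun s => (unitCoord (h₂ s * (h₁ s)⁻¹) : E)) 0 t := by
  have := topologicalGroup_of_lieGroup 𝓘(ℂ, E) ω (G := G)
  have hk {h : ℝ → G} (H : HasLeftLogDerivAt h y t) :
      Tendsto (fun ε => (h t)⁻¹ * h (t + ε)) (𝓝 0) (𝓝 1) := by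
    have : ContinuousAt (fun ε => (h t)⁻¹ * h (t + ε)) 0 := by
      refine continuousAt_const.mul (ContinuousAt.comp (g := h) ?_ (by fun_prop))
      rw [add_zero]
      exact H.1
    simpa [ContinuousAt] using! this
  -- the coordinate expression of `(k₂, k₁) ↦ h₂(t) k₂ k₁⁻¹ h₁(t)⁻¹`
  let d : E × E → E := fun q =>
    unitCoord (h₂ t * (unitPoint G q.1 * (unitPoint G q.2)⁻¹) * (h₁ t)⁻¹)
  have hd : ContDiffAt ℂ ω d 0 := by
    refine contDiffAt_unitCoord_comp ?_ (by simpa using hW)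
    have h1 : ContMDiffAt 𝓘(ℂ, E × E) 𝓘(ℂ, E) ω (fun q : E × E => unitPoint G q.1) 0 :=
      ContMDiffAt.comp (g := unitPoint G) (f := Prod.fst) (0 : E × E) contMDiffAt_unitPoint_zero
        contDiffAt_fst.contMDiffAt
    have h2 : ContMDiffAt 𝓘(ℂ, E × E) 𝓘(ℂ, E) ω (fun q : E × E => unitPoint G q.2) 0 :=
      ContMDiffAt.comp (g := unitPoint G) (f := Prod.snd) (0 : E × E) contMDiffAt_unitPoint_zero
        contDiffAt_snd.contMDiffAt
    exact (contMDiffAt_const.mul (h1.mul h2.inv)).mul contMDiffAt_const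
  have hd' : HasFDerivAt d (fderiv ℂ d 0) 0 := (hd.differentiableAt (by simp)).hasFDerivAt
  -- On the diagonal the two small factors cancel, so `d` is constant there and its derivative kills
  -- `(y, y)`.
  have hd0 : fderiv ℂ d 0 (y, y) = 0 := by
    have h1 : HasFDerivAt d (fderiv ℂ d 0)
        ((ContinuousLinearMap.id ℂ E).prod (ContinuousLinearMap.id ℂ E) 0) := hd'
    have h2 := h1.comp (0 : E)
      ((ContinuousLinearMap.id ℂ E).prod (ContinuousLinearMap.id ℂ E)).hasFDerivAt
    have e : d ∘ ((ContinuousLinearMap.id ℂ E).prod (ContinuousLinearMap.id ℂ E)) =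
        fun _ => unitCoord (h₂ t * (h₁ t)⁻¹) := by
      ext a
      simp [d]
    rw [e] at h2
    have h3 := h2.unique (hasFDerivAt_const _ _)
    simpa using DFunLike.congr_fun h3 y
  have hcurve := H₂.2.prodMk H₁.2
  have h4 := (hd'.restrictScalars ℝ).comp_hasDerivAt_of_eq (0 : ℝ) hcurve (by simp; rfl)
  rw [ContinuousLinearMap.coe_restrictScalars', hd0] at h4
  have h5 : HasDerivAt (fun ε => (unitCoord (h₂ (t + ε) * (h₁ (t + ε))⁻¹) : E)) 0 (t - t) := by
    rw [sub_self]
    refine h4.congr_of_eventuallyEq ?_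
    filter_upwards [(hk H₁).eventually (unitDomain_mem_nhds (E := E)),
      (hk H₂).eventually (unitDomain_mem_nhds (E := E))] with ε e₁ e₂
    simp only [Function.comp_apply, d]
    rw [unitPoint_unitCoord e₁, unitPoint_unitCoord e₂]
    congr 1
    group
  simpa using! h5.comp_sub_const t t

/-- Curves with the same left logarithmic derivative that agree at one point agree, as long as they
remain close. -/
theorem eqOn_of_hasLeftLogDerivAt {h₁ h₂ : ℝ → G} {y : E} {S : Set ℝ} (hS : Convex ℝ S) {t₀ : ℝ}
    (ht₀ : t₀ ∈ S) (h0 : h₁ t₀ = h₂ t₀) (H₁ : ∀ t ∈ S, HasLeftLogDerivAt h₁ y t)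
    (H₂ : ∀ t ∈ S, HasLeftLogDerivAt h₂ y t)
    (hW : ∀ t ∈ S, h₂ t * (h₁ t)⁻¹ ∈ unitDomain E G) : EqOn h₁ h₂ S := by
  intro t ht
  have h := hS.norm_image_sub_le_of_norm_hasDerivWithin_le (C := 0) (fun s hs =>
    (hasDerivAt_mul_inv_of_hasLeftLogDerivAt (H₁ s hs) (H₂ s hs) (hW s hs)).hasDerivWithinAt)
    (fun s _ => by simp) ht₀ ht
  rw [zero_mul, norm_le_zero_iff, sub_eq_zero, h0, mul_inv_cancel, unitCoord_one] at h
  have h2 := unitPoint_unitCoord (hW t ht)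
  rw [h, unitPoint_zero] at h2
  exact (mul_inv_eq_one.1 h2.symm).symm

/-- One-parameter groups are determined by their derivative. -/
theorem IsOneParameterGroup.unique {γ₁ γ₂ : ℝ → G} {x : E} (h₁ : IsOneParameterGroup γ₁ x)
    (h₂ : IsOneParameterGroup γ₂ x) : γ₁ = γ₂ := by
  have := topologicalGroup_of_lieGroup 𝓘(ℂ, E) ω (G := G)
  have hc : ContinuousAt (fun t => γ₂ t * (γ₁ t)⁻¹) 0 :=
    (h₂.hasLeftLogDerivAt 0).1.mul (h₁.hasLeftLogDerivAt 0).1.inv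
  have hW : ∀ᶠ t in 𝓝 0, γ₂ t * (γ₁ t)⁻¹ ∈ unitDomain E G := by
    refine hc.eventually_mem ?_
    simp only [h₁.map_zero, h₂.map_zero, inv_one, mul_one]
    exact unitDomain_mem_nhds
  obtain ⟨δ, hδ, hδW⟩ := Metric.eventually_nhds_iff_ball.1 hW
  have heq := eqOn_of_hasLeftLogDerivAt (convex_ball (0 : ℝ) δ) (Metric.mem_ball_self hδ)
    (h₁.map_zero.trans h₂.map_zero.symm) (fun t _ => h₁.hasLeftLogDerivAt t)
    (fun t _ => h₂.hasLeftLogDerivAt t) hδW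
  -- Agreement on a ball around `0` spreads to every `t`, as `γ(t) = γ(t / n)ⁿ` and `t / n` lies in
  -- the ball for large `n`.
  have hpow {γ : ℝ → G} (h : IsOneParameterGroup γ x) (n : ℕ) (t : ℝ) : γ (n * t) = γ t ^ n := by
    induction n with
    | zero => simp [h.map_zero]
    | succ n ih => rw [Nat.cast_succ, add_mul, one_mul, h.1, ih, pow_succ]
  ext t
  obtain ⟨n, hn⟩ := exists_nat_gt (|t| / δ)
  have hn0 : (0 : ℝ) < n := lt_of_le_of_lt (by positivity) hn
  have e : t = n * (t / n) := by field_simp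
  rw [e, hpow h₁, hpow h₂, heq]
  rw [mem_ball_zero_iff, Real.norm_eq_abs, abs_div, Nat.abs_cast, div_lt_iff₀ hn0]
  rwa [div_lt_iff₀ hδ, mul_comm] at hn

end LieGroup

end Coordinates

/-- A map that is additive on `[-1, 1]` extends to a homomorphism on `ℝ`. -/
theorem exists_extension_of_add_mul {G : Type*} [Monoid G] {h : ℝ → G}
    (hadd : ∀ s ∈ Icc (-1 : ℝ) 1, ∀ t ∈ Icc (-1 : ℝ) 1, s + t ∈ Icc (-1 : ℝ) 1 →
      h (s + t) = h s * h t) :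
    ∃ H : ℝ → G, (∀ s t, H (s + t) = H s * H t) ∧ ∀ t ∈ Icc (-1 : ℝ) 1, H t = h t := by
  -- The extension is `H(t) = h(t / 2ⁿ) ^ 2ⁿ`, which does not depend on `n` once `|t| ≤ 2ⁿ`, because
  -- each halving of the argument is compensated by a squaring.
  have hstep (t : ℝ) (n : ℕ) (ht : |t| ≤ 2 ^ n) (k : ℕ) :
      h (t / 2 ^ (n + k)) ^ 2 ^ (n + k) = h (t / 2 ^ n) ^ 2 ^ n := by
    induction k with
    | zero => simp
    | succ k ih =>
      have hle : |t / 2 ^ (n + k)| ≤ 1 := by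
        rw [abs_div, abs_of_pos (by positivity : (0 : ℝ) < 2 ^ (n + k)), div_le_one (by positivity)]
        exact ht.trans (pow_le_pow_right₀ (by norm_num) (by omega))
      have e : t / 2 ^ (n + k) = t / 2 ^ (n + (k + 1)) + t / 2 ^ (n + (k + 1)) := by
        rw [← add_assoc, pow_succ]
        field_simp
        ring
      have hle2 : t / 2 ^ (n + (k + 1)) = t / 2 ^ (n + k) / 2 := by
        rw [← add_assoc, pow_succ]
        field_simp
      rw [abs_le] at hle
      have hm : t / 2 ^ (n + (k + 1)) ∈ Icc (-1 : ℝ) 1 := by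
        rw [hle2]
        constructor <;> linarith [hle.1, hle.2]
      rw [← ih, e, hadd _ hm _ hm (by rw [← e]; exact hle), ← sq, ← pow_mul]
      congr 1
      ring
  have hstep2 (t : ℝ) (n m : ℕ) (hn : |t| ≤ 2 ^ n) (hm : |t| ≤ 2 ^ m) :
      h (t / 2 ^ n) ^ 2 ^ n = h (t / 2 ^ m) ^ 2 ^ m := by
    rcases le_total n m with hnm | hnm
    · obtain ⟨k, rfl⟩ := Nat.exists_eq_add_of_le hnm
      exact (hstep t n hn k).symm
    · obtain ⟨k, rfl⟩ := Nat.exists_eq_add_of_le hnm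
      exact hstep t m hm k
  have hex (t : ℝ) : ∃ n : ℕ, |t| ≤ 2 ^ n := by
    obtain ⟨n, hn⟩ := pow_unbounded_of_one_lt |t| (by norm_num : (1 : ℝ) < 2)
    exact ⟨n, hn.le⟩
  choose N hN using hex
  refine ⟨fun t => h (t / 2 ^ N t) ^ 2 ^ N t, fun s t => ?_, fun t ht => ?_⟩
  · obtain ⟨n, hn⟩ : ∃ n : ℕ, |s| + |t| ≤ 2 ^ n := by
      obtain ⟨n, hn⟩ := pow_unbounded_of_one_lt (|s| + |t|) (by norm_num : (1 : ℝ) < 2)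
      exact ⟨n, hn.le⟩
    have hs : |s| ≤ 2 ^ n := by linarith [abs_nonneg t]
    have ht : |t| ≤ 2 ^ n := by linarith [abs_nonneg s]
    have hst : |s + t| ≤ 2 ^ n := (abs_add_le s t).trans hn
    have hmem {r : ℝ} (hr : |r| ≤ 2 ^ n) : r / 2 ^ n ∈ Icc (-1 : ℝ) 1 := by
      rw [mem_Icc, ← abs_le, abs_div, abs_of_pos (by positivity : (0 : ℝ) < 2 ^ n),
        div_le_one (by positivity)]
      exact hr
    -- The target need not be commutative; the two values commute because both products equal the
    -- value of `h` at the same sum.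
    have hcomm : Commute (h (s / 2 ^ n)) (h (t / 2 ^ n)) := by
      have h1 := hadd _ (hmem hs) _ (hmem ht) (by rw [← add_div]; exact hmem hst)
      have h2 := hadd _ (hmem ht) _ (hmem hs) (by rw [add_comm, ← add_div]; exact hmem hst)
      rw [add_comm] at h2
      exact h1.symm.trans h2
    simp only
    rw [hstep2 (s + t) _ n (hN _) hst, hstep2 s _ n (hN _) hs, hstep2 t _ n (hN _) ht, add_div,
      hadd _ (hmem hs) _ (hmem ht) (by rw [← add_div]; exact hmem hst), hcomm.mul_pow]
  · simp only
    rw [hstep2 t _ 0 (hN t) (by simpa [abs_le] using ht)]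
    simp

/-! ### One-parameter groups as solutions of the left invariant differential equation. -/

section Exponential

open Filter

variable {E : Type*} [NormedAddCommGroup E] [NormedSpace ℂ E]
  {G : Type*} [TopologicalSpace G] [ChartedSpace E G] [Group G] [LieGroup 𝓘(ℂ, E) ω G]

variable (G) in
/-- The multiplication in the centered coordinate at the unit element. -/
noncomputable def coordMul (q : E × E) : E := unitCoord (unitPoint G q.1 * unitPoint G q.2)

lemma ContMDiffAt.unitPoint_comp {F : Type*} [NormedAddCommGroup F] [NormedSpace ℂ F] {f : F → E}
    {p : F} (hu : ContMDiffAt 𝓘(ℂ, E) 𝓘(ℂ, E) ω (unitPoint G) (f p)) (hf : ContDiffAt ℂ ω f p) :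
    ContMDiffAt 𝓘(ℂ, F) 𝓘(ℂ, E) ω (fun q => unitPoint G (f q)) p :=
  ContMDiffAt.comp (g := unitPoint G) (f := f) p hu hf.contMDiffAt

lemma contDiffAt_coordMul {q : E × E}
    (h₁ : ContMDiffAt 𝓘(ℂ, E) 𝓘(ℂ, E) ω (unitPoint G) q.1)
    (h₂ : ContMDiffAt 𝓘(ℂ, E) 𝓘(ℂ, E) ω (unitPoint G) q.2)
    (h : unitPoint G q.1 * unitPoint G q.2 ∈ unitDomain E G) :
    ContDiffAt ℂ ω (coordMul G) q :=
  contDiffAt_unitCoord_comp ((ContMDiffAt.unitPoint_comp h₁ contDiffAt_fst).mul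
    (ContMDiffAt.unitPoint_comp h₂ contDiffAt_snd)) h

lemma contDiffAt_coordMul_zero : ContDiffAt ℂ ω (coordMul G) (0 : E × E) :=
  contDiffAt_coordMul contMDiffAt_unitPoint_zero contMDiffAt_unitPoint_zero
    (by simpa using one_mem_unitDomain)

variable (G) in
/-- The left invariant vector field defined by `q.2` at the point `q.1`, in the centered coordinate
at the unit element. -/
noncomputable def coordField (q : E × E) : E := fderiv ℂ (coordMul G) (q.1, 0) (0, q.2)

/-- The solutions of the differential equation of the left invariant vector field of `y` have left
logarithmic derivative `y`. -/
lemma eventually_hasLeftLogDerivAt_of_coordField : ∀ᶠ a in 𝓝 (0 : E), ∀ (γ : ℝ → E) (t : ℝ) (y : E),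
    γ t = a → HasDerivAt γ (coordField G (a, y)) t →
      HasLeftLogDerivAt (fun s => unitPoint G (γ s)) y t := by
  filter_upwards [eventually_contMDiffAt_unitPoint (G := G), eventually_unitPoint_mem (G := G),
    eventually_unitCoord_unitPoint (G := G)] with a ha ha2 ha3 γ t y hγa hγ
  refine ⟨ContinuousAt.comp (g := unitPoint G) (by rw [hγa]; exact ha.continuousAt)
    hγ.continuousAt, ?_⟩
  -- the coordinate expression of left translation by the inverse of the point `a`
  let m : E → E := fun c => unitCoord ((unitPoint G a)⁻¹ * unitPoint G c)
  have hm : ContDiffAt ℂ ω m a :=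
    contDiffAt_unitCoord_comp (contMDiffAt_const.mul ha) (by simpa using one_mem_unitDomain)
  have hm' := (hm.differentiableAt (by simp)).hasFDerivAt
  have hM : ContDiffAt ℂ ω (coordMul G) (a, (0 : E)) :=
    contDiffAt_coordMul ha contMDiffAt_unitPoint_zero (by simpa using ha2)
  have hM' : HasFDerivAt (fun b => coordMul G (a, b))
      (fderiv ℂ (coordMul G) (a, 0) ∘L ContinuousLinearMap.inr ℂ E E) 0 :=
    (hM.differentiableAt (by simp)).hasFDerivAt.comp (0 : E) (hasFDerivAt_prodMk_right a 0)
  have hMa : coordMul G (a, (0 : E)) = a := by simp [coordMul, ha3]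
  have hcomp := HasFDerivAt.comp (g := m) (0 : E) (by rw [hMa]; exact hm') hM'
  -- From `a⁻¹(ab) = b`: the derivative of left translation by `a⁻¹` undoes `coordField G (a, ·)`,
  -- so the velocity of the curve, carried back to `1`, is `y`.
  have hid : HasFDerivAt (m ∘ fun b => coordMul G (a, b)) (ContinuousLinearMap.id ℂ E) 0 := by
    refine (hasFDerivAt_id 0).congr_of_eventuallyEq ?_
    have hc : ContinuousAt (fun b : E => unitPoint G a * unitPoint G b) 0 := by
      have := topologicalGroup_of_lieGroup 𝓘(ℂ, E) ω (G := G)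
      exact continuousAt_const.mul contMDiffAt_unitPoint_zero.continuousAt
    have hev := hc.eventually_mem (s := unitDomain E G)
      (isOpen_unitDomain.mem_nhds (by simpa using ha2))
    filter_upwards [hev, eventually_unitCoord_unitPoint (G := G)] with b hb hb2
    simp only [Function.comp_apply, m, coordMul, unitPoint_unitCoord hb, inv_mul_cancel_left, hb2,
      id]
  have hval := DFunLike.congr_fun (hcomp.unique hid) y
  have hγ' : HasDerivAt (fun ε => γ (t + ε)) (coordField G (a, y)) 0 := by
    have : HasDerivAt γ (coordField G (a, y)) (t + 0) := by rwa [add_zero]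
    exact this.comp_const_add t 0
  have hfin := (hm'.restrictScalars ℝ).comp_hasDerivAt_of_eq (0 : ℝ) hγ' (by simp [hγa])
  have e : (fderiv ℂ m a).restrictScalars ℝ (coordField G (a, y)) = y := by
    simpa [coordField] using hval
  rw [e] at hfin
  simpa [m, hγa, Function.comp_def] using hfin

variable [CompleteSpace E]

/-- The field is a partial derivative of the analytic multiplication, applied to a vector that
depends linearly on the argument. -/
lemma analyticAt_coordField : AnalyticAt ℂ (coordField G) (0 : E × E) := by
  have h1 : AnalyticAt ℂ (fderiv ℂ (coordMul G)) (0 : E × E) :=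
    (contDiffAt_coordMul_zero (G := G)).analyticAt.fderiv
  have h2 : AnalyticAt ℂ (fun q : E × E => fderiv ℂ (coordMul G) (q.1, (0 : E))) 0 :=
    AnalyticAt.comp (g := fderiv ℂ (coordMul G)) (f := fun q : E × E => (q.1, (0 : E)))
      (x := (0 : E × E)) h1 (analyticAt_fst.prod analyticAt_const)
  exact (h2.contDiffAt (n := ω) |>.clm_apply (contDiffAt_const.prodMk contDiffAt_snd)).analyticAt

/-- Small elements of the Lie algebra generate one-parameter groups, and these depend analytically
on the element. -/
theorem exists_analyticAt_oneParameterGroup : ∃ e : E → E, AnalyticAt ℂ e 0 ∧ e 0 = 0 ∧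
    ∀ᶠ y in 𝓝 (0 : E), ∃ γ : ℝ → G, IsOneParameterGroup γ y ∧ γ 1 = unitPoint G (e y) := by
  have := topologicalGroup_of_lieGroup 𝓘(ℂ, E) ω (G := G)
  obtain ⟨γ, hγ0, hγ, hγW, hγe⟩ := exists_analytic_flow (analyticAt_coordField (G := G))
    (Eventually.of_forall fun a : E => map_zero (fderiv ℂ (coordMul G) (a, 0)))
  have hc : ContinuousAt (fun q : E × E × E =>
      unitPoint G q.1 * (unitPoint G q.2.1 * unitPoint G q.2.2)⁻¹) 0 := by
    have hu := (contMDiffAt_unitPoint_zero (E := E) (G := G)).continuousAt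
    have h1 : ContinuousAt (fun q : E × E × E => unitPoint G q.1) 0 :=
      ContinuousAt.comp (g := unitPoint G) hu continuousAt_fst
    have h2 : ContinuousAt (fun q : E × E × E => unitPoint G q.2.1) 0 :=
      ContinuousAt.comp (g := unitPoint G) (f := fun q : E × E × E => q.2.1) hu (by fun_prop)
    have h3 : ContinuousAt (fun q : E × E × E => unitPoint G q.2.2) 0 :=
      ContinuousAt.comp (g := unitPoint G) (f := fun q : E × E × E => q.2.2) hu (by fun_prop)
    exact h1.mul (h2.mul h3).inv
  -- This is the closeness condition of `eqOn_of_hasLeftLogDerivAt` for the curves `t ↦ h s * h t`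
  -- and `t ↦ h (s + t)`, as long as all three points have small coordinates.
  have hW : ∀ᶠ q in 𝓝 (0 : E × E × E),
      unitPoint G q.1 * (unitPoint G q.2.1 * unitPoint G q.2.2)⁻¹ ∈ unitDomain E G :=
    hc.eventually_mem (by simpa using unitDomain_mem_nhds)
  obtain ⟨ε, hε, hεW⟩ := Metric.eventually_nhds_iff_ball.1 hW
  have hsmall : ∀ᶠ y in 𝓝 (0 : E), ∀ t ∈ Icc (-1 : ℝ) 1, γ y t ∈ Metric.ball 0 ε :=
    hγW _ (Metric.ball_mem_nhds 0 hε)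
  have hone : ∀ᶠ y in 𝓝 (0 : E), ∃ Γ : ℝ → G,
      IsOneParameterGroup Γ y ∧ Γ 1 = unitPoint G (γ y 1) := by
    filter_upwards [hγ, hsmall, hγW _ (eventually_hasLeftLogDerivAt_of_coordField (G := G))] with
      y hy hy2 hy3
    set h : ℝ → G := fun t => unitPoint G (γ y t) with hh
    have hlog (t : ℝ) (ht : t ∈ Icc (-1 : ℝ) 1) : HasLeftLogDerivAt h y t :=
      hy3 t ht (γ y) t y rfl (hy t ht)
    have h1 : h 0 = 1 := by simp [hh, hγ0]
    obtain ⟨Γ, hΓ, hΓh⟩ := exists_extension_of_add_mul (h := h) (by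
      intro s hs t ht hst
      -- The times at which both curves are controlled; the set is convex and contains the common
      -- starting time `0`.
      let S : Set ℝ := Icc (-1 : ℝ) 1 ∩ (fun t => s + t) ⁻¹' Icc (-1 : ℝ) 1
      have hS : Convex ℝ S :=
        (convex_Icc _ _).inter ((convex_Icc (-1 : ℝ) 1).translate_preimage_right s)
      have := eqOn_of_hasLeftLogDerivAt (G := G) (h₁ := fun t => h s * h t)
        (h₂ := fun t => h (s + t)) (y := y) hS (t₀ := 0) ⟨by norm_num, by simpa using hs⟩
        (by simp [h1]) (fun t ht => ⟨continuousAt_const.mul (hlog t ht.1).1, ?_⟩)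
        (fun t ht => ⟨ContinuousAt.comp (g := h) (hlog _ ht.2).1 (by fun_prop), ?_⟩) ?_
      · exact (this ⟨ht, hst⟩).symm
      · simpa [mul_assoc] using (hlog t ht.1).2
      · simpa [add_assoc] using (hlog _ ht.2).2
      · intro t ht
        refine hεW (γ y (s + t), γ y s, γ y t) ?_
        rw [mem_ball_zero_iff]
        refine max_lt (mem_ball_zero_iff.1 (hy2 _ ht.2)) (max_lt (mem_ball_zero_iff.1 (hy2 _ hs))
          (mem_ball_zero_iff.1 (hy2 _ ht.1))))
    refine ⟨Γ, isOneParameterGroup_iff.2 ⟨hΓ, ?_⟩, hΓh 1 (by norm_num)⟩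
    have hev : Γ =ᶠ[𝓝 0] h := by
      filter_upwards [Icc_mem_nhds (by norm_num : (-1 : ℝ) < 0) (by norm_num : (0 : ℝ) < 1)] with t ht
      exact hΓh t ht
    have hl := hlog 0 (by norm_num)
    refine ⟨hl.1.congr hev.symm, ?_⟩
    have hl2 := hl.2
    simp only [zero_add] at hl2 ⊢
    refine hl2.congr_of_eventuallyEq ?_
    filter_upwards [hev] with t ht
    rw [ht, hev.self_of_nhds]
  refine ⟨fun y => γ y 1, hγe, ?_, hone⟩
  -- the constant one-parameter group
  have h01 : γ 0 1 = 0 := by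
    by_contra hne
    have := hγW {γ 0 1}ᶜ (isOpen_compl_singleton.mem_nhds (Ne.symm hne))
    exact this.self_of_nhds 1 (by norm_num) rfl
  exact h01

end Exponential

/-! ### The exponential function and the adjoint action. -/

section Exponential

open Filter

variable {E : Type*} [NormedAddCommGroup E] [NormedSpace ℂ E]
  {G : Type*} [TopologicalSpace G] [ChartedSpace E G] [Group G] [LieGroup 𝓘(ℂ, E) ω G]

/-- The inverse function theorem for maps from a Banach space to a Lie group. -/
theorem exists_local_inverse {F : Type*} [NormedAddCommGroup F] [NormedSpace ℂ F] [CompleteSpace F]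
    [CompleteSpace E] {f : F → G} {p : F} {A : F ≃L[ℂ] E}
    (hf : ContMDiffAt 𝓘(ℂ, F) 𝓘(ℂ, E) ω f p) (hp : f p = 1)
    (hA : HasFDerivAt (fun q => (unitCoord (f q) : E)) (A : F →L[ℂ] E) p) :
    ∃ s : G → F, (∀ᶠ g in 𝓝 (1 : G), ContMDiffAt 𝓘(ℂ, E) 𝓘(ℂ, F) ω s g) ∧ s 1 = p ∧
      (∀ᶠ g in 𝓝 (1 : G), f (s g) = g) ∧ ∀ᶠ q in 𝓝 p, s (f q) = q := by
  have hc : ContDiffAt ℂ ω (fun q => (unitCoord (f q) : E)) p :=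
    contDiffAt_unitCoord_comp hf (by rw [hp]; exact one_mem_unitDomain)
  have hst := hc.hasStrictFDerivAt' hA (by simp)
  let r : E → F := hst.localInverse _ _ _
  have hr0 : r 0 = p := by
    have := hst.localInverse_apply_image
    simpa [r, hp] using this
  have hr : ContDiffAt ℂ ω r 0 := by
    have := hc.to_localInverse hA (by simp)
    simpa [hp] using! this
  have hr1 : ∀ᶠ a in 𝓝 (0 : E), unitCoord (f (r a)) = a := by
    have := hst.eventually_right_inverse
    simpa [hp] using! this
  have hr2 : ∀ᶠ q in 𝓝 p, r (unitCoord (f q)) = q := hst.eventually_left_inverse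
  have hu : Tendsto (unitCoord : G → E) (𝓝 1) (𝓝 0) := by
    have := continuousAt_unitCoord (E := E) (one_mem_unitDomain (E := E) (G := G))
    simpa [ContinuousAt] using! this
  have hfr : Tendsto (fun g : G => f (r (unitCoord g))) (𝓝 1) (𝓝 1) := by
    have h1 : Tendsto r (𝓝 0) (𝓝 p) := by simpa [ContinuousAt, hr0] using! hr.continuousAt
    have h2 : Tendsto f (𝓝 p) (𝓝 1) := by simpa [ContinuousAt, hp] using! hf.continuousAt
    exact (h2.comp h1).comp hu
  refine ⟨fun g => r (unitCoord g), ?_, by simpa using hr0, ?_, hr2⟩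
  · have ha : ∀ᶠ a in 𝓝 (0 : E), AnalyticAt ℂ r a := hr.analyticAt.eventually_analyticAt
    filter_upwards [hu.eventually ha, unitDomain_mem_nhds (E := E)] with g hg hg2
    exact ContMDiffAt.comp (g := r) g hg.contDiffAt.contMDiffAt (contMDiffAt_unitCoord hg2)
  · filter_upwards [hu.eventually hr1, hfr.eventually (unitDomain_mem_nhds (E := E)),
      unitDomain_mem_nhds (E := E)] with g h1 h2 h3
    rw [← unitPoint_unitCoord h2, h1, unitPoint_unitCoord h3]

lemma IsOneParameterGroup.comp_mul {γ : ℝ → G} {y : E} (h : IsOneParameterGroup γ y) (c : ℝ) :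
    IsOneParameterGroup (fun t => γ (c * t)) (c • y) := by
  have h0 := h.map_zero
  refine ⟨fun s t => by simp only [mul_add, h.1], ?_⟩
  have h2 := (hasMFDerivAt_real_iff h0).1 h.2
  refine (hasMFDerivAt_real_iff (by simpa using h0)).2 ⟨?_, ?_⟩
  · exact ContinuousAt.comp (g := γ) (by simpa using h2.1) (by fun_prop)
  · have h3 : HasDerivAt (fun t => (unitCoord (γ t) : E)) y (c * 0) := by simpa using h2.2
    exact h3.scomp (0 : ℝ) (by simpa using (hasDerivAt_id (0 : ℝ)).const_mul c)

section Complete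

variable [CompleteSpace E]

/-- A small non-zero real multiple of `x` generates a one-parameter group, and reparametrizing it by
the inverse factor gives one for `x` itself. -/
theorem exists_isOneParameterGroup (x : E) : ∃ γ : ℝ → G, IsOneParameterGroup γ x := by
  obtain ⟨e, -, -, he⟩ := exists_analyticAt_oneParameterGroup (E := E) (G := G)
  have ht : Tendsto (fun t : ℝ => t • x) (𝓝[≠] 0) (𝓝 0) := by
    have : ContinuousAt (fun t : ℝ => t • x) 0 := by fun_prop
    simpa [ContinuousAt] using! this.mono_left nhdsWithin_le_nhds
  obtain ⟨t, ⟨γ, hγ, -⟩, ht0⟩ := ((ht.eventually he).and self_mem_nhdsWithin).exists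
  refine ⟨fun s => γ (t⁻¹ * s), ?_⟩
  have := hγ.comp_mul t⁻¹
  rwa [inv_smul_smul₀ ht0] at this

end Complete

lemma IsOneParameterGroup.lieExp_eq {γ : ℝ → G} {x : E} (h : IsOneParameterGroup γ x) :
    lieExp G x = γ 1 := by
  have hex : ∃ γ : ℝ → G, IsOneParameterGroup γ x := ⟨γ, h⟩
  rw [lieExp, dif_pos hex, hex.choose_spec.unique h]

variable [CompleteSpace E]

lemma isOneParameterGroup_lieExp (x : E) :
    IsOneParameterGroup (fun t : ℝ => lieExp G (t • x)) x := by
  obtain ⟨γ, hγ⟩ := exists_isOneParameterGroup (G := G) x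
  convert! hγ using 2 with t
  rw [(hγ.comp_mul t).lieExp_eq, mul_one]

lemma lieExp_add_smul (s t : ℝ) (x : E) :
    lieExp G ((s + t) • x) = lieExp G (s • x) * lieExp G (t • x) :=
  (isOneParameterGroup_lieExp x).1 s t

@[simp] lemma lieExp_zero : lieExp G (0 : E) = 1 := by
  simpa using (isOneParameterGroup_lieExp (G := G) (0 : E)).map_zero

lemma lieExp_neg (x : E) : lieExp G (-x) = (lieExp G x)⁻¹ := by
  rw [eq_comm, inv_eq_iff_mul_eq_one]
  have := lieExp_add_smul (G := G) 1 (-1) x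
  simpa using this.symm

lemma lieExp_nsmul (n : ℕ) (x : E) : lieExp G (n • x) = lieExp G x ^ n := by
  induction n with
  | zero => simp
  | succ n ih =>
    have := lieExp_add_smul (G := G) n 1 x
    rw [one_smul, Nat.cast_smul_eq_nsmul ℝ, ih] at this
    rw [pow_succ, ← this]
    congr 1
    rw [add_smul, one_smul, add_smul, one_smul, Nat.cast_smul_eq_nsmul ℝ]

/-- The exponential function is analytic near `0`, and its derivative there is the identity. -/
lemma lieExp_aux : (∀ᶠ y in 𝓝 (0 : E), ContMDiffAt 𝓘(ℂ, E) 𝓘(ℂ, E) ω (lieExp G) y) ∧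
    HasFDerivAt (fun y : E => (unitCoord (lieExp G y) : E)) (ContinuousLinearMap.id ℂ E) 0 := by
  obtain ⟨e, hea, he0, he⟩ := exists_analyticAt_oneParameterGroup (E := E) (G := G)
  have heq : ∀ᶠ y in 𝓝 (0 : E), lieExp G y = unitPoint G (e y) := by
    filter_upwards [he] with y ⟨γ, hγ, hγe⟩
    rw [hγ.lieExp_eq, hγe]
  have het : Tendsto e (𝓝 0) (𝓝 0) := by simpa [ContinuousAt, he0] using! hea.continuousAt
  have h1 : ∀ᶠ y in 𝓝 (0 : E), ContMDiffAt 𝓘(ℂ, E) 𝓘(ℂ, E) ω (lieExp G) y := by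
    filter_upwards [heq.eventually_nhds, hea.eventually_analyticAt,
      het.eventually (eventually_contMDiffAt_unitPoint (G := G))] with y hy hy2 hy3
    exact (ContMDiffAt.unitPoint_comp hy3 hy2.contDiffAt).congr_of_eventuallyEq hy
  refine ⟨h1, ?_⟩
  have h2 : ContDiffAt ℂ ω (fun y : E => (unitCoord (lieExp G y) : E)) 0 :=
    contDiffAt_unitCoord_comp h1.self_of_nhds (by simpa using one_mem_unitDomain)
  have h3 := (h2.differentiableAt (by simp)).hasFDerivAt
  convert! h3 using 1
  ext y
  have h4 := ((hasMFDerivAt_real_iff (isOneParameterGroup_lieExp (G := G) y).map_zero).1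
    (isOneParameterGroup_lieExp (G := G) y).2).2
  have h5 : HasDerivAt (fun t : ℝ => t • y) y 0 := by
    simpa using (hasDerivAt_id (0 : ℝ)).smul_const y
  have h6 := (h3.restrictScalars ℝ).comp_hasDerivAt_of_eq (0 : ℝ) h5 (by simp)
  exact h4.unique h6

/-- The exponential function is analytic. -/
theorem contMDiff_lieExp : ContMDiff 𝓘(ℂ, E) 𝓘(ℂ, E) ω (lieExp G : E → G) := by
  intro x
  -- The identity `exp y = exp(y / n)ⁿ`, with `x / n` in the region where analyticity is known,
  -- transports analyticity from `0` to `x`.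
  have ht : Tendsto (fun n : ℕ => (n : ℂ)⁻¹ • x) atTop (𝓝 0) := by
    have := (tendsto_inv_atTop_nhds_zero_nat (𝕜 := ℂ)).smul_const x
    rwa [zero_smul] at this
  obtain ⟨n, hn, hn0⟩ := ((ht.eventually (lieExp_aux (G := G)).1).and (eventually_ne_atTop 0)).exists
  have e : (lieExp G : E → G) = fun y => lieExp G ((n : ℂ)⁻¹ • y) ^ n := by
    ext y
    rw [← lieExp_nsmul, ← Nat.cast_smul_eq_nsmul ℂ, smul_inv_smul₀ (by exact_mod_cast hn0)]
  rw [e]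
  refine (contMDiff_pow n).contMDiffAt.comp x
    (ContMDiffAt.comp (g := lieExp G) (f := fun y : E => (n : ℂ)⁻¹ • y) x hn ?_)
  exact (contDiff_const_smul _).contMDiff.contMDiffAt

lemma hasFDerivAt_unitCoord_lieExp :
    HasFDerivAt (fun y : E => (unitCoord (lieExp G y) : E)) (ContinuousLinearMap.id ℂ E) 0 :=
  lieExp_aux.2

lemma continuous_lieExp : Continuous (lieExp G : E → G) := contMDiff_lieExp.continuous

/-- The exponential function restricts to a biholomorphic map between a neighborhood of `0` and a
neighborhood of `1`. -/
theorem exists_lieExp_openPartialHomeomorph : ∃ Φ : OpenPartialHomeomorph E G,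
    0 ∈ Φ.source ∧ (∀ x ∈ Φ.source, Φ x = lieExp G x) ∧
    ContMDiffOn 𝓘(ℂ, E) 𝓘(ℂ, E) ω Φ Φ.source ∧
    ContMDiffOn 𝓘(ℂ, E) 𝓘(ℂ, E) ω Φ.symm Φ.target := by
  obtain ⟨s, hs, hs0, hs1, hs2⟩ := exists_local_inverse (A := ContinuousLinearEquiv.refl ℂ E)
    (contMDiff_lieExp (E := E) (G := G) 0) lieExp_zero hasFDerivAt_unitCoord_lieExp
  obtain ⟨W, hW, hWo, h1W⟩ := eventually_nhds_iff.1 (hs.and hs1)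
  have hfc : ContinuousAt (lieExp G : E → G) 0 := continuous_lieExp.continuousAt
  have hfW : ∀ᶠ y in 𝓝 (0 : E), lieExp G y ∈ W :=
    hfc.eventually_mem (hWo.mem_nhds (by simpa using h1W))
  obtain ⟨O, hO, hOo, h0O⟩ := eventually_nhds_iff.1 (hs2.and hfW)
  have hsW : ContMDiffOn 𝓘(ℂ, E) 𝓘(ℂ, E) ω s W := fun g hg => (hW g hg).1.contMDiffWithinAt
  refine ⟨{ toFun := lieExp G, invFun := s, source := O, target := W ∩ s ⁻¹' O,
            map_source' := fun y hy => ⟨(hO y hy).2, ?_⟩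
            map_target' := fun g hg => hg.2
            left_inv' := fun y hy => (hO y hy).1
            right_inv' := fun g hg => (hW g hg.1).2
            open_source := hOo
            open_target := hsW.continuousOn.isOpen_inter_preimage hWo hOo
            continuousOn_toFun := continuous_lieExp.continuousOn
            continuousOn_invFun := hsW.continuousOn.mono inter_subset_left }, h0O,
    fun x _ => rfl, contMDiff_lieExp.contMDiffOn, hsW.mono inter_subset_left⟩
  rw [mem_preimage, (hO y hy).1]
  exact hy

lemma lieExp_injOn : ∃ W ∈ 𝓝 (0 : E), InjOn (lieExp G : E → G) W := by
  obtain ⟨Φ, h0, hΦ, -, -⟩ := exists_lieExp_openPartialHomeomorph (E := E) (G := G)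
  refine ⟨Φ.source, Φ.open_source.mem_nhds h0, fun a ha b hb hab => Φ.injOn ha hb ?_⟩
  rw [hΦ a ha, hΦ b hb, hab]

/-- The adjoint action on the model space. -/
noncomputable def adRep (g : G) : E →L[ℂ] E := lieAd (E := E) g

lemma adRep_one : adRep (1 : G) = ContinuousLinearMap.id ℂ E := lieAd_one

lemma adRep_mul (a b : G) : adRep (E := E) (a * b) = adRep a ∘L adRep b := lieAd_mul a b

lemma adRep_mul_apply (a b : G) (y : E) : adRep (a * b) y = adRep a (adRep b y) := by
  rw [adRep_mul]; rfl

lemma adRep_inv_apply_self (a : G) (y : E) : adRep a⁻¹ (adRep a y) = y := by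
  rw [← adRep_mul_apply, inv_mul_cancel, adRep_one]; rfl

lemma adRep_apply_inv_self (a : G) (y : E) : adRep a (adRep a⁻¹ y) = y := by
  rw [← adRep_mul_apply, mul_inv_cancel, adRep_one]; rfl

lemma hasFDerivAt_conj (g : G) :
    HasFDerivAt (fun a : E => (unitCoord (g * unitPoint G a * g⁻¹) : E)) (adRep g) 0 := by
  have h1 : HasMFDerivAt 𝓘(ℂ, E) 𝓘(ℂ, E) (unitPoint G) (0 : E) (ContinuousLinearMap.id ℂ E) := by
    refine (hasMFDerivAt_complex_iff unitPoint_zero).2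
      ⟨contMDiffAt_unitPoint_zero.continuousAt, ?_⟩
    exact (hasFDerivAt_id 0).congr_of_eventuallyEq eventually_unitCoord_unitPoint
  have h2 : HasMFDerivAt 𝓘(ℂ, E) 𝓘(ℂ, E) (fun h : G => g * h * g⁻¹) (unitPoint G (0 : E))
      (adRep g : E →L[ℂ] E) := by
    rw [unitPoint_zero]
    exact lieAd_hasMFDerivAt g
  have h3 := HasMFDerivAt.comp (0 : E) h2 h1
  exact ((hasMFDerivAt_complex_iff (by simp)).1 h3).2

/-- Conjugating `t ↦ exp(ty)` by `g` gives a one-parameter group whose velocity is `Ad(g)y`, and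
one-parameter groups are determined by their velocity. -/
lemma lieExp_adRep (g : G) (y : E) : lieExp G (adRep g y) = g * lieExp G y * g⁻¹ := by
  have := topologicalGroup_of_lieGroup 𝓘(ℂ, E) ω (G := G)
  have h := isOneParameterGroup_lieExp (G := G) y
  have h1 := (hasMFDerivAt_real_iff h.map_zero).1 h.2
  have : IsOneParameterGroup (fun t : ℝ => g * lieExp G (t • y) * g⁻¹) (adRep g y) := by
    refine ⟨fun s t => by
      have := h.1 s t
      simp only at this ⊢
      rw [this]
      group, (hasMFDerivAt_real_iff (by simp)).2 ⟨?_, ?_⟩⟩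
    · exact (continuousAt_const.mul h1.1).mul continuousAt_const
    · have h2 := ((hasFDerivAt_conj (E := E) g).restrictScalars ℝ).comp_hasDerivAt_of_eq (0 : ℝ)
        h1.2 (by simp)
      refine h2.congr_of_eventuallyEq ?_
      have h3 : ∀ᶠ t in 𝓝 (0 : ℝ), lieExp G (t • y) ∈ unitDomain E G :=
        h1.1.eventually_mem (by simpa using unitDomain_mem_nhds)
      filter_upwards [h3] with t ht
      simp only [Function.comp_apply, unitPoint_unitCoord ht]
  rw [this.lieExp_eq, one_smul]

end Exponential

/-! ### The bracket as the derivative of the adjoint representation. -/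

section Bracket

open Filter VectorField

variable {E : Type*} [NormedAddCommGroup E] [NormedSpace ℂ E]
  {G : Type*} [TopologicalSpace G] [ChartedSpace E G] [Group G] [LieGroup 𝓘(ℂ, E) ω G]

lemma hasMFDerivAt_unitPoint_zero :
    HasMFDerivAt 𝓘(ℂ, E) 𝓘(ℂ, E) (unitPoint G) (0 : E) (ContinuousLinearMap.id ℂ E) := by
  refine (hasMFDerivAt_complex_iff unitPoint_zero).2
    ⟨contMDiffAt_unitPoint_zero.continuousAt, ?_⟩
  exact (hasFDerivAt_id 0).congr_of_eventuallyEq eventually_unitCoord_unitPoint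

/-- The bracket on `GroupLieAlgebra` is defined by invariant vector fields on the manifold; this is
the passage to the concrete field `coordField` on `E`. It holds because the derivatives of
`unitPoint` and `unitCoord` are mutually inverse. -/
lemma eventually_mpullback_unitPoint (v : E) : ∀ᶠ a in 𝓝 (0 : E),
    mpullback 𝓘(ℂ, E) 𝓘(ℂ, E) (unitPoint G)
      (mulInvariantVectorField (I := 𝓘(ℂ, E)) (G := G) v) a = coordField G (a, v) := by
  filter_upwards [eventually_contMDiffAt_unitPoint (G := G), eventually_unitPoint_mem (G := G),
    (eventually_unitCoord_unitPoint (E := E) (G := G)).eventually_nhds] with a ha ha2 ha3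
  have hσ := (ha.mdifferentiableAt (by simp)).hasMFDerivAt
  have hl := ((contMDiffAt_unitCoord ha2).mdifferentiableAt (by simp)).hasMFDerivAt
  have hm := ((contMDiff_mul_left (I := 𝓘(ℂ, E)) (n := ω) (a := unitPoint G a)
    (1 : G)).mdifferentiableAt (by simp)).hasMFDerivAt
  have hu : unitCoord (unitPoint G a) = a := ha3.self_of_nhds
  set σ' : E →L[ℂ] E := mfderiv 𝓘(ℂ, E) 𝓘(ℂ, E) (unitPoint G) a with hσ'
  set l' : E →L[ℂ] E := mfderiv 𝓘(ℂ, E) 𝓘(ℂ, E) (unitCoord : G → E) (unitPoint G a) with hl'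
  set m' : E →L[ℂ] E := mfderiv 𝓘(ℂ, E) 𝓘(ℂ, E) (fun g : G => unitPoint G a * g) 1 with hm'
  have h1 : l' ∘L σ' = ContinuousLinearMap.id ℂ E := by
    have h := HasMFDerivAt.comp a hl hσ
    have h2 : HasMFDerivAt 𝓘(ℂ, E) 𝓘(ℂ, E) (unitCoord ∘ unitPoint G) a
        (ContinuousLinearMap.id ℂ E) :=
      ((hasFDerivAt_id a).congr_of_eventuallyEq ha3).hasMFDerivAt
    exact hasMFDerivAt_unique h h2
  have h2 : σ' ∘L l' = ContinuousLinearMap.id ℂ E := by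
    have h := HasMFDerivAt.comp (g := unitPoint G) (f := unitCoord) (unitPoint G a)
      (by rw [hu]; exact hσ) hl
    have h2 : HasMFDerivAt 𝓘(ℂ, E) 𝓘(ℂ, E) (unitPoint G ∘ (unitCoord : G → E)) (unitPoint G a)
        (ContinuousLinearMap.id ℂ E) := by
      refine (hasMFDerivAt_id (unitPoint G a)).congr_of_eventuallyEq ?_
      filter_upwards [isOpen_unitDomain.mem_nhds ha2] with g hg
      exact unitPoint_unitCoord hg
    exact hasMFDerivAt_unique h h2
  have h3 : σ'.inverse = l' := ContinuousLinearMap.inverse_eq h2 h1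
  have h4 : HasFDerivAt (fun b => coordMul G (a, b)) (l' ∘L m' ∘L ContinuousLinearMap.id ℂ E) 0 := by
    have h5 : HasMFDerivAt 𝓘(ℂ, E) 𝓘(ℂ, E) (fun g : G => unitPoint G a * g) (unitPoint G (0 : E))
        m' := by
      rw [unitPoint_zero]; exact hm
    have h6 (q : G) (hq : q = unitPoint G a) :
        HasMFDerivAt 𝓘(ℂ, E) 𝓘(ℂ, E) (unitCoord : G → E) q l' := by
      subst hq
      exact hl
    exact (HasMFDerivAt.comp (0 : E) (h6 _ (by simp))
      (HasMFDerivAt.comp (0 : E) h5 hasMFDerivAt_unitPoint_zero)).hasFDerivAt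
  have hM : ContDiffAt ℂ ω (coordMul G) (a, (0 : E)) :=
    contDiffAt_coordMul ha contMDiffAt_unitPoint_zero (by simpa using ha2)
  have hM' : HasFDerivAt (fun b => coordMul G (a, b))
      (fderiv ℂ (coordMul G) (a, 0) ∘L ContinuousLinearMap.inr ℂ E E) 0 :=
    (hM.differentiableAt (by simp)).hasFDerivAt.comp (0 : E) (hasFDerivAt_prodMk_right a 0)
  have h7 := DFunLike.congr_fun (h4.unique hM') v
  change σ'.inverse (m' v) = _
  rw [h3]
  simpa [coordField] using h7

variable [CompleteSpace E]

/-- In coordinates `Ad` is the partial derivative in `b`, at `b = 0`, of the analytic map `(a, b) ↦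
a b a⁻¹`. Analyticity is in the operator norm. -/
lemma analyticAt_adRep_unitPoint : AnalyticAt ℂ (fun a : E => adRep (E := E) (unitPoint G a)) 0 := by
  let c : E × E → E := fun q => unitCoord (unitPoint G q.1 * unitPoint G q.2 * (unitPoint G q.1)⁻¹)
  have h (q : E × E) (h1 : ContMDiffAt 𝓘(ℂ, E) 𝓘(ℂ, E) ω (unitPoint G) q.1)
      (h2 : ContMDiffAt 𝓘(ℂ, E) 𝓘(ℂ, E) ω (unitPoint G) q.2)
      (h3 : unitPoint G q.1 * unitPoint G q.2 * (unitPoint G q.1)⁻¹ ∈ unitDomain E G) :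
      ContDiffAt ℂ ω c q :=
    contDiffAt_unitCoord_comp (((ContMDiffAt.unitPoint_comp h1 contDiffAt_fst).mul
      (ContMDiffAt.unitPoint_comp h2 contDiffAt_snd)).mul
      (ContMDiffAt.unitPoint_comp h1 contDiffAt_fst).inv) h3
  have hc0 : AnalyticAt ℂ c 0 := (h 0 contMDiffAt_unitPoint_zero contMDiffAt_unitPoint_zero
    (by simpa using one_mem_unitDomain)).analyticAt
  have h1 : AnalyticAt ℂ (fun a : E => fderiv ℂ c (a, (0 : E))) 0 :=
    AnalyticAt.comp (g := fderiv ℂ c) (f := fun a : E => (a, (0 : E))) (x := (0 : E)) hc0.fderiv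
      (analyticAt_id.prod analyticAt_const)
  have h2 : AnalyticAt ℂ (fun a : E => fderiv ℂ c (a, (0 : E)) ∘L .inr ℂ E E) 0 :=
    (h1.contDiffAt (n := ω) |>.clm_comp contDiffAt_const).analyticAt
  refine h2.congr ?_
  filter_upwards [eventually_contMDiffAt_unitPoint (G := G)] with a ha
  have h3 : HasFDerivAt (fun b => c (a, b)) (fderiv ℂ c (a, 0) ∘L .inr ℂ E E) 0 :=
    ((h (a, 0) ha contMDiffAt_unitPoint_zero
      (by simpa using one_mem_unitDomain)).differentiableAt (by simp)).hasFDerivAt.comp (0 : E)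
      (hasFDerivAt_prodMk_right a 0)
  exact h3.unique (hasFDerivAt_conj (unitPoint G a))

variable (G) in
/-- The Lie bracket of the Lie algebra of `G`, as a continuous bilinear map on the model space:
the derivative of the adjoint representation. -/
noncomputable def bracketCLM : E →L[ℂ] E →L[ℂ] E :=
  fderiv ℂ (fun a : E => adRep (E := E) (unitPoint G a)) 0

lemma hasFDerivAt_coordField (w : E) : HasFDerivAt (fun a : E => coordField G (a, w))
    ((fderiv ℂ (fderiv ℂ (coordMul G)) 0 ∘L .inl ℂ E E).flip (0, w)) 0 := by
  have hD : HasFDerivAt (fderiv ℂ (coordMul (E := E) G)) (fderiv ℂ (fderiv ℂ (coordMul G)) 0) 0 :=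
    contDiffAt_coordMul_zero.analyticAt.fderiv.differentiableAt.hasFDerivAt
  have h1 : HasFDerivAt (fun a : E => fderiv ℂ (coordMul G) (a, (0 : E)))
      (fderiv ℂ (fderiv ℂ (coordMul G)) 0 ∘L .inl ℂ E E) 0 :=
    HasFDerivAt.comp (g := fderiv ℂ (coordMul G)) (0 : E) hD
      (hasFDerivAt_prodMk_left (0 : E) (0 : E))
  have := h1.clm_apply (hasFDerivAt_const ((0 : E), w) (0 : E))
  simpa [coordField] using this

lemma coordField_zero_left (w : E) : coordField G (0, w) = w := by
  have e2 : HasFDerivAt (fun z : E => coordMul G ((0 : E), z))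
      (fderiv ℂ (coordMul G) ((0 : E), (0 : E)) ∘L .inr ℂ E E) 0 :=
    contDiffAt_coordMul_zero.analyticAt.differentiableAt.hasFDerivAt.comp (0 : E)
      (hasFDerivAt_prodMk_right (0 : E) (0 : E))
  have e3 : HasFDerivAt (fun z : E => coordMul G ((0 : E), z)) (ContinuousLinearMap.id ℂ E) 0 := by
    refine (hasFDerivAt_id 0).congr_of_eventuallyEq ?_
    filter_upwards [eventually_unitCoord_unitPoint (G := G)] with b hb
    simp [coordMul, hb]
  simpa [coordField] using DFunLike.congr_fun (e2.unique e3) w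

/-- The derivative of the adjoint representation is the commutator of left invariant vector
fields. -/
lemma bracketCLM_eq (v w : E) : bracketCLM G v w =
    fderiv ℂ (fderiv ℂ (coordMul G)) 0 (v, 0) (0, w) -
      fderiv ℂ (fderiv ℂ (coordMul G)) 0 (w, 0) (0, v) := by
  set M := coordMul (E := E) G with hMdef
  have hM : ContDiffAt ℂ ω M 0 := contDiffAt_coordMul_zero
  have hsymm : IsSymmSndFDerivAt ℂ M 0 := hM.isSymmSndFDerivAt_of_omega
  set D2 := fderiv ℂ (fderiv ℂ M) 0 with hD2
  have hD : HasFDerivAt (fderiv ℂ M) D2 0 := hM.analyticAt.fderiv.differentiableAt.hasFDerivAt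
  set A : E → E →L[ℂ] E := fun a => adRep (unitPoint G a) with hA
  have hA' : HasFDerivAt A (bracketCLM G) 0 :=
    analyticAt_adRep_unitPoint.differentiableAt.hasFDerivAt
  have hA0 : A 0 = ContinuousLinearMap.id ℂ E := by simp [hA, adRep_one]
  -- differentiate `M (a, b) = M (a b a⁻¹, a)` in `b`
  have key : ∀ᶠ a in 𝓝 (0 : E), fderiv ℂ M (a, 0) (0, w) = fderiv ℂ M (0, a) (A a w, 0) := by
    have hc : ContinuousAt (fun a : E => ((0 : E), a)) 0 := by fun_prop
    have hc2 : ContinuousAt (fun a : E => (a, (0 : E))) 0 := by fun_prop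
    have hev := hM.analyticAt.eventually_analyticAt
    filter_upwards [hc.tendsto.eventually hev, hc2.tendsto.eventually hev,
      eventually_contMDiffAt_unitPoint (G := G), eventually_unitPoint_mem (G := G)] with
      a h1 h2 h3 h4
    have e1 : HasFDerivAt (fun b => M (a, b)) (fderiv ℂ M (a, 0) ∘L .inr ℂ E E) 0 :=
      h2.differentiableAt.hasFDerivAt.comp (0 : E) (hasFDerivAt_prodMk_right a 0)
    have e2 : HasFDerivAt (fun z => M (z, a)) (fderiv ℂ M (0, a) ∘L .inl ℂ E E) 0 :=
      HasFDerivAt.comp (g := M) (f := fun z : E => (z, a)) (0 : E) h1.differentiableAt.hasFDerivAt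
        (hasFDerivAt_prodMk_left (0 : E) a)
    have e3 := HasFDerivAt.comp (g := fun z => M (z, a)) (0 : E) (by simpa using e2)
      (hasFDerivAt_conj (E := E) (unitPoint G a))
    have e4 := e3.congr_of_eventuallyEq (f₁ := fun b => M (a, b)) (by
      have := topologicalGroup_of_lieGroup 𝓘(ℂ, E) ω (G := G)
      have hcc : ContinuousAt (fun b : E => unitPoint G a * unitPoint G b * (unitPoint G a)⁻¹) 0 :=
        (continuousAt_const.mul contMDiffAt_unitPoint_zero.continuousAt).mul continuousAt_const
      filter_upwards [hcc.eventually_mem (s := unitDomain E G)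
        (by simpa using unitDomain_mem_nhds)] with b hb
      simp only [hMdef, coordMul, Function.comp_apply, unitPoint_unitCoord hb,
        inv_mul_cancel_right])
    simpa using DFunLike.congr_fun (e1.unique e4) w
  have hM0 (z : E) : fderiv ℂ M 0 (z, 0) = z := by
    have e2 : HasFDerivAt (fun z : E => M (z, (0 : E))) (fderiv ℂ M 0 ∘L .inl ℂ E E) 0 :=
      HasFDerivAt.comp (g := M) (f := fun z : E => (z, (0 : E))) (0 : E)
        hM.analyticAt.differentiableAt.hasFDerivAt (hasFDerivAt_prodMk_left (0 : E) (0 : E))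
    have e3 : HasFDerivAt (fun z : E => M (z, (0 : E))) (ContinuousLinearMap.id ℂ E) 0 := by
      refine (hasFDerivAt_id 0).congr_of_eventuallyEq ?_
      filter_upwards [eventually_unitCoord_unitPoint (G := G)] with b hb
      simp [hMdef, coordMul, hb]
    simpa using DFunLike.congr_fun (e2.unique e3) z
  -- differentiate the resulting identity in `a`
  have d1 := hasFDerivAt_coordField (G := G) w
  have d2 : HasFDerivAt (fun a : E => fderiv ℂ M (0, a) (A a w, 0))
      (fderiv ℂ M 0 ∘L (.inl ℂ E E ∘L (bracketCLM G).flip w) +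
        (D2 ∘L .inr ℂ E E).flip (w, 0)) 0 := by
    have h1 : HasFDerivAt (fun a : E => fderiv ℂ M (0, a)) (D2 ∘L .inr ℂ E E) 0 :=
      HasFDerivAt.comp (g := fderiv ℂ M) (0 : E) hD (hasFDerivAt_prodMk_right 0 0)
    have h2 : HasFDerivAt (fun a : E => A a w) ((bracketCLM G).flip w) 0 := by
      have := hA'.clm_apply (hasFDerivAt_const w (0 : E))
      simpa using this
    have h3 : HasFDerivAt (fun a : E => (A a w, (0 : E))) (.inl ℂ E E ∘L (bracketCLM G).flip w) 0 :=
      (ContinuousLinearMap.inl ℂ E E).hasFDerivAt.comp (0 : E) h2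
    have h4 := h1.clm_apply h3
    simpa [hA0] using! h4
  have h := DFunLike.congr_fun (d1.unique (d2.congr_of_eventuallyEq key)) v
  simp only [ContinuousLinearMap.flip_apply, ContinuousLinearMap.comp_apply,
    add_apply, ContinuousLinearMap.inl_apply, ContinuousLinearMap.inr_apply,
    hM0] at h
  -- Here `h` reads `D²M(v, 0)(0, w) = [v, w] + D²M(0, v)(w, 0)`; symmetry of the second derivative
  -- brings the last term into the required form.
  rw [h, hsymm (w, 0) (0, v)]
  abel

/-- The Lie bracket of the Lie algebra of a Lie group is the derivative of the adjoint
representation. -/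
theorem bracket_eq_bracketCLM (v w : E) :
    Bracket.bracket (L := GroupLieAlgebra 𝓘(ℂ, E) G) (M := GroupLieAlgebra 𝓘(ℂ, E) G) v w =
      (bracketCLM G v w : E) := by
  have hG : LieGroup 𝓘(ℂ, E) (minSmoothness ℂ 3) G := LieGroup.of_le (n := ω) le_top
  let V : (g : G) → TangentSpace 𝓘(ℂ, E) g := mulInvariantVectorField (I := 𝓘(ℂ, E)) (G := G) v
  let W : (g : G) → TangentSpace 𝓘(ℂ, E) g := mulInvariantVectorField (I := 𝓘(ℂ, E)) (G := G) w
  -- Brackets of vector fields commute with pullback. Pulling back by `unitPoint`, whose derivative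
  -- at `0` is the identity, moves the computation to the model space.
  have h1 := mpullback_mlieBracket (n := ω) (x₀ := (0 : E)) (f := unitPoint G)
    (I := 𝓘(ℂ, E)) (I' := 𝓘(ℂ, E)) (V := V) (W := W)
    (mdifferentiableAt_mulInvariantVectorField (I := 𝓘(ℂ, E)) (G := G) v)
    (mdifferentiableAt_mulInvariantVectorField (I := 𝓘(ℂ, E)) (G := G) w)
    contMDiffAt_unitPoint_zero le_top
  have h2 : mlieBracket 𝓘(ℂ, E) (mpullback 𝓘(ℂ, E) 𝓘(ℂ, E) (unitPoint G) V)
      (mpullback 𝓘(ℂ, E) 𝓘(ℂ, E) (unitPoint G) W) (0 : E) =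
      mlieBracket 𝓘(ℂ, E) (fun a : E => (coordField G (a, v) : E))
        (fun a : E => (coordField G (a, w) : E)) (0 : E) :=
    Filter.EventuallyEq.mlieBracket_vectorField_eq (eventually_mpullback_unitPoint (G := G) v)
      (eventually_mpullback_unitPoint (G := G) w)
  have h3 : mlieBracket 𝓘(ℂ, E) (fun a : E => (coordField G (a, v) : E))
        (fun a : E => (coordField G (a, w) : E)) (0 : E) = (bracketCLM G v w : E) := by
    have h (X Y : E → E) : mlieBracket 𝓘(ℂ, E) X Y (0 : E) =
        fderiv ℂ Y 0 (X 0) - fderiv ℂ X 0 (Y 0) := by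
      refine (congrFun (mlieBracketWithin_eq_lieBracketWithin (𝕜 := ℂ) (V := X) (W := Y)
        (s := univ)) (0 : E)).trans ?_
      rw [lieBracketWithin_univ, lieBracket_eq]
    refine (h (fun a : E => coordField G (a, v)) fun a : E => coordField G (a, w)).trans ?_
    rw [(hasFDerivAt_coordField v).fderiv, (hasFDerivAt_coordField w).fderiv,
      coordField_zero_left, coordField_zero_left, bracketCLM_eq]
    simp
    rfl
  have h4 : mfderiv 𝓘(ℂ, E) 𝓘(ℂ, E) (unitPoint G) (0 : E) = ContinuousLinearMap.id ℂ E :=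
    hasMFDerivAt_unitPoint_zero.mfderiv
  have h5 : (mpullback 𝓘(ℂ, E) 𝓘(ℂ, E) (unitPoint G) (mlieBracket 𝓘(ℂ, E) V W) (0 : E) : E) =
      (mlieBracket 𝓘(ℂ, E) V W (unitPoint G (0 : E)) : E) := by
    rw [mpullback_apply, h4]
    exact congrArg (fun T : E →L[ℂ] E => T (mlieBracket 𝓘(ℂ, E) V W (unitPoint G (0 : E)) : E))
      ContinuousLinearMap.inverse_id
  have h6 : (mlieBracket 𝓘(ℂ, E) V W (unitPoint G (0 : E)) : E) = mlieBracket 𝓘(ℂ, E) V W (1 : G) :=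
    congrArg (fun g : G => (mlieBracket 𝓘(ℂ, E) V W g : E)) unitPoint_zero
  exact h6.symm.trans (h5.symm.trans (h1.trans (h2.trans h3)))

lemma analyticAt_adRep_lieExp : AnalyticAt ℂ (fun y : E => adRep (E := E) (lieExp G y)) 0 ∧
    HasFDerivAt (fun y : E => adRep (E := E) (lieExp G y)) (bracketCLM G) 0 := by
  have hev : ∀ᶠ y in 𝓝 (0 : E), unitPoint G (unitCoord (lieExp G y) : E) = lieExp G y := by
    have : ContinuousAt (lieExp G : E → G) 0 := continuous_lieExp.continuousAt
    filter_upwards [this.eventually_mem (s := unitDomain E G) (by simpa using unitDomain_mem_nhds)]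
      with y hy using unitPoint_unitCoord hy
  have h1 : AnalyticAt ℂ (fun y : E => (unitCoord (lieExp G y) : E)) 0 :=
    (contDiffAt_unitCoord_comp (contMDiff_lieExp 0)
      (by simpa using one_mem_unitDomain)).analyticAt
  have h2 : AnalyticAt ℂ (fun a : E => adRep (E := E) (unitPoint G a))
      (unitCoord (lieExp G (0 : E)) : E) := by
    simpa using analyticAt_adRep_unitPoint
  constructor
  · refine (AnalyticAt.comp (g := fun a : E => adRep (E := E) (unitPoint G a))
      (f := fun y : E => (unitCoord (lieExp G y) : E)) h2 h1).congr ?_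
    filter_upwards [hev] with y hy
    simp only [Function.comp_apply, hy]
  · have h3 : HasFDerivAt (fun a : E => adRep (E := E) (unitPoint G a)) (bracketCLM G)
        (unitCoord (lieExp G (0 : E)) : E) := by
      rw [show (unitCoord (lieExp G (0 : E)) : E) = 0 by simp]
      exact analyticAt_adRep_unitPoint.differentiableAt.hasFDerivAt
    have h4 := h3.comp (0 : E) hasFDerivAt_unitCoord_lieExp
    refine h4.congr_of_eventuallyEq ?_
    filter_upwards [hev] with y hy
    simp only [Function.comp_apply, hy]

/-- The adjoint action of `exp y` is the exponential of `ad y`. -/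
theorem adRep_lieExp (y : E) : adRep (E := E) (lieExp G y) = NormedSpace.exp (bracketCLM G y) := by
  set T : E →L[ℂ] E := bracketCLM G y with hT
  set F : ℝ → E →L[ℂ] E := fun t => adRep (lieExp G (t • y)) with hF
  have hadd (s t : ℝ) : F (s + t) = F s * F t := by
    simp only [hF, lieExp_add_smul, adRep_mul]
    rfl
  have hF0 : F 0 = 1 := by simp [hF, adRep_one]; rfl
  have hd0 : HasDerivAt F T 0 := by
    have h5 : HasDerivAt (fun t : ℝ => t • y) y 0 := by
      simpa using (hasDerivAt_id (0 : ℝ)).smul_const y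
    exact ((analyticAt_adRep_lieExp (E := E) (G := G)).2.restrictScalars ℝ).comp_hasDerivAt_of_eq
      (0 : ℝ) h5 (by simp)
  have hd (t : ℝ) : HasDerivAt F (F t * T) t := by
    have h1 : HasDerivAt (fun ε => F t * F (ε - t)) (F t * T) t := by
      have h2 : HasDerivAt F T (t - t) := by simpa using hd0
      exact (h2.comp_sub_const t t).const_mul (F t)
    refine h1.congr_of_eventuallyEq (Eventually.of_forall fun s => ?_)
    simp only
    rw [← hadd]
    congr 1
    ring
  have hexp (t : ℝ) : HasDerivAt (fun u : ℝ => NormedSpace.exp (u • (-T)))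
      (-T * NormedSpace.exp (t • (-T))) t := hasDerivAt_exp_smul_const' (𝕂 := ℝ) (-T) t
  -- Since `F' = F T`, the product `F(t) exp(-tT)` has derivative zero.
  have hconst : ∀ s t : ℝ, F s * NormedSpace.exp (s • (-T)) = F t * NormedSpace.exp (t • (-T)) := by
    refine is_const_of_deriv_eq_zero (f := fun t => F t * NormedSpace.exp (t • (-T)))
      (fun t => ((hd t).mul (hexp t)).differentiableAt) fun t => ?_
    refine ((hd t).mul (hexp t)).deriv.trans ?_
    noncomm_ring
  have h := hconst 1 0
  rw [hF0, one_smul, zero_smul, NormedSpace.exp_zero, mul_one] at h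
  have h2 : F 1 = NormedSpace.exp T := by
    let : NormedAlgebra ℚ (E →L[ℂ] E) := NormedAlgebra.restrictScalars ℚ ℂ _
    have h3 : NormedSpace.exp (-T) * NormedSpace.exp T = 1 := by
      rw [← NormedSpace.exp_add_of_commute (Commute.neg_left (Commute.refl T)), neg_add_cancel,
        NormedSpace.exp_zero]
    calc F 1 = F 1 * (NormedSpace.exp (-T) * NormedSpace.exp T) := by rw [h3, mul_one]
      _ = NormedSpace.exp T := by rw [← mul_assoc, h, one_mul]
  simpa [hF] using h2

/-- The adjoint action is by automorphisms of the Lie algebra. -/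
theorem adRep_bracketCLM (g : G) (v w : E) :
    adRep g (bracketCLM G v w) = bracketCLM G (adRep g v) (adRep g w) := by
  -- Differentiating this conjugation identity at `t = 0` gives `ad(Ad(g)v) = Ad(g) ad(v) Ad(g)⁻¹`.
  have key (t : ℝ) : adRep (E := E) (lieExp G (t • adRep g v)) =
      adRep g ∘L adRep (lieExp G (t • v)) ∘L adRep g⁻¹ := by
    have : t • adRep g v = adRep g (t • v) := by
      rw [← Complex.coe_smul, ← Complex.coe_smul, map_smul]
    rw [this, lieExp_adRep, adRep_mul, adRep_mul]
    rfl
  have hd (z : E) : HasDerivAt (fun t : ℝ => adRep (E := E) (lieExp G (t • z))) (bracketCLM G z)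
      0 := by
    have h5 : HasDerivAt (fun t : ℝ => t • z) z 0 := by
      simpa using (hasDerivAt_id (0 : ℝ)).smul_const z
    exact ((analyticAt_adRep_lieExp (E := E) (G := G)).2.restrictScalars ℝ).comp_hasDerivAt_of_eq
      (0 : ℝ) h5 (by simp)
  have h1 := hd (adRep g v)
  simp only [key] at h1
  have h2 := ((hd v).const_mul (adRep g)).mul_const (adRep g⁻¹)
  have h3 := DFunLike.congr_fun (h1.unique h2) (adRep g w)
  rw [h3]
  change _ = adRep g (bracketCLM G v (adRep g⁻¹ (adRep g w)))
  rw [adRep_inv_apply_self]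

end Bracket

/-! ### Invariant subspaces of an operator and of its exponential. -/

section Invariance

open Filter

variable {E : Type*} [NormedAddCommGroup E] [NormedSpace ℂ E] [CompleteSpace E]

/-- If a closed subspace is invariant under `T` and contains `T v`, it contains `exp(T) v - v`. -/
lemma exp_apply_sub_mem {T : E →L[ℂ] E} {W : Submodule ℂ E} (hW : IsClosed (W : Set E))
    (hT : ∀ w ∈ W, T w ∈ W) {v : E} (hv : T v ∈ W) : NormedSpace.exp T v - v ∈ W := by
  have h1 := (ContinuousLinearMap.apply ℂ E v).hasSum (NormedSpace.exp_series_hasSum_exp' (𝕂 := ℂ) T)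
  have h2 := ((hasSum_nat_add_iff' 1).2 h1).tendsto_sum_nat
  simp only [Finset.range_one, Finset.sum_singleton] at h2
  have h3 : NormedSpace.exp T v - v ∈ (W : Set E) := by
    refine hW.mem_of_tendsto (by simpa using h2) (Eventually.of_forall fun n => ?_)
    refine W.sum_mem fun i _ => ?_
    have h4 : ∀ k : ℕ, T^[k] (T v) ∈ W := by
      intro k
      induction k with
      | zero => exact hv
      | succ k ih =>
        rw [Function.iterate_succ_apply']
        exact hT _ ih
    exact W.smul_mem _ (h4 i)
  exact h3

lemma exp_apply_mem {T : E →L[ℂ] E} {W : Submodule ℂ E} (hW : IsClosed (W : Set E))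
    (hT : ∀ w ∈ W, T w ∈ W) {v : E} (hv : v ∈ W) : NormedSpace.exp T v ∈ W := by
  have := W.add_mem (exp_apply_sub_mem hW hT (hT v hv)) hv
  rwa [sub_add_cancel] at this

/-- A small operator leaves a complemented subspace invariant if its exponential does. -/
theorem eventually_invariant_of_exp_invariant {W : Submodule ℂ E} (hW : IsClosed (W : Set E))
    (π : E →L[ℂ] E) (hπ : ∀ v, π v ∈ W) (hπ' : ∀ v ∈ W, π v = v) :
    ∀ᶠ T : E →L[ℂ] E in 𝓝 0, (∀ v ∈ W, (NormedSpace.exp T : E →L[ℂ] E) v ∈ W) →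
      ∀ v ∈ W, T v ∈ W := by
  let q : E →L[ℂ] E := ContinuousLinearMap.id ℂ E - π
  have hq (v : E) : q v = v - π v := rfl
  have hqW {v : E} (hv : v ∈ W) : q v = 0 := by rw [hq, hπ' v hv, sub_self]
  have hqq (v : E) : q (q v) = q v := by rw [hq v, map_sub, hqW (hπ v), sub_zero, hq]
  set C := ‖q‖ * ‖π‖ with hC
  have hC0 : 0 ≤ C := by positivity
  -- The operator `c = q T π` is the part of `T` leading out of `W`, and `T - c` preserves `W`,
  -- hence so does its exponential. Compressing `exp T - exp(T - c) - c` by `q` and `π` therefore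
  -- leaves exactly `-c`. Strict differentiability of `exp` at `0` bounds that expression by a small
  -- multiple of `‖c‖`; the constant is chosen so that `‖c‖ ≤ ‖c‖ / 2`, whence `c = 0`.
  have hst := (hasStrictFDerivAt_exp_zero (𝕂 := ℂ) (𝔸 := E →L[ℂ] E)).isLittleO.def
    (c := (2 * (C + 1))⁻¹) (by positivity)
  have hc : Tendsto (fun T : E →L[ℂ] E => (T, T - q ∘L T ∘L π)) (𝓝 0) (𝓝 (0, 0)) := by
    have : Continuous fun T : E →L[ℂ] E => (T, T - q ∘L T ∘L π) := by fun_prop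
    simpa using this.tendsto 0
  filter_upwards [hc.eventually hst] with T hT hexp v hv
  set c := q ∘L T ∘L π with hcdef
  have hT' : ∀ w ∈ W, (T - c) w ∈ W := by
    intro w hw
    have : (T - c) w = π (T w) := by
      simp [hcdef, hπ' w hw, hq]
    rw [this]
    exact hπ _
  have h1 : q ∘L (NormedSpace.exp T - NormedSpace.exp (T - c) - (T - (T - c))) ∘L π = -c := by
    ext w
    have e1 : q (NormedSpace.exp T (π w)) = 0 := hqW (hexp _ (hπ w))
    have e2 : q (NormedSpace.exp (T - c) (π w)) = 0 := hqW (exp_apply_mem hW hT' (hπ w))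
    have e3 : π (π w) = π w := hπ' _ (hπ w)
    simp only [ContinuousLinearMap.comp_apply, sub_apply, map_sub, e1, e2]
    simp [hcdef, e3, hqq]
  have h2 : ‖c‖ ≤ C * ((2 * (C + 1))⁻¹ * ‖c‖) := by
    calc ‖c‖ = ‖-c‖ := (norm_neg c).symm
      _ ≤ ‖q‖ * (‖NormedSpace.exp T - NormedSpace.exp (T - c) - (T - (T - c))‖ * ‖π‖) := by
        rw [← h1]
        refine (ContinuousLinearMap.opNorm_comp_le _ _).trans ?_
        gcongr
        exact ContinuousLinearMap.opNorm_comp_le _ _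
      _ ≤ ‖q‖ * (((2 * (C + 1))⁻¹ * ‖c‖) * ‖π‖) := by
        gcongr
        simpa using hT
      _ = C * ((2 * (C + 1))⁻¹ * ‖c‖) := by rw [hC]; ring
  have h3 : ‖c‖ = 0 := by
    have : C * ((2 * (C + 1))⁻¹ * ‖c‖) ≤ ‖c‖ / 2 := by
      rw [mul_inv, ← mul_assoc, ← mul_assoc, div_eq_inv_mul]
      gcongr ?_ * _
      rw [mul_comm C, mul_assoc]
      have : (C + 1)⁻¹ * C ≤ 1 := by
        rw [inv_mul_le_iff₀ (by positivity)]
        linarith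
      linarith
    linarith [norm_nonneg c]
  rw [norm_eq_zero] at h3
  have h4 : q (T v) = 0 := by
    have := DFunLike.congr_fun h3 v
    simpa [hcdef, hπ' v hv] using this
  rw [hq, sub_eq_zero] at h4
  rw [h4]
  exact hπ _

end Invariance

/-! ### Lie subgroups and their atlases. -/

section LieSubgroup

open Filter

variable {E : Type*} [NormedAddCommGroup E] [NormedSpace ℂ E] [CompleteSpace E]
  {G : Type*} [TopologicalSpace G] [ChartedSpace E G] [Group G] [LieGroup 𝓘(ℂ, E) ω G]

/-- A criterion for Lie subgroups. -/
theorem isLieSubgroup_of {H : Subgroup G} {V : Submodule ℂ (GroupLieAlgebra 𝓘(ℂ, E) G)}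
    (hH : IsClosed (H : Set G)) (hV : IsClosed (toModel V : Set E))
    (hexp : ∀ v ∈ toModel V, lieExp G v ∈ H)
    (hloc : ∀ᶠ y in 𝓝 (0 : E), lieExp G y ∈ H → y ∈ toModel V) : IsLieSubgroup H V where
  isClosed := hH
  isClosed_algebra := hV
  mem_iff x := by
    refine ⟨fun hx t => hexp _ ?_, fun hx => ?_⟩
    · rw [← Complex.coe_smul]
      exact (toModel V).smul_mem _ hx
    · have ht : Tendsto (fun t : ℝ => t • x) (𝓝[≠] 0) (𝓝 0) := by
        have : ContinuousAt (fun t : ℝ => t • x) 0 := by fun_prop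
        simpa [ContinuousAt] using! this.mono_left nhdsWithin_le_nhds
      obtain ⟨t, h1, h0⟩ := ((ht.eventually hloc).and self_mem_nhdsWithin).exists
      have h2 := h1 (hx t)
      rw [← Complex.coe_smul] at h2
      exact ((toModel V).smul_mem_iff (by simpa using h0)).1 h2
  adapted := by
    obtain ⟨Φ, h0, hΦ, hs, hs'⟩ := exists_lieExp_openPartialHomeomorph (E := E) (G := G)
    obtain ⟨W, hW, hWo, h0W⟩ := eventually_nhds_iff.1 hloc
    refine ⟨Φ.restrOpen W hWo, ⟨h0, h0W⟩, fun x hx => hΦ x hx.1, hs.mono inter_subset_left,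
      hs'.mono fun g hg => hg.1, ?_⟩
    ext g
    constructor
    · rintro ⟨y, ⟨hy, hyV⟩, rfl⟩
      exact ⟨⟨y, hy, rfl⟩, hexp y hyV⟩
    · rintro ⟨⟨y, hy, rfl⟩, hg⟩
      exact ⟨y, ⟨hy, hW y hy.2 hg⟩, rfl⟩

/-- Near each of its points, the subgroup `H` is an analytic retract of `G`. -/
def HasLocalRetractions (H : Subgroup G) (V : Submodule ℂ E) [ChartedSpace V H] : Prop :=
  ∀ h₀ : H, ∃ ρ : G → H, ContMDiffAt 𝓘(ℂ, E) 𝓘(ℂ, V) ω ρ h₀ ∧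
    ∀ᶠ g in 𝓝 (h₀ : G), ∀ h : H, (h : G) = g → ρ g = h

/-- A map into a Lie subgroup is analytic if it is analytic as a map into the group. -/
theorem HasLocalRetractions.contMDiffWithinAt {H : Subgroup G} {V : Submodule ℂ E}
    [ChartedSpace V H]
    (hH : HasLocalRetractions H V) {F B M : Type*} [NormedAddCommGroup F] [NormedSpace ℂ F]
    [TopologicalSpace B] {I : ModelWithCorners ℂ F B} [TopologicalSpace M] [ChartedSpace B M]
    {f : M → H} {s : Set M} {p : M} (hp : p ∈ s)
    (hf : ContMDiffWithinAt I 𝓘(ℂ, E) ω (fun q => (f q : G)) s p) :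
    ContMDiffWithinAt I 𝓘(ℂ, V) ω f s p := by
  obtain ⟨ρ, hρ, hρ'⟩ := hH (f p)
  have h1 : ContMDiffWithinAt I 𝓘(ℂ, V) ω (fun q => ρ (f q : G)) s p :=
    ContMDiffAt.comp_contMDiffWithinAt (g := ρ) p hρ hf
  refine h1.congr_of_eventuallyEq_of_mem ?_ hp
  filter_upwards [hf.continuousWithinAt.eventually hρ'] with q hq
  exact (hq _ rfl).symm

theorem HasLocalRetractions.contMDiff {H : Subgroup G} {V : Submodule ℂ E} [ChartedSpace V H]
    (hH : HasLocalRetractions H V) {F B M : Type*} [NormedAddCommGroup F] [NormedSpace ℂ F]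
    [TopologicalSpace B] {I : ModelWithCorners ℂ F B} [TopologicalSpace M] [ChartedSpace B M]
    {f : M → H} (hf : ContMDiff I 𝓘(ℂ, E) ω (fun q => (f q : G))) : ContMDiff I 𝓘(ℂ, V) ω f :=
  fun p => hH.contMDiffWithinAt (mem_univ p) (hf p)

variable {H : Subgroup G} {V : Submodule ℂ E}

/-- The chart at the unit element of a Lie subgroup, given by the exponential function. -/
noncomputable def subgroupChart (hexp : ∀ v ∈ V, lieExp G v ∈ H) (Φ : OpenPartialHomeomorph E G)
    (hΦ : ∀ x ∈ Φ.source, Φ x = lieExp G x)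
    (hV : ∀ g ∈ Φ.target, g ∈ H → Φ.symm g ∈ V)
    (π : E →L[ℂ] V) (hπ : ∀ v : V, π v = v) : OpenPartialHomeomorph H V where
  toFun h := π (Φ.symm h)
  invFun v := ⟨lieExp G (v : E), hexp v v.2⟩
  source := {h | (h : G) ∈ Φ.target}
  target := {v | (v : E) ∈ Φ.source}
  map_source' h hh := by
    have h1 := hπ ⟨_, hV h hh h.2⟩
    simp only at h1
    simp only [mem_ofPred_eq, h1]
    exact Φ.map_target hh
  map_target' v hv := by
    simp only [mem_ofPred_eq, ← hΦ _ hv]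
    exact Φ.map_source hv
  left_inv' h hh := by
    have h1 := hπ ⟨_, hV h hh h.2⟩
    simp only at h1
    ext
    simp only [h1, ← hΦ _ (Φ.map_target hh)]
    exact Φ.right_inv hh
  right_inv' v hv := by
    simp only [← hΦ _ hv, Φ.left_inv hv, hπ]
  open_source := Φ.open_target.preimage continuous_subtype_val
  open_target := Φ.open_source.preimage continuous_subtype_val
  continuousOn_toFun := π.continuous.comp_continuousOn
    (Φ.continuousOn_symm.comp continuous_subtype_val.continuousOn fun _ h => h)
  continuousOn_invFun :=
    ((continuous_lieExp.comp continuous_subtype_val).subtype_mk _).continuousOn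

/-- The translates of a chart at the unit element of a topological group. -/
noncomputable abbrev translatedChartedSpace {A B : Type*} [TopologicalSpace A] [Group A]
    [ContinuousMul A] [TopologicalSpace B] (c : OpenPartialHomeomorph A B) (h1 : 1 ∈ c.source) :
    ChartedSpace B A where
  atlas := range fun h : A => (Homeomorph.mulLeft h⁻¹).toOpenPartialHomeomorph.trans c
  chartAt h := (Homeomorph.mulLeft h⁻¹).toOpenPartialHomeomorph.trans c
  mem_chart_source h := by simpa using h1
  chart_mem_atlas h := ⟨h, rfl⟩

/-- A Lie subgroup with complemented Lie algebra is a Lie group. -/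
theorem IsLieSubgroup.exists_atlas {V : Submodule ℂ (GroupLieAlgebra 𝓘(ℂ, E) G)}
    (hH : IsLieSubgroup H V) (π : E →L[ℂ] toModel V) (hπ : ∀ v : toModel V, π v = v) :
    ∃ _ : ChartedSpace (toModel V) H, IsLieSubgroupAtlas H V ∧
      HasLocalRetractions H (toModel V) := by
  have htop := topologicalGroup_of_lieGroup 𝓘(ℂ, E) ω (G := G)
  obtain ⟨Φ, h0, hΦ, hΦs, hΦt, hΦH⟩ := hH.adapted
  have hexp : ∀ v ∈ toModel V, lieExp G v ∈ H := fun v hv => by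
    simpa using (hH.mem_iff v).1 hv 1
  have hV : ∀ g ∈ Φ.target, g ∈ H → Φ.symm g ∈ toModel V := by
    intro g hg hgH
    have hs := Φ.map_target hg
    have hg' : lieExp G (Φ.symm g) = g := by rw [← hΦ _ hs, Φ.right_inv hg]
    have : g ∈ lieExp G '' Φ.source ∩ H := ⟨⟨_, hs, hg'⟩, hgH⟩
    rw [← hΦH] at this
    obtain ⟨y, ⟨hy, hyV⟩, hyg⟩ := this
    have : y = Φ.symm g := Φ.injOn hy hs (by rw [hΦ y hy, hΦ _ hs, hyg, hg'])
    rwa [← this]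
  have h1t : (1 : G) ∈ Φ.target := by
    have := Φ.map_source h0
    rwa [hΦ 0 h0, lieExp_zero] at this
  have hsymm1 : Φ.symm 1 = 0 := by
    rw [← lieExp_zero (E := E) (G := G), ← hΦ 0 h0, Φ.left_inv h0]
  have hΦt' {g : G} (hg : g ∈ Φ.target) : ContMDiffAt 𝓘(ℂ, E) 𝓘(ℂ, E) ω Φ.symm g :=
    hΦt.contMDiffAt (Φ.open_target.mem_nhds hg)
  have hπs : ContMDiff 𝓘(ℂ, E) 𝓘(ℂ, toModel V) ω π := π.contMDiff
  let c := subgroupChart hexp Φ hΦ hV π hπ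
  have hc1 : (1 : H) ∈ c.source := h1t
  let cs : ChartedSpace (toModel V) H := translatedChartedSpace c hc1
  have hexpV : ContMDiff 𝓘(ℂ, toModel V) 𝓘(ℂ, E) ω (fun v : toModel V => lieExp G (v : E)) :=
    contMDiff_lieExp.comp (toModel V).subtypeL.contMDiff
  have hmani : IsManifold 𝓘(ℂ, toModel V) ω H := by
    refine isManifold_of_contDiffOn _ _ _ ?_
    rintro _ _ ⟨a, rfl⟩ ⟨b, rfl⟩
    have hml (h : H) : (Homeomorph.mulLeft a⁻¹).symm h = a * h := by
      rw [Homeomorph.mulLeft_symm]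
      simp
    simp only [modelWithCornersSelf_coe, modelWithCornersSelf_coe_symm, Function.id_comp,
      Function.comp_id, preimage_id, range_id, inter_univ]
    -- The transition map between the charts translated by `a` and `b`, extended past `H` by the
    -- projection `π`. In this form it is a composite of analytic maps through `G`.
    have h : ∀ v : toModel V, ((b : G)⁻¹ * ((a : G) * lieExp G (v : E))) ∈ Φ.target →
        ContDiffAt ℂ ω (fun v : toModel V => π (Φ.symm ((b : G)⁻¹ * ((a : G) * lieExp G (v : E)))))
          v := by
      intro v hv
      refine contMDiffAt_iff_contDiffAt.1 (hπs.contMDiffAt.comp v ?_)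
      exact ContMDiffAt.comp (g := Φ.symm) v (hΦt' hv)
        (contMDiffAt_const.mul (contMDiffAt_const.mul (hexpV v)))
    intro v hv
    refine ((h v ?_).congr_of_eventuallyEq (Eventually.of_forall fun w => ?_)).contDiffWithinAt
    · have := hv.2
      simpa [c, subgroupChart, hml] using this.2
    · simp [c, subgroupChart, hml]
  have hchart (h₀ h : H) : chartAt (toModel V) h₀ h = π (Φ.symm ((h₀ : G)⁻¹ * h)) := rfl
  have hchart' (h₀ : H) (v : toModel V) :
      (((chartAt (toModel V) h₀).symm v : H) : G) = h₀ * lieExp G (v : E) := by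
    change (((h₀⁻¹ : H)⁻¹ * ⟨lieExp G (v : E), _⟩ : H) : G) = _
    simp
  have hleft (h₀ : G) : Tendsto (fun g : G => h₀⁻¹ * g) (𝓝 h₀) (𝓝 1) := by
    have : ContinuousAt (fun g : G => h₀⁻¹ * g) h₀ := by fun_prop
    simpa [ContinuousAt] using! this
  have hincl : ContMDiff 𝓘(ℂ, toModel V) 𝓘(ℂ, E) ω (Subtype.val : H → G) := by
    intro h₀
    have h1 : ContMDiffAt 𝓘(ℂ, toModel V) 𝓘(ℂ, E) ω
        (fun h : H => (h₀ : G) * lieExp G (chartAt (toModel V) h₀ h : E)) h₀ := by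
      refine contMDiffAt_const.mul (hexpV.contMDiffAt.comp h₀ ?_)
      exact contMDiffOn_chart.contMDiffAt (chart_source_mem_nhds _ h₀)
    refine h1.congr_of_eventuallyEq ?_
    filter_upwards [chart_source_mem_nhds (toModel V) h₀] with h hh
    rw [← hchart', (chartAt (toModel V) h₀).left_inv hh]
  -- Near `h₀` the retraction is `g ↦ h₀ exp(π(log(h₀⁻¹ g)))`. It lets analyticity of maps into `H`,
  -- in particular of the group operations, be checked in `G`.
  have hret : HasLocalRetractions H (toModel V) := by
    intro h₀
    refine ⟨fun g => (chartAt (toModel V) h₀).symm (π (Φ.symm ((h₀ : G)⁻¹ * g))), ?_, ?_⟩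
    · refine ContMDiffAt.comp (I' := 𝓘(ℂ, toModel V)) (g := (chartAt (toModel V) h₀).symm)
        (f := fun g => π (Φ.symm ((h₀ : G)⁻¹ * g))) (h₀ : G) ?_ ?_
      · refine contMDiffOn_chart_symm.contMDiffAt ((chartAt (toModel V) h₀).open_target.mem_nhds ?_)
        rw [← hchart]
        exact mem_chart_target (toModel V) h₀
      · refine hπs.contMDiffAt.comp (h₀ : G) ?_
        exact ContMDiffAt.comp (g := Φ.symm) (h₀ : G) (hΦt' (by simpa using h1t))
          (contMDiffAt_const.mul contMDiffAt_id)
    · filter_upwards [(hleft h₀).eventually (Φ.open_target.mem_nhds h1t)] with g hg h hhg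
      subst hhg
      rw [← hchart]
      refine (chartAt (toModel V) h₀).left_inv ?_
      refine ⟨mem_univ _, ?_⟩
      exact hg
  have hlie : LieGroup 𝓘(ℂ, toModel V) ω H :=
    { hmani with
      contMDiff_mul := hret.contMDiff
        ((hincl.comp contMDiff_fst).mul (hincl.comp contMDiff_snd))
      contMDiff_inv := hret.contMDiff hincl.inv }
  refine ⟨cs, ⟨hlie, hincl, ?_⟩, hret⟩
  refine ⟨hincl.continuous.continuousAt, ?_⟩
  -- In the exponential chart at `1` the inclusion is the exponential function restricted to `V`,
  -- whose derivative at `0` is the inclusion of `V`.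
  have e0 : chartAt (toModel V) (1 : H) 1 = 0 := by
    rw [hchart]
    simp [hsymm1]
  simp only [mfld_simps, writtenInExtChartAt, e0]
  have h2 : HasFDerivAt (fun v : toModel V => (unitCoord (lieExp G (v : E)) : E))
      ((ContinuousLinearMap.id ℂ E) ∘L (toModel V).subtypeL) 0 :=
    HasFDerivAt.comp (g := fun y : E => (unitCoord (lieExp G y) : E)) (0 : toModel V)
      (by simpa using hasFDerivAt_unitCoord_lieExp) (toModel V).subtypeL.hasFDerivAt
  have h3 := h2.add_const (chartAt E (1 : G) 1)
  rw [ContinuousLinearMap.id_comp] at h3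
  refine HasFDerivAt.hasFDerivWithinAt (𝕜 := ℂ) (E := toModel V) (F := E) ?_
  refine h3.congr_of_eventuallyEq (Eventually.of_forall fun v => ?_)
  simp [unitCoord, hchart']

/-- The exponential function of a Lie subgroup is the restriction of the exponential function. -/
theorem IsLieSubgroup.lieExp_eq {V : Submodule ℂ (GroupLieAlgebra 𝓘(ℂ, E) G)}
    (hH : IsLieSubgroup H V) [ChartedSpace (toModel V) H] (hA : IsLieSubgroupAtlas H V)
    (hR : HasLocalRetractions H (toModel V)) (v : toModel V) :
    (lieExp H v : G) = lieExp G (v : E) := by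
  have := hA.lieGroup
  have hexp : ∀ v ∈ toModel V, lieExp G v ∈ H := fun v hv => by
    simpa using (hH.mem_iff v).1 hv 1
  let e : toModel V → H := fun v => ⟨lieExp G (v : E), hexp v v.2⟩
  have he : ContMDiff 𝓘(ℂ, toModel V) 𝓘(ℂ, toModel V) ω e :=
    hR.contMDiff (contMDiff_lieExp.comp (toModel V).subtypeL.contMDiff)
  have he0 : e 0 = 1 := by ext; simp [e]
  -- the derivative of `e` at `0` is the identity
  have hd : HasFDerivAt (fun v : toModel V => (unitCoord (e v) : toModel V))
      (ContinuousLinearMap.id ℂ (toModel V)) 0 := by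
    have h1 := (contDiffAt_unitCoord_comp (he 0) (by
      rw [he0]; exact one_mem_unitDomain)).differentiableAt (by simp) |>.hasFDerivAt
    set D := fderiv ℂ (fun v : toModel V => (unitCoord (e v) : toModel V)) 0
    have h2 : HasMFDerivAt 𝓘(ℂ, toModel V) 𝓘(ℂ, toModel V) e 0 D :=
      (hasMFDerivAt_complex_iff he0).2 ⟨he.continuous.continuousAt, h1⟩
    have h3 : ∀ h : H, h = 1 → HasMFDerivAt 𝓘(ℂ, toModel V) 𝓘(ℂ, E) (Subtype.val : H → G) h
        ((toModel V).subtypeL : toModel V →L[ℂ] E) := by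
      rintro _ rfl
      exact hA.hasMFDerivAt_incl
    -- Composed with the inclusion into `G`, the map `e` is `exp_G` on `V`. The inclusion of `V`
    -- into `E` is injective, so this determines `D`.
    have h4 := HasMFDerivAt.comp (0 : toModel V) (h3 (e 0) he0) h2
    have h5 : HasFDerivAt (fun v : toModel V => (unitCoord (lieExp G (v : E)) : E))
        ((ContinuousLinearMap.id ℂ E) ∘L (toModel V).subtypeL) 0 :=
      HasFDerivAt.comp (g := fun y : E => (unitCoord (lieExp G y) : E)) (0 : toModel V)
        (by simpa using hasFDerivAt_unitCoord_lieExp) (toModel V).subtypeL.hasFDerivAt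
    have h6 := ((hasMFDerivAt_complex_iff (by simp [he0])).1 h4).2
    have h7 := h6.unique h5
    convert! h1 using 1
    ext w
    have h8 := DFunLike.congr_fun h7 w
    exact h8.symm
  have hγ : IsOneParameterGroup (fun t : ℝ => e (t • v)) v := by
    refine ⟨fun s t => ?_, (hasMFDerivAt_real_iff (by simp [he0])).2 ⟨?_, ?_⟩⟩
    · ext
      simpa [e] using! lieExp_add_smul (G := G) s t (v : E)
    · exact (he.continuous.comp (by fun_prop : Continuous fun t : ℝ => t • v)).continuousAt
    · have h5 : HasDerivAt (fun t : ℝ => t • v) v 0 := by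
        simpa using (hasDerivAt_id (0 : ℝ)).smul_const v
      exact (hd.restrictScalars ℝ).comp_hasDerivAt_of_eq (0 : ℝ) h5 (by simp)
  rw [hγ.lieExp_eq]
  simp [e]

end LieSubgroup

/-! ### Functional calculus of an operator with finitely many real eigenvalues. -/

section SpectralCalculus

open Filter

variable {E : Type*} [NormedAddCommGroup E] [NormedSpace ℂ E]

/-- A bounded operator which is diagonalizable with finitely many eigenvalues, all of them real. -/
def IsRealDiagonalizable (D : E →L[ℂ] E) : Prop :=
  ∃ S : Finset ℝ, ⨆ r ∈ S, Module.End.eigenspace (D : E →ₗ[ℂ] E) (r : ℂ) = ⊤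

/-- The sum of the eigenspaces of `D` for the real eigenvalues in `A`. -/
def spectralSubspace (D : E →L[ℂ] E) (A : Set ℝ) : Submodule ℂ E :=
  ⨆ r ∈ A, Module.End.eigenspace (D : E →ₗ[ℂ] E) (r : ℂ)

variable {D : E →L[ℂ] E} {A B : Set ℝ}

lemma mem_spectralSubspace {r : ℝ} (hr : r ∈ A) {v : E} (hv : D v = (r : ℂ) • v) :
    v ∈ spectralSubspace D A :=
  Submodule.mem_iSup_of_mem r (Submodule.mem_iSup_of_mem hr (Module.End.mem_eigenspace_iff.2 hv))

@[elab_as_elim]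
lemma spectralSubspace_induction {p : E → Prop} {v : E} (hv : v ∈ spectralSubspace D A)
    (h : ∀ r ∈ A, ∀ w, D w = (r : ℂ) • w → p w) (h0 : p 0) (hadd : ∀ v w, p v → p w → p (v + w)) :
    p v := by
  rw [spectralSubspace, iSup_subtype'] at hv
  refine Submodule.iSup_induction (motive := p) _ hv (fun i w hw => ?_) h0 hadd
  exact h i i.2 w (Module.End.mem_eigenspace_iff.1 hw)

lemma spectralSubspace_mono (h : A ⊆ B) : spectralSubspace D A ≤ spectralSubspace D B :=
  biSup_mono h

lemma spectralSubspace_neg : spectralSubspace (-D) A = spectralSubspace D (-A) := by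
  refine le_antisymm (fun v hv => ?_) (fun v hv => ?_)
  · refine spectralSubspace_induction hv (fun r hr w hw => ?_) (zero_mem _)
      fun _ _ => add_mem
    refine mem_spectralSubspace (r := -r) (by simpa using hr) ?_
    rw [neg_apply, neg_eq_iff_eq_neg] at hw
    rw [hw]
    simp
  · refine spectralSubspace_induction hv (fun r hr w hw => ?_) (zero_mem _)
      fun _ _ => add_mem
    refine mem_spectralSubspace (r := -r) (by simpa using hr) ?_
    rw [neg_apply, hw]
    simp

lemma mem_spectralSubspace_singleton_zero {v : E} : v ∈ spectralSubspace D {0} ↔ D v = 0 := by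
  simp [spectralSubspace]

namespace IsRealDiagonalizable

lemma neg (hD : IsRealDiagonalizable D) : IsRealDiagonalizable (-D) := by
  classical
  obtain ⟨S, hS⟩ := hD
  refine ⟨S.image (fun r => -r), ?_⟩
  have h1 := spectralSubspace_neg (D := D) (A := -(S : Set ℝ))
  rw [neg_neg] at h1
  have h2 : spectralSubspace D (S : Set ℝ) = ⊤ := by simpa [spectralSubspace] using hS
  rw [h2] at h1
  rw [← h1, spectralSubspace]
  congr 1
  ext r
  simp [neg_eq_iff_eq_neg]

lemma spectralSubspace_univ (hD : IsRealDiagonalizable D) : spectralSubspace D univ = ⊤ := by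
  obtain ⟨S, hS⟩ := hD
  rw [eq_top_iff, ← hS]
  exact biSup_mono fun _ _ => mem_univ _

lemma ext (hD : IsRealDiagonalizable D) {F : Type*} [NormedAddCommGroup F] [NormedSpace ℂ F]
    {T T' : E →L[ℂ] F} (h : ∀ (r : ℝ) (v : E), D v = (r : ℂ) • v → T v = T' v) : T = T' := by
  ext v
  have hv : v ∈ spectralSubspace D univ := by rw [hD.spectralSubspace_univ]; trivial
  refine spectralSubspace_induction hv (fun r _ w hw => h r w hw) (by simp) fun v w hv hw => ?_
  rw [map_add, map_add, hv, hw]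

/-- The operator is the Lagrange interpolation polynomial of `f` on `S`, evaluated at `D`. For `r ∉
S` there is nothing to check: the polynomial with roots `S` annihilates `D`, so eigenvectors for `r`
vanish. This is why `f` need not be specified together with the spectrum. -/
lemma exists_calculus (hD : IsRealDiagonalizable D) (f : ℝ → ℂ) :
    ∃ T : E →L[ℂ] E, ∀ (r : ℝ) (v : E), D v = (r : ℂ) • v → T v = f r • v := by
  obtain ⟨S, hS⟩ := hD
  have key (q : Polynomial ℂ) {c : ℂ} {v : E} (hv : D v = c • v) :
      (Polynomial.aeval D q) v = q.eval c • v := by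
    induction q using Polynomial.induction_on' with
    | add p q hp hq => simp [hp, hq, add_smul]
    | monomial n a =>
      have hn : ∀ n : ℕ, (D ^ n) v = c ^ n • v := by
        intro n
        induction n with
        | zero => simp
        | succ n ih =>
          rw [pow_succ, mul_apply_eq_comp, hv, map_smul, ih, smul_smul, pow_succ,
            mul_comm]
      simp only [Polynomial.aeval_monomial, Polynomial.eval_monomial, mul_smul, ← hn]
      simp [Algebra.algebraMap_eq_smul_one]
  -- eigenvectors with other eigenvalues vanish
  have hbot (r : ℝ) (hr : r ∉ S) (v : E) (hv : D v = (r : ℂ) • v) : v = 0 := by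
    let q : Polynomial ℂ := ∏ s ∈ S, (Polynomial.X - Polynomial.C (s : ℂ))
    have h1 : ∀ w : E, (Polynomial.aeval D q) w = 0 := by
      intro w
      have hw : w ∈ spectralSubspace D (S : Set ℝ) := by
        simp only [spectralSubspace, SetLike.mem_coe, hS]
        trivial
      refine spectralSubspace_induction hw (fun s hs u hu => ?_) (by simp)
        fun u u' h h' => by rw [map_add, h, h', add_zero]
      rw [key q hu, Polynomial.eval_prod, Finset.prod_eq_zero (Finset.mem_coe.1 hs) (by simp),
        zero_smul]
    have h2 := key q hv
    rw [h1, eq_comm, smul_eq_zero, Polynomial.eval_prod, Finset.prod_eq_zero_iff] at h2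
    refine h2.resolve_left ?_
    rintro ⟨s, hs, h⟩
    rw [Polynomial.eval_sub, Polynomial.eval_X, Polynomial.eval_C, sub_eq_zero] at h
    exact hr (Complex.ofReal_injective h ▸ hs)
  refine ⟨Polynomial.aeval D (Lagrange.interpolate S (fun r : ℝ => (r : ℂ)) f), fun r v hv => ?_⟩
  by_cases hr : r ∈ S
  · rw [key _ hv, Lagrange.eval_interpolate_at_node _ Complex.ofReal_injective.injOn hr]
  · simp [hbot r hr v hv]

/-- The functional calculus of a real diagonalizable operator. -/
noncomputable def calculus (hD : IsRealDiagonalizable D) (f : ℝ → ℂ) : E →L[ℂ] E :=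
  (hD.exists_calculus f).choose

variable (hD : IsRealDiagonalizable D)

lemma calculus_apply (f : ℝ → ℂ) {r : ℝ} {v : E} (hv : D v = (r : ℂ) • v) :
    hD.calculus f v = f r • v :=
  (hD.exists_calculus f).choose_spec r v hv

lemma calculus_comp (f g : ℝ → ℂ) : hD.calculus f ∘L hD.calculus g = hD.calculus (f * g) := by
  refine hD.ext fun r v hv => ?_
  simp [hD.calculus_apply _ hv, smul_smul, mul_comm]

lemma calculus_calculus (f g : ℝ → ℂ) (v : E) :
    hD.calculus f (hD.calculus g v) = hD.calculus (f * g) v :=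
  DFunLike.congr_fun (hD.calculus_comp f g) v

lemma calculus_add (f g : ℝ → ℂ) : hD.calculus f + hD.calculus g = hD.calculus (f + g) := by
  refine hD.ext fun r v hv => ?_
  simp [hD.calculus_apply _ hv, add_smul]

lemma calculus_one : hD.calculus 1 = ContinuousLinearMap.id ℂ E := by
  refine hD.ext fun r v hv => ?_
  simp [hD.calculus_apply _ hv]

lemma calculus_id : hD.calculus (fun r => (r : ℂ)) = D := by
  refine hD.ext fun r v hv => ?_
  rw [hD.calculus_apply _ hv, hv]

lemma calculus_congr {f g : ℝ → ℂ} (h : EqOn f g A) {v : E} (hv : v ∈ spectralSubspace D A) :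
    hD.calculus f v = hD.calculus g v := by
  refine spectralSubspace_induction hv (fun r hr w hw => ?_) (by simp) fun v w hv hw => ?_
  · rw [hD.calculus_apply _ hw, hD.calculus_apply _ hw, h hr]
  · rw [map_add, map_add, hv, hw]

lemma calculus_mem (f : ℝ → ℂ) (h : ∀ r ∉ A, f r = 0) (v : E) :
    hD.calculus f v ∈ spectralSubspace D A := by
  have hv : v ∈ spectralSubspace D univ := by rw [hD.spectralSubspace_univ]; trivial
  refine spectralSubspace_induction hv (fun r _ w hw => ?_) (by simp) fun v w hv hw => ?_
  · rw [hD.calculus_apply _ hw]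
    by_cases hr : r ∈ A
    · exact Submodule.smul_mem _ _ (mem_spectralSubspace hr hw)
    · simp [h r hr]
  · rw [map_add]
    exact add_mem hv hw

lemma calculus_mem_of_mem (f : ℝ → ℂ) {v : E} (hv : v ∈ spectralSubspace D A) :
    hD.calculus f v ∈ spectralSubspace D A := by
  rw [hD.calculus_congr (g := A.indicator f) (fun r hr => (indicator_of_mem hr f).symm) hv]
  exact hD.calculus_mem _ (fun r hr => indicator_of_notMem hr f) v

lemma apply_mem_of_mem (hD : IsRealDiagonalizable D) {v : E} (hv : v ∈ spectralSubspace D A) :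
    D v ∈ spectralSubspace D A := by
  have := hD.calculus_mem_of_mem (fun r => (r : ℂ)) hv
  rwa [hD.calculus_id] at this

/-- The projection onto a spectral subspace along the complementary one. -/
noncomputable def proj (A : Set ℝ) : E →L[ℂ] E := hD.calculus (A.indicator 1)

lemma proj_mem (v : E) : hD.proj A v ∈ spectralSubspace D A :=
  hD.calculus_mem _ (fun _ hr => indicator_of_notMem hr _) v

lemma proj_eq_self {v : E} (hv : v ∈ spectralSubspace D A) : hD.proj A v = v := by
  rw [proj, hD.calculus_congr (g := 1) (fun r hr => indicator_of_mem hr _) hv, hD.calculus_one]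
  rfl

lemma proj_eq_zero {v : E} (hv : v ∈ spectralSubspace D B) (h : Disjoint A B) :
    hD.proj A v = 0 := by
  rw [proj, hD.calculus_congr (A := B) (g := 0)
    (fun r hr => indicator_of_notMem (fun hr' => h.le_bot ⟨hr', hr⟩) _) hv]
  have : hD.calculus 0 = 0 := hD.ext fun r v hv => by simp [hD.calculus_apply _ hv]
  rw [this]
  rfl

lemma mem_iff_proj_eq {v : E} : v ∈ spectralSubspace D A ↔ hD.proj A v = v :=
  ⟨hD.proj_eq_self, fun h => h ▸ hD.proj_mem v⟩

lemma proj_compl_add (v : E) : hD.proj A v + hD.proj Aᶜ v = v := by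
  have : hD.proj A + hD.proj Aᶜ = ContinuousLinearMap.id ℂ E := by
    rw [proj, proj, calculus_add, ← hD.calculus_one, indicator_self_add_compl]
  exact DFunLike.congr_fun this v

/-- Membership in a spectral subspace may be tested after applying `D` if `0 ∈ A`. -/
lemma mem_of_apply_mem (hD : IsRealDiagonalizable D) (h0 : (0 : ℝ) ∈ A) {v : E}
    (hv : D v ∈ spectralSubspace D A) : v ∈ spectralSubspace D A := by
  -- The convention `0⁻¹ = 0` makes `r⁻¹ r` the indicator of `r ≠ 0`. So `v` is recovered from `D v`
  -- up to its component in the kernel, which lies in the subspace because `0 ∈ A`.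
  have h1 : hD.calculus (fun r => (r : ℂ)⁻¹) (D v) ∈ spectralSubspace D A :=
    hD.calculus_mem_of_mem _ hv
  have h2 : hD.calculus (({0} : Set ℝ).indicator 1) v ∈ spectralSubspace D A :=
    hD.calculus_mem _ (fun r hr => indicator_of_notMem (fun h => hr (h ▸ h0)) _) v
  have h3 : hD.calculus (fun r => (r : ℂ)⁻¹) (D v) + hD.calculus (({0} : Set ℝ).indicator 1) v
      = v := by
    rw [← DFunLike.congr_fun hD.calculus_id v, hD.calculus_calculus, ← add_apply, hD.calculus_add]
    have : ((fun r : ℝ => (r : ℂ)⁻¹) * fun r : ℝ => (r : ℂ)) + ({0} : Set ℝ).indicator 1 = 1 := by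
      ext r
      by_cases hr : r = 0
      · simp [hr]
      · simp [hr]
    rw [this, hD.calculus_one]
    rfl
  rw [← h3]
  exact add_mem h1 h2

lemma isClosed (hD : IsRealDiagonalizable D) (A : Set ℝ) :
    IsClosed (spectralSubspace D A : Set E) := by
  have : (spectralSubspace D A : Set E) = {v | hD.proj A v = v} :=
    Set.ext fun v => hD.mem_iff_proj_eq
  rw [this]
  exact isClosed_eq (hD.proj A).continuous continuous_id

/-- The continuous projection onto a spectral subspace. -/
noncomputable def projTo (A : Set ℝ) : E →L[ℂ] spectralSubspace D A :=
  (hD.proj A).codRestrict _ hD.proj_mem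

lemma coe_projTo (v : E) : (hD.projTo A v : E) = hD.proj A v := rfl

/-- Subspaces which are large enough are spectral subspaces. -/
lemma eq_spectralSubspace (hD : IsRealDiagonalizable D) {V V' : Submodule ℂ E}
    (hV : V ≤ spectralSubspace D A) (hV' : V' ≤ spectralSubspace D Aᶜ) (h : V ⊔ V' = ⊤) :
    V = spectralSubspace D A := by
  refine le_antisymm hV fun v hv => ?_
  have h1 : v ∈ V ⊔ V' := by rw [h]; trivial
  obtain ⟨a, ha, b, hb, rfl⟩ := Submodule.mem_sup.1 h1
  have h2 := hD.proj_eq_self hv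
  rw [map_add, hD.proj_eq_self (hV ha), hD.proj_eq_zero (hV' hb) disjoint_compl_right,
    add_zero] at h2
  rwa [← h2]

lemma inter_mem (hD : IsRealDiagonalizable D) {v : E} (hA : v ∈ spectralSubspace D A)
    (hB : v ∈ spectralSubspace D B) : v ∈ spectralSubspace D (A ∩ B) := by
  have h1 : hD.proj A (hD.proj B v) = v := by rw [hD.proj_eq_self hB, hD.proj_eq_self hA]
  rw [proj, proj, hD.calculus_calculus] at h1
  rw [← h1]
  refine hD.calculus_mem _ (fun r hr => ?_) v
  by_cases h : r ∈ A
  · simp [show r ∉ B from fun h' => hr ⟨h, h'⟩]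
  · simp [h]

lemma disjoint (hD : IsRealDiagonalizable D) {v : E} (hA : v ∈ spectralSubspace D A)
    (hB : v ∈ spectralSubspace D B) (h : Disjoint A B) : v = 0 := by
  rw [← hD.proj_eq_self hA, hD.proj_eq_zero hB h]

/-- The operators `exp(t D)`. -/
noncomputable def flow (t : ℝ) : E →L[ℂ] E := hD.calculus fun r => Complex.exp (t * r)

lemma flow_eq_exp [CompleteSpace E] (t : ℝ) : NormedSpace.exp (t • D) = hD.flow t := by
  refine hD.ext fun r v hv => ?_
  rw [flow, hD.calculus_apply _ hv]
  have h1 := (ContinuousLinearMap.apply ℂ E v).hasSum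
    (NormedSpace.exp_series_hasSum_exp' (𝕂 := ℂ) (t • D))
  have h2 : HasSum (fun n : ℕ => ((n.factorial : ℂ)⁻¹ • ((t : ℂ) * r) ^ n) • v)
      (NormedSpace.exp ((t : ℂ) * r) • v) :=
    (NormedSpace.exp_series_hasSum_exp' (𝕂 := ℂ) ((t : ℂ) * r)).smul_const v
  rw [← Complex.exp_eq_exp_ℂ] at h2
  refine h1.unique ?_
  convert! h2 using 2 with n
  have h3 : ((t • D) ^ n) v = ((t : ℂ) * r) ^ n • v := by
    induction n with
    | zero => simp
    | succ n ih =>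
      have h4 : (t • D) v = ((t : ℂ) * r) • v := by
        rw [smul_apply, hv, ← Complex.coe_smul, smul_smul]
      rw [pow_succ, mul_apply_eq_comp, h4, map_smul, ih, smul_smul, pow_succ, mul_comm]
  simp only [ContinuousLinearMap.apply_apply, smul_apply, h3, smul_smul, smul_eq_mul]

/-- On an eigenvector for `r > 0` the flow is `exp(tr)`, which decays as `t → -∞`. This is the
contraction behind all global statements about `U` and `N`. -/
lemma tendsto_flow {v : E} (hv : v ∈ spectralSubspace D (Ioi 0)) :
    Tendsto (fun t => hD.flow t v) atBot (𝓝 0) := by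
  refine spectralSubspace_induction hv (fun r hr w hw => ?_) (by simp) fun v w hv hw => ?_
  · simp only [flow, hD.calculus_apply _ hw]
    have h1 : Tendsto (fun t : ℝ => Real.exp (t * r)) atBot (𝓝 0) :=
      Real.tendsto_exp_atBot.comp (tendsto_id.atBot_mul_const hr)
    have h2 := (Complex.continuous_ofReal.tendsto _).comp h1
    simpa [Function.comp_def] using h2.smul_const w
  · simpa using hv.add hw

end IsRealDiagonalizable

end SpectralCalculus

/-! ### Globalizing a local inverse by a contraction group. -/

section Contraction

open Filter

/-- A map which is locally invertible at `0` and equivariant under a contraction group is globally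
invertible. -/
theorem exists_analytic_inverse_of_contraction {V : Type*} [NormedAddCommGroup V] [NormedSpace ℂ V]
    [CompleteSpace V] {F : V → V} (hF : ContDiff ℂ ω F) (h0 : F 0 = 0) {A : V ≃L[ℂ] V}
    (hA : HasFDerivAt F (A : V →L[ℂ] V) 0) (θ : ℝ → V →L[ℂ] V)
    (hθ : ∀ t v, θ (-t) (θ t v) = v) (hFθ : ∀ t v, F (θ t v) = θ t (F v))
    (hlim : ∀ v, Tendsto (fun t => θ t v) atBot (𝓝 0)) :
    ∃ s : V → V, ContDiff ℂ ω s ∧ (∀ v, s (F v) = v) ∧ ∀ v, F (s v) = v := by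
  let Φ := hF.contDiffAt.toOpenPartialHomeomorph F hA (by simp)
  have hΦ (v : V) : Φ v = F v := rfl
  have hs0 : (0 : V) ∈ Φ.source := hF.contDiffAt.mem_toOpenPartialHomeomorph_source hA (by simp)
  have ht0 : (0 : V) ∈ Φ.target := by
    have := Φ.map_source hs0
    rwa [hΦ, h0] at this
  have hsymm : ContDiffAt ℂ ω Φ.symm (0 : V) := by
    have := hF.contDiffAt.to_localInverse hA (by simp)
    rwa [h0] at this
  have hinj : Function.Injective F := by
    intro u v huv
    obtain ⟨t, hu, hv⟩ := (((hlim u).eventually_mem (Φ.open_source.mem_nhds hs0)).and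
      ((hlim v).eventually_mem (Φ.open_source.mem_nhds hs0))).exists
    have h1 := Φ.injOn hu hv (by rw [hΦ, hΦ, hFθ, hFθ, huv])
    rw [← hθ t u, h1, hθ]
  -- Contract `w` into the range of the local inverse, invert there, and expand again. The same
  -- formula with fixed `t` describes the global inverse near `w`, which gives its analyticity.
  have hinv (t : ℝ) (w : V) (hw : θ t w ∈ Φ.target) : F (θ (-t) (Φ.symm (θ t w))) = w := by
    rw [hFθ, ← hΦ, Φ.right_inv hw, hθ]
  have hsurj : Function.Surjective F := by
    intro w
    obtain ⟨t, hw⟩ := ((hlim w).eventually_mem (Φ.open_target.mem_nhds ht0)).exists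
    exact ⟨_, hinv t w hw⟩
  let e := Equiv.ofBijective F ⟨hinj, hsurj⟩
  refine ⟨e.symm, contDiff_iff_contDiffAt.2 fun w => ?_, e.left_inv, e.right_inv⟩
  obtain ⟨t, hw, hw'⟩ := (((hlim w).eventually_mem (Φ.open_target.mem_nhds ht0)).and
    ((hlim w).eventually (hsymm.eventually (by simp)))).exists
  have h1 : ContDiffAt ℂ ω (fun w => θ (-t) (Φ.symm (θ t w))) w :=
    (θ (-t)).contDiff.contDiffAt.comp w (hw'.comp w (θ t).contDiff.contDiffAt)
  refine h1.congr_of_eventuallyEq ?_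
  filter_upwards [(θ t).continuous.continuousAt.eventually_mem (Φ.open_target.mem_nhds hw)]
    with w' hw'
  rw [Equiv.symm_apply_eq]
  exact (hinv t w' hw').symm

end Contraction

/-! ### Functional calculus restricted to a spectral subspace. -/

namespace IsRealDiagonalizable

variable {E : Type*} [NormedAddCommGroup E] [NormedSpace ℂ E] {D : E →L[ℂ] E}
  (hD : IsRealDiagonalizable D) (A : Set ℝ)

/-- The functional calculus on a spectral subspace. -/
noncomputable def restrictCalculus (f : ℝ → ℂ) : spectralSubspace D A →L[ℂ] spectralSubspace D A :=
  hD.projTo A ∘L hD.calculus f ∘L (spectralSubspace D A).subtypeL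

lemma coe_restrictCalculus (f : ℝ → ℂ) (v : spectralSubspace D A) :
    (hD.restrictCalculus A f v : E) = hD.calculus f (v : E) :=
  hD.proj_eq_self (hD.calculus_mem_of_mem f v.2)

lemma restrictCalculus_comp_eq {f g : ℝ → ℂ} (h : EqOn (f * g) 1 A) (v : spectralSubspace D A) :
    hD.restrictCalculus A f (hD.restrictCalculus A g v) = v := by
  ext
  rw [coe_restrictCalculus, coe_restrictCalculus, hD.calculus_calculus, hD.calculus_congr h v.2,
    hD.calculus_one]
  rfl

end IsRealDiagonalizable

/-! ### The unipotent subgroup attached to the positive eigenvalues of `ad x`. -/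

section Unipotent

open Filter

variable {E : Type*} [NormedAddCommGroup E] [NormedSpace ℂ E] [CompleteSpace E]
  {G : Type*} [TopologicalSpace G] [ChartedSpace E G] [Group G] [LieGroup 𝓘(ℂ, E) ω G]

lemma bracketCLM_jacobi (x v w : E) : bracketCLM G x (bracketCLM G v w) =
    bracketCLM G (bracketCLM G x v) w + bracketCLM G v (bracketCLM G x w) := by
  have e (a b : E) := bracket_eq_bracketCLM (G := G) a b
  rw [← e x w, ← e x v, ← e v w]
  refine (e x _).symm.trans (Eq.trans ?_ (congrArg₂ (fun a b : E => a + b) (e _ w) (e v _)))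
  exact leibniz_lie (L₁ := GroupLieAlgebra 𝓘(ℂ, E) G) (L₂ := GroupLieAlgebra 𝓘(ℂ, E) G)
    (M := GroupLieAlgebra 𝓘(ℂ, E) G) x v w

lemma bracketCLM_skew (v w : E) : bracketCLM G v w = -bracketCLM G w v := by
  simp only [← bracket_eq_bracketCLM]
  exact (lie_skew (L := GroupLieAlgebra 𝓘(ℂ, E) G) v w).symm

lemma bracketCLM_self (v : E) : bracketCLM G v v = 0 := by
  rw [← bracket_eq_bracketCLM]
  exact lie_self (L := GroupLieAlgebra 𝓘(ℂ, E) G) v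

/-- By the Jacobi identity `ad x` is a derivation, so eigenvalues add under the bracket. -/
lemma bracketCLM_mem_spectralSubspace {x : E} {A B C : Set ℝ} (h : ∀ a ∈ A, ∀ b ∈ B, a + b ∈ C)
    {v w : E} (hv : v ∈ spectralSubspace (bracketCLM G x) A)
    (hw : w ∈ spectralSubspace (bracketCLM G x) B) :
    bracketCLM G v w ∈ spectralSubspace (bracketCLM G x) C := by
  refine spectralSubspace_induction hv (fun r hr v hv => ?_) (by simp) fun v v' hv hv' => ?_
  · refine spectralSubspace_induction hw (fun s hs w hw => ?_) (by simp) fun w w' hw hw' => ?_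
    · refine mem_spectralSubspace (h r hr s hs) ?_
      rw [bracketCLM_jacobi, hv, hw]
      simp [add_smul]
    · rw [map_add]
      exact add_mem hw hw'
  · rw [map_add, add_apply]
    exact add_mem hv hv'

/-- Analyticity near `1` is carried to `g` by `Ad(h) = Ad(g) Ad(g⁻¹h)`. -/
lemma contMDiff_adRep : ContMDiff 𝓘(ℂ, E) 𝓘(ℂ, E →L[ℂ] E) ω (adRep : G → E →L[ℂ] E) := by
  intro g
  have := topologicalGroup_of_lieGroup 𝓘(ℂ, E) ω (G := G)
  have h1 : ContMDiffAt 𝓘(ℂ, E) 𝓘(ℂ, E) ω (fun h : G => g⁻¹ * h) g :=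
    contMDiffAt_const.mul contMDiffAt_id
  have h2 : ContMDiffAt 𝓘(ℂ, E) 𝓘(ℂ, E) ω (fun h : G => (unitCoord (g⁻¹ * h) : E)) g :=
    ContMDiffAt.comp (g := (unitCoord : G → E)) g
      (contMDiffAt_unitCoord (by simpa using one_mem_unitDomain)) h1
  have h3 : ContMDiffAt 𝓘(ℂ, E) 𝓘(ℂ, E →L[ℂ] E) ω
      (fun h : G => adRep (E := E) (unitPoint G (unitCoord (g⁻¹ * h) : E))) g :=
    ContMDiffAt.comp (g := fun a : E => adRep (E := E) (unitPoint G a)) g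
      (by simpa using analyticAt_adRep_unitPoint.contDiffAt.contMDiffAt) h2
  have h5 : ContMDiffAt 𝓘(ℂ, E) 𝓘(ℂ, E →L[ℂ] E) ω
      (fun h : G => adRep (E := E) g ∘L adRep (E := E) (unitPoint G (unitCoord (g⁻¹ * h) : E))) g :=
    ContMDiffAt.comp (g := fun T : E →L[ℂ] E => adRep (E := E) g ∘L T) g
      (((ContinuousLinearMap.compL ℂ E E E) (adRep g)).contMDiff.contMDiffAt) h3
  refine h5.congr_of_eventuallyEq ?_
  have h6 : ∀ᶠ h in 𝓝 g, g⁻¹ * h ∈ unitDomain E G :=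
    h1.continuousAt.eventually_mem (by simpa using unitDomain_mem_nhds)
  filter_upwards [h6] with h hh
  rw [unitPoint_unitCoord hh, ← adRep_mul, mul_inv_cancel_left]

lemma contMDiff_adRep_apply (x : E) :
    ContMDiff 𝓘(ℂ, E) 𝓘(ℂ, E) ω (fun g : G => adRep g x) :=
  ContMDiff.comp (g := fun T : E →L[ℂ] E => T x)
    (ContinuousLinearMap.apply ℂ E x).contMDiff contMDiff_adRep

lemma t2Space_of_lieGroup (E : Type*) [NormedAddCommGroup E] [NormedSpace ℂ E]
    (G : Type*) [TopologicalSpace G] [ChartedSpace E G] [Group G] [LieGroup 𝓘(ℂ, E) ω G] :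
    T2Space G := by
  have := topologicalGroup_of_lieGroup 𝓘(ℂ, E) ω (G := G)
  have : T1Space G := ChartedSpace.t1Space E G
  infer_instance

variable {x : E} (hD : IsRealDiagonalizable (bracketCLM G x))

lemma adRep_lieExp_smul (t : ℝ) : adRep (lieExp G (t • x)) = hD.flow t := by
  rw [adRep_lieExp, ← hD.flow_eq_exp]
  congr 1
  rw [← Complex.coe_smul, map_smul, Complex.coe_smul]

lemma adRep_lieExp_sub_mem {A : Set ℝ} (hD : IsRealDiagonalizable (bracketCLM G x))
    {v y : E} (hv : ∀ w ∈ spectralSubspace (bracketCLM G x) A,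
      bracketCLM G v w ∈ spectralSubspace (bracketCLM G x) A)
    (hy : bracketCLM G v y ∈ spectralSubspace (bracketCLM G x) A) :
    adRep (lieExp G v) y - y ∈ spectralSubspace (bracketCLM G x) A := by
  rw [adRep_lieExp]
  exact exp_apply_sub_mem (hD.isClosed A) hv hy

lemma adRep_lieExp_mem {A : Set ℝ} (hD : IsRealDiagonalizable (bracketCLM G x))
    {v y : E} (hv : ∀ w ∈ spectralSubspace (bracketCLM G x) A,
      bracketCLM G v w ∈ spectralSubspace (bracketCLM G x) A)
    (hy : y ∈ spectralSubspace (bracketCLM G x) A) :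
    adRep (lieExp G v) y ∈ spectralSubspace (bracketCLM G x) A := by
  rw [adRep_lieExp]
  exact exp_apply_mem (hD.isClosed A) hv hy

lemma bracketCLM_pos {u v : E} (hu : u ∈ spectralSubspace (bracketCLM G x) (Ioi 0))
    (hv : v ∈ spectralSubspace (bracketCLM G x) (Ioi 0)) :
    bracketCLM G u v ∈ spectralSubspace (bracketCLM G x) (Ioi 0) :=
  bracketCLM_mem_spectralSubspace (fun _ ha _ hb => add_pos ha hb) hu hv

/-- In the series of `exp(ad u)x` all terms after the first are iterated images of `[u, x] = -[x,
u]`, which lies in the closed, `ad u`-invariant positive part. -/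
lemma adRep_lieExp_pos_sub_mem (hD : IsRealDiagonalizable (bracketCLM G x))
    {u : E} (hu : u ∈ spectralSubspace (bracketCLM G x) (Ioi 0)) :
    adRep (lieExp G u) x - x ∈ spectralSubspace (bracketCLM G x) (Ioi 0) := by
  refine adRep_lieExp_sub_mem hD (fun w hw => bracketCLM_pos hu hw) ?_
  rw [bracketCLM_skew]
  exact neg_mem (hD.apply_mem_of_mem hu)

/-- The orbit map of `x` has a global analytic section. -/
theorem exists_unipotent_coordinate (hD : IsRealDiagonalizable (bracketCLM G x)) :
    ∃ σ : G → spectralSubspace (bracketCLM G x) (Ioi 0),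
    ContMDiff 𝓘(ℂ, E) 𝓘(ℂ, spectralSubspace (bracketCLM G x) (Ioi 0)) ω σ ∧
    (∀ u : spectralSubspace (bracketCLM G x) (Ioi 0), σ (lieExp G (u : E)) = u) ∧
    (∀ g, adRep g x = x → σ g = 0) ∧
    ∀ g, adRep g x - x ∈ spectralSubspace (bracketCLM G x) (Ioi 0) →
      adRep (lieExp G (σ g : E)) x = adRep g x := by
  set V := spectralSubspace (bracketCLM G x) (Ioi 0) with hV
  have : CompleteSpace V := (hD.isClosed (Ioi 0)).completeSpace_coe
  let κ : G → V := fun g => hD.projTo (Ioi 0) (adRep g x - x)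
  have hκ : ContMDiff 𝓘(ℂ, E) 𝓘(ℂ, V) ω κ :=
    (hD.projTo (Ioi 0)).contMDiff.comp ((contMDiff_adRep_apply x).sub contMDiff_const)
  have hκ' (g : G) (hg : adRep g x - x ∈ V) : (κ g : E) = adRep g x - x := hD.proj_eq_self hg
  have hκu (u : V) : (κ (lieExp G (u : E)) : E) = adRep (lieExp G (u : E)) x - x :=
    hκ' _ (adRep_lieExp_pos_sub_mem hD u.2)
  let F : V → V := fun u => κ (lieExp G (u : E))
  have hF : ContDiff ℂ ω F :=
    contMDiff_iff_contDiff.1 (hκ.comp (contMDiff_lieExp.comp V.subtypeL.contMDiff))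
  have hF0 : F 0 = 0 := by
    ext
    rw [hκu]
    simp [adRep_one]
  -- The derivative of `u ↦ Ad(exp u)x - x` at `0` is `u ↦ [u, x] = -D u`; it is invertible since
  -- all eigenvalues on `V` are positive.
  let A : V ≃L[ℂ] V := ContinuousLinearEquiv.equivOfInverse
    (-hD.restrictCalculus (Ioi 0) fun r => (r : ℂ))
    (-hD.restrictCalculus (Ioi 0) fun r => (r : ℂ)⁻¹)
    (fun v => by
      simp only [neg_apply, map_neg, neg_neg]
      refine hD.restrictCalculus_comp_eq _ (fun r hr => ?_) v
      simp [(show (0 : ℝ) < r from hr).ne'])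
    (fun v => by
      simp only [neg_apply, map_neg, neg_neg]
      refine hD.restrictCalculus_comp_eq _ (fun r hr => ?_) v
      simp [(show (0 : ℝ) < r from hr).ne'])
  have hA : HasFDerivAt F (A : V →L[ℂ] V) 0 := by
    have h1 : HasFDerivAt (fun u : V => adRep (E := E) (lieExp G (u : E)))
        (bracketCLM G ∘L V.subtypeL) 0 :=
      HasFDerivAt.comp (g := fun y : E => adRep (E := E) (lieExp G y)) (0 : V)
        (by simpa using analyticAt_adRep_lieExp.2) V.subtypeL.hasFDerivAt
    have h2 := ((ContinuousLinearMap.apply ℂ E x).hasFDerivAt.comp (0 : V) h1).sub_const x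
    have h3 := (hD.projTo (Ioi 0)).hasFDerivAt.comp (0 : V) h2
    convert! h3 using 1
    ext v
    have h4 : bracketCLM G x (v : E) ∈ V := hD.apply_mem_of_mem v.2
    have h5 : hD.proj (Ioi 0) (bracketCLM G (v : E) x) = -bracketCLM G x (v : E) := by
      rw [bracketCLM_skew, map_neg, hD.proj_eq_self h4]
    have h6 := hD.coe_restrictCalculus (Ioi 0) (fun r => (r : ℂ)) v
    rw [hD.calculus_id] at h6
    simp [A, h6, IsRealDiagonalizable.coe_projTo, h5]
  -- Equivariance holds because `exp(tx)` fixes `x` under `Ad` and conjugates `exp u` to `exp(Ad(exp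
  -- tx)u)`.
  have hθF (t : ℝ) (v : V) : F (hD.restrictCalculus (Ioi 0) (fun r => Complex.exp (t * r)) v) =
      hD.restrictCalculus (Ioi 0) (fun r => Complex.exp (t * r)) (F v) := by
    have hx : hD.flow t x = x := by
      rw [IsRealDiagonalizable.flow, hD.calculus_apply (r := 0) _ (by simp [bracketCLM_self])]
      simp
    have hx' : adRep (lieExp G (t • x))⁻¹ x = x := by
      nth_rw 2 [← hx]
      rw [← adRep_lieExp_smul hD, adRep_inv_apply_self]
    ext
    rw [hD.coe_restrictCalculus, hκu, hκu, hD.coe_restrictCalculus]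
    change adRep (lieExp G (hD.flow t v)) x - x = hD.flow t _
    rw [map_sub, hx, ← adRep_lieExp_smul hD, lieExp_adRep, adRep_mul_apply, adRep_mul_apply, hx']
  obtain ⟨s, hs, hs1, hs2⟩ := exists_analytic_inverse_of_contraction hF hF0 hA
    (fun t => hD.restrictCalculus (Ioi 0) (fun r => Complex.exp (t * r)))
    (fun t v => hD.restrictCalculus_comp_eq _ (fun r _ => by simp [← Complex.exp_add]) v) hθF
    (fun v => by
      rw [tendsto_subtype_rng]
      simp only [hD.coe_restrictCalculus]
      exact hD.tendsto_flow v.2)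
  refine ⟨s ∘ κ, hs.contMDiff.comp hκ, hs1, fun g hg => ?_, fun g hg => ?_⟩
  · have : κ g = 0 := by simp [κ, hg]
    rw [Function.comp_apply, this]
    conv_lhs => rw [← hF0]
    exact hs1 0
  · have h1 := congrArg (Subtype.val) (hs2 (κ g))
    rw [hκ' g hg] at h1
    change (κ (lieExp G _) : E) = _ at h1
    rw [hκu] at h1
    exact sub_left_injective h1

/-- The unipotent subgroup defined by `x`. -/
noncomputable def unipotentSubgroup (hD : IsRealDiagonalizable (bracketCLM G x)) : Subgroup G where
  carrier := lieExp G '' (spectralSubspace (bracketCLM G x) (Ioi 0) : Set E)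
  one_mem' := ⟨0, zero_mem _, lieExp_zero⟩
  inv_mem' := by
    rintro _ ⟨u, hu, rfl⟩
    exact ⟨-u, neg_mem hu, lieExp_neg u⟩
  mul_mem' := by
    rintro _ _ ⟨u, hu, rfl⟩ ⟨v, hv, rfl⟩
    have := topologicalGroup_of_lieGroup 𝓘(ℂ, E) ω (G := G)
    have := t2Space_of_lieGroup E G
    obtain ⟨σ, -, -, -, hσ⟩ := exists_unipotent_coordinate hD
    have h1 : adRep (lieExp G u * lieExp G v) x - x ∈
        spectralSubspace (bracketCLM G x) (Ioi 0) := by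
      have h2 : adRep (lieExp G u) (adRep (lieExp G v) x - x) ∈
          spectralSubspace (bracketCLM G x) (Ioi 0) :=
        adRep_lieExp_mem hD (fun w hw => bracketCLM_pos hu hw) (adRep_lieExp_pos_sub_mem hD hv)
      have := add_mem h2 (adRep_lieExp_pos_sub_mem hD hu)
      rwa [map_sub, sub_add_sub_cancel, ← adRep_mul_apply] at this
    have h3 := hσ _ h1
    set w := σ (lieExp G u * lieExp G v) with hw
    -- The candidate `w` is the coordinate of the product, and `h` is the error. By the choice of
    -- `w`, `h` fixes `x` and hence commutes with every `exp(tx)`. Conjugation by `exp(tx)` thus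
    -- leaves `h` unchanged while it contracts each of the three factors to `1` as `t → -∞`, so `h =
    -- 1`.
    set h : G := lieExp G (-(w : E)) * lieExp G u * lieExp G v with hh
    have h4 : adRep h x = x := by
      rw [hh, mul_assoc, adRep_mul_apply, ← h3, lieExp_neg, adRep_inv_apply_self]
    have h5 (t : ℝ) : lieExp G (hD.flow t (-(w : E))) * lieExp G (hD.flow t u) *
        lieExp G (hD.flow t v) = h := by
      have h6 : lieExp G (adRep h (t • x)) = lieExp G (t • x) := by
        rw [← Complex.coe_smul, map_smul, h4]
      rw [lieExp_adRep] at h6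
      rw [← adRep_lieExp_smul hD, lieExp_adRep, lieExp_adRep, lieExp_adRep]
      rw [mul_inv_eq_iff_eq_mul] at h6
      calc _ = lieExp G (t • x) * h * (lieExp G (t • x))⁻¹ := by rw [hh]; group
        _ = h := by rw [← h6]; group
    have hlim {y : E} (hy : y ∈ spectralSubspace (bracketCLM G x) (Ioi 0)) :
        Tendsto (fun t => lieExp G (hD.flow t y)) atBot (𝓝 1) := by
      have h7 := (continuous_lieExp (G := G)).tendsto (0 : E)
      rw [lieExp_zero] at h7
      exact h7.comp (hD.tendsto_flow hy)
    have h8 := ((hlim (neg_mem w.2)).mul (hlim hu)).mul (hlim hv)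
    simp only [h5, mul_one] at h8
    have h9 : h = 1 := tendsto_nhds_unique tendsto_const_nhds h8
    refine ⟨w, w.2, ?_⟩
    rw [hh, lieExp_neg, mul_assoc, inv_mul_eq_one] at h9
    exact h9

lemma coe_unipotentSubgroup : (unipotentSubgroup hD : Set G) =
    lieExp G '' (spectralSubspace (bracketCLM G x) (Ioi 0) : Set E) := rfl

/-- The unipotent subgroup acts freely on `x`. -/
lemma unipotentSubgroup_eq_one {g : G} (hg : g ∈ unipotentSubgroup hD) (h : adRep g x = x) :
    g = 1 := by
  obtain ⟨σ, -, hσ, hσ0, -⟩ := exists_unipotent_coordinate hD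
  obtain ⟨u, hu, rfl⟩ := hg
  have h1 := hσ ⟨u, hu⟩
  rw [hσ0 _ h] at h1
  have h2 : (0 : E) = u := congrArg Subtype.val h1
  rw [← h2, lieExp_zero]

lemma adRep_sub_mem_of_mem_unipotentSubgroup {g : G} (hg : g ∈ unipotentSubgroup hD) :
    adRep g x - x ∈ spectralSubspace (bracketCLM G x) (Ioi 0) := by
  obtain ⟨u, hu, rfl⟩ := hg
  exact adRep_lieExp_pos_sub_mem hD hu

/-- The subgroup is the set where `exp(σ(g)) = g`, so it is closed. If `y` is small and `exp y` lies
in it, then `σ(exp y)` is also small with the same exponential, and local injectivity gives `y =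
σ(exp y)`, an element of the positive part. -/
theorem isLieSubgroup_unipotentSubgroup {V : Submodule ℂ (GroupLieAlgebra 𝓘(ℂ, E) G)}
    (hV : toModel V = spectralSubspace (bracketCLM G x) (Ioi 0)) :
    IsLieSubgroup (unipotentSubgroup hD) V := by
  have := t2Space_of_lieGroup E G
  obtain ⟨σ, hσ, hσ1, -, -⟩ := exists_unipotent_coordinate hD
  have hσu {g : G} (hg : g ∈ unipotentSubgroup hD) : lieExp G (σ g : E) = g := by
    obtain ⟨u, hu, rfl⟩ := hg
    rw [hσ1 ⟨u, hu⟩]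
  have hσc : Continuous fun g : G => (σ g : E) := continuous_subtype_val.comp hσ.continuous
  refine isLieSubgroup_of ?_ ?_ ?_ ?_
  · have h1 : (unipotentSubgroup hD : Set G) = {g | lieExp G (σ g : E) = g} :=
      Set.ext fun g => ⟨hσu, fun h => ⟨_, (σ g).2, h⟩⟩
    rw [h1]
    exact isClosed_eq (continuous_lieExp.comp hσc) continuous_id
  · rw [hV]
    exact hD.isClosed _
  · intro v hv
    rw [hV] at hv
    exact ⟨v, hv, rfl⟩
  · obtain ⟨W, hW, hinj⟩ := lieExp_injOn (E := E) (G := G)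
    have h1 : Tendsto (fun y : E => (σ (lieExp G y) : E)) (𝓝 0) (𝓝 0) := by
      have h2 := (hσc.comp (continuous_lieExp (E := E) (G := G))).tendsto 0
      have h3 := hσ1 0
      simp only [ZeroMemClass.coe_zero, lieExp_zero] at h3
      simpa [Function.comp_def, h3] using! h2
    filter_upwards [hW, h1 hW] with y hy hy' h
    rw [hV, hinj hy hy' (hσu h).symm]
    exact (σ _).2

theorem isBiholomorphic_lieExp_unipotentSubgroup {V : Submodule ℂ (GroupLieAlgebra 𝓘(ℂ, E) G)}
    (hV : toModel V = spectralSubspace (bracketCLM G x) (Ioi 0))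
    [ChartedSpace (toModel V) (unipotentSubgroup hD)]
    (hA : IsLieSubgroupAtlas (unipotentSubgroup hD) V)
    (hR : HasLocalRetractions (unipotentSubgroup hD) (toModel V)) :
    IsBiholomorphic 𝓘(ℂ, toModel V) 𝓘(ℂ, toModel V)
      (lieExp (unipotentSubgroup hD) : toModel V → unipotentSubgroup hD) := by
  have hH := isLieSubgroup_unipotentSubgroup hD hV
  have hexp := hH.lieExp_eq hA hR
  obtain ⟨σ, hσ, hσ1, -, -⟩ := exists_unipotent_coordinate hD
  -- Only a change of type: it carries the values of `σ` into `toModel V`, which equals the spectral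
  -- subspace but is not syntactically the same space. The inverse of the exponential function is
  -- then `σ` restricted to the subgroup.
  let τ : E →L[ℂ] toModel V := (hD.proj (Ioi 0)).codRestrict (toModel V)
    (fun v => by rw [hV]; exact hD.proj_mem v)
  have hτ (v : toModel V) : τ v = v := Subtype.ext (hD.proj_eq_self (hV ▸ v.2))
  have hσ' : ContMDiff 𝓘(ℂ, E) 𝓘(ℂ, toModel V) ω (fun g : G => τ (σ g : E)) :=
    τ.contMDiff.comp ((spectralSubspace (bracketCLM G x) (Ioi 0)).subtypeL.contMDiff.comp hσ)
  have hσ1' (v : toModel V) : τ (σ (lieExp G (v : E)) : E) = v := by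
    have h1 : (v : E) ∈ spectralSubspace (bracketCLM G x) (Ioi 0) := hV ▸ v.2
    rw [hσ1 ⟨v, h1⟩]
    exact hτ v
  refine ⟨⟨⟨lieExp (unipotentSubgroup hD), fun g => τ (σ (g : G) : E), fun v => ?_, fun g => ?_⟩,
    ?_, hσ'.comp hA.contMDiff_incl⟩, rfl⟩
  · change τ (σ (lieExp (unipotentSubgroup hD) v : G) : E) = v
    rw [hexp, hσ1']
  · obtain ⟨g, u, hu, rfl⟩ := g
    ext
    rw [hexp]
    exact congrArg (fun v : toModel V => lieExp G (v : E)) (hσ1' ⟨u, hV ▸ hu⟩)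
  · refine hR.contMDiff ?_
    simp only [Equiv.coe_fn_mk, hexp]
    exact contMDiff_lieExp.comp (toModel V).subtypeL.contMDiff

end Unipotent

/-! ### Coordinates of the second kind near the unit element. -/

section Products

open Filter

variable {E : Type*} [NormedAddCommGroup E] [NormedSpace ℂ E] [CompleteSpace E]
  {G : Type*} [TopologicalSpace G] [ChartedSpace E G] [Group G] [LieGroup 𝓘(ℂ, E) ω G]

/-- Neutrality of `1` makes both partial derivatives the identity. -/
lemma hasFDerivAt_coordMul_zero : HasFDerivAt (coordMul (E := E) G)
    (ContinuousLinearMap.fst ℂ E E + ContinuousLinearMap.snd ℂ E E) (0, 0) := by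
  have h := (contDiffAt_coordMul_zero (E := E) (G := G)).analyticAt.differentiableAt.hasFDerivAt
  have h1 (w : E) : fderiv ℂ (coordMul G) ((0 : E), (0 : E)) (0, w) = w :=
    coordField_zero_left (G := G) w
  have h2 : HasFDerivAt (fun z : E => coordMul G (z, (0 : E)))
      (fderiv ℂ (coordMul G) ((0 : E), (0 : E)) ∘L .inl ℂ E E) 0 :=
    HasFDerivAt.comp (g := coordMul G) (0 : E) h (hasFDerivAt_prodMk_left (0 : E) (0 : E))
  have h3 : HasFDerivAt (fun z : E => coordMul G (z, (0 : E))) (ContinuousLinearMap.id ℂ E) 0 := by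
    refine (hasFDerivAt_id 0).congr_of_eventuallyEq ?_
    filter_upwards [eventually_unitCoord_unitPoint (E := E) (G := G)] with b hb
    simpa [coordMul] using hb
  have h4 (v : E) : fderiv ℂ (coordMul G) ((0 : E), (0 : E)) (v, 0) = v :=
    DFunLike.congr_fun (h2.unique h3) v
  convert! h using 1
  ext v
  · refine Eq.trans ?_ (h4 v).symm
    simp
  · refine Eq.trans ?_ (h1 v).symm
    simp

lemma hasFDerivAt_unitCoord_mul {F : Type*} [NormedAddCommGroup F] [NormedSpace ℂ F] {f g : F → G}
    {p : F} {f' g' : F →L[ℂ] E} (hf : ContinuousAt f p) (hg : ContinuousAt g p) (hf1 : f p = 1)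
    (hg1 : g p = 1) (hf' : HasFDerivAt (fun q => (unitCoord (f q) : E)) f' p)
    (hg' : HasFDerivAt (fun q => (unitCoord (g q) : E)) g' p) :
    HasFDerivAt (fun q => (unitCoord (f q * g q) : E)) (f' + g') p := by
  have h1 : HasFDerivAt (coordMul (E := E) G)
      (ContinuousLinearMap.fst ℂ E E + ContinuousLinearMap.snd ℂ E E)
      (unitCoord (f p), unitCoord (g p)) := by
    simpa [hf1, hg1] using hasFDerivAt_coordMul_zero (E := E) (G := G)
  have h2 := HasFDerivAt.comp p h1 (hf'.prodMk hg')
  have h3 : (ContinuousLinearMap.fst ℂ E E + ContinuousLinearMap.snd ℂ E E) ∘L f'.prod g' =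
      f' + g' := by
    ext
    simp
  rw [h3] at h2
  refine h2.congr_of_eventuallyEq ?_
  filter_upwards [hf.eventually_mem (s := unitDomain E G) (by simpa [hf1] using unitDomain_mem_nhds),
    hg.eventually_mem (s := unitDomain E G) (by simpa [hg1] using unitDomain_mem_nhds)] with q h4 h5
  simp [coordMul, unitPoint_unitCoord h4, unitPoint_unitCoord h5]

variable {x : E}

/-- The elements near `1` are products of exponentials of components of their analytic coordinate
for the decomposition of the Lie algebra into the negative, zero and positive parts. -/
theorem exists_triangular_coordinate (hD : IsRealDiagonalizable (bracketCLM G x)) :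
    ∃ s : G → E, (∀ᶠ g in 𝓝 (1 : G), ContMDiffAt 𝓘(ℂ, E) 𝓘(ℂ, E) ω s g) ∧
      ∀ᶠ g in 𝓝 (1 : G), lieExp G (hD.proj (Iio 0) (s g)) * lieExp G (hD.proj {0} (s g)) *
        lieExp G (hD.proj (Ioi 0) (s g)) = g := by
  have hc (T : E →L[ℂ] E) : ContMDiff 𝓘(ℂ, E) 𝓘(ℂ, E) ω (fun v => lieExp G (T v)) :=
    contMDiff_lieExp.comp T.contMDiff
  have hd (T : E →L[ℂ] E) : HasFDerivAt (fun v => (unitCoord (lieExp G (T v)) : E)) T 0 := by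
    have := HasFDerivAt.comp (g := fun y : E => (unitCoord (lieExp G y) : E)) (0 : E)
      (by simpa using hasFDerivAt_unitCoord_lieExp) T.hasFDerivAt
    rwa [ContinuousLinearMap.id_comp] at this
  -- The indicators of the negative, zero and positive numbers add up to `1`, so the triple product
  -- of exponentials has derivative the identity at `0`.
  have hsum : hD.proj (Iio 0) + hD.proj {0} + hD.proj (Ioi 0) = ContinuousLinearMap.id ℂ E := by
    rw [IsRealDiagonalizable.proj, IsRealDiagonalizable.proj, IsRealDiagonalizable.proj,
      hD.calculus_add, hD.calculus_add, ← hD.calculus_one]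
    congr 1
    ext r
    rcases lt_trichotomy r 0 with h | h | h
    · simp [h, h.ne, h.le]
    · simp [h]
    · simp [h, h.ne', h.le]
  have h1 := hasFDerivAt_unitCoord_mul ((hc (hD.proj (Iio 0))).mul (hc (hD.proj {0}))).continuous.continuousAt
    (hc (hD.proj (Ioi 0))).continuous.continuousAt (by simp) (by simp)
    (hasFDerivAt_unitCoord_mul (hc _).continuous.continuousAt (hc _).continuous.continuousAt
      (by simp) (by simp) (hd (hD.proj (Iio 0))) (hd (hD.proj {0}))) (hd (hD.proj (Ioi 0)))
  rw [hsum] at h1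
  obtain ⟨s, hs, -, hs2, -⟩ := exists_local_inverse (p := (0 : E))
    (A := ContinuousLinearEquiv.refl ℂ E)
    (((hc (hD.proj (Iio 0))).mul (hc (hD.proj {0}))).mul (hc (hD.proj (Ioi 0)))).contMDiffAt
    (by simp) h1
  exact ⟨s, hs, hs2⟩

end Products

/-! ### Normalizers of spectral subspaces and their Lie algebras. -/

section Normalizer

open Filter

variable {E : Type*} [NormedAddCommGroup E] [NormedSpace ℂ E] [CompleteSpace E]
  {G : Type*} [TopologicalSpace G] [ChartedSpace E G] [Group G] [LieGroup 𝓘(ℂ, E) ω G]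
  {V : Submodule ℂ (GroupLieAlgebra 𝓘(ℂ, E) G)}

lemma adRep_mem_of_mem_adNormalizer {g : G} (hg : g ∈ adNormalizer V) {v : E}
    (hv : v ∈ toModel V) : adRep g v ∈ toModel V := by
  have h1 : adRep g '' (toModel V : Set E) = toModel V := hg
  have h2 : adRep g v ∈ adRep g '' (toModel V : Set E) := ⟨v, hv, rfl⟩
  rwa [h1] at h2

lemma mem_adNormalizer_of {g : G} (h : ∀ v ∈ toModel V, adRep g v ∈ toModel V)
    (h' : ∀ v ∈ toModel V, adRep g⁻¹ v ∈ toModel V) : g ∈ adNormalizer V := by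
  change adRep g '' (toModel V : Set E) = toModel V
  refine Subset.antisymm ?_ fun v hv => ⟨_, h' v hv, adRep_apply_inv_self g v⟩
  rintro _ ⟨v, hv, rfl⟩
  exact h v hv

lemma lieExp_mem_adNormalizer (hV : IsClosed (toModel V : Set E)) {v : E}
    (hv : ∀ w ∈ toModel V, bracketCLM G v w ∈ toModel V) : lieExp G v ∈ adNormalizer V := by
  refine mem_adNormalizer_of (fun w hw => ?_) (fun w hw => ?_)
  · rw [adRep_lieExp]
    exact exp_apply_mem hV hv hw
  · rw [← lieExp_neg, adRep_lieExp]
    refine exp_apply_mem hV (fun w hw => ?_) hw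
    rw [map_neg]
    exact neg_mem (hv w hw)

/-- Equality `Ad(g)V = V` means that `g` and `g⁻¹` both map `V` into itself, which is a family of
closed conditions, one for each `v`. -/
lemma isClosed_adNormalizer (hV : IsClosed (toModel V : Set E)) :
    IsClosed (adNormalizer V : Set G) := by
  have := topologicalGroup_of_lieGroup 𝓘(ℂ, E) ω (G := G)
  have h1 : (adNormalizer V : Set G) =
      ⋂ v : toModel V, {g | adRep g (v : E) ∈ (toModel V : Set E)} ∩
        {g | adRep g⁻¹ (v : E) ∈ (toModel V : Set E)} := by
    ext g
    simp only [mem_iInter, mem_inter_iff, mem_ofPred_eq]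
    constructor
    · intro hg v
      exact ⟨adRep_mem_of_mem_adNormalizer hg v.2,
        adRep_mem_of_mem_adNormalizer ((adNormalizer V).inv_mem hg) v.2⟩
    · intro h
      exact mem_adNormalizer_of (fun v hv => (h ⟨v, hv⟩).1) fun v hv => (h ⟨v, hv⟩).2
  rw [h1]
  refine isClosed_iInter fun v => ?_
  have h2 := (contMDiff_adRep_apply (G := G) (v : E)).continuous
  exact (hV.preimage h2).inter (hV.preimage (h2.comp continuous_inv))

/-- Open subgroups of closed subgroups are closed. -/
lemma isClosed_of_isOpen_subgroupOf {A : Type*} [Group A] [TopologicalSpace A]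
    [IsTopologicalGroup A] {H K : Subgroup A} (hHK : H ≤ K) (hK : IsClosed (K : Set A))
    (hH : IsOpen (H.subgroupOf K : Set K)) : IsClosed (H : Set A) := by
  have h1 := hK.isClosedEmbedding_subtypeVal.isClosedMap (H.subgroupOf K : Set K)
    (Subgroup.isClosed_of_isOpen (H.subgroupOf K) hH)
  convert! h1 using 1
  ext g
  constructor
  · intro hg
    exact ⟨⟨g, hHK hg⟩, hg, rfl⟩
  · rintro ⟨g, hg, rfl⟩
    exact hg

/-- An open subgroup contains the one-parameter groups of the group. -/
lemma lieExp_mem_of_isOpen_subgroupOf {H K : Subgroup G}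
    (hH : IsOpen (H.subgroupOf K : Set K)) {v : E} (hv : ∀ t : ℝ, lieExp G (t • v) ∈ K) :
    lieExp G v ∈ H := by
  have := topologicalGroup_of_lieGroup 𝓘(ℂ, E) ω (G := G)
  let γ : ℝ → K := fun t => ⟨lieExp G (t • v), hv t⟩
  have hγ : Continuous γ :=
    (continuous_lieExp.comp (by fun_prop : Continuous fun t : ℝ => t • v)).subtype_mk _
  have h1 : IsClopen (γ ⁻¹' (H.subgroupOf K : Set K)) :=
    ⟨(Subgroup.isClosed_of_isOpen _ hH).preimage hγ, hH.preimage hγ⟩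
  have h2 : (0 : ℝ) ∈ γ ⁻¹' (H.subgroupOf K : Set K) := by
    simp [γ, Subgroup.mem_subgroupOf]
  have h3 : (1 : ℝ) ∈ γ ⁻¹' (H.subgroupOf K : Set K) := by
    rw [h1.eq_univ ⟨0, h2⟩]
    trivial
  simpa [γ, Subgroup.mem_subgroupOf] using h3

variable {x : E} {A : Set ℝ}

/-- A criterion for subgroups of normalizers of spectral subspaces. -/
theorem isLieSubgroup_of_le_adNormalizer (hD : IsRealDiagonalizable (bracketCLM G x))
    (hV : toModel V = spectralSubspace (bracketCLM G x) A) (h0 : (0 : ℝ) ∈ A) {H : Subgroup G}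
    (hH : IsClosed (H : Set G)) (hHV : H ≤ adNormalizer V)
    (hexp : ∀ v ∈ toModel V, lieExp G v ∈ H) : IsLieSubgroup H V := by
  have hVc : IsClosed (toModel V : Set E) := hV ▸ hD.isClosed A
  refine isLieSubgroup_of hH hVc hexp ?_
  have h1 := eventually_invariant_of_exp_invariant hVc (hD.proj A)
    (fun v => hV ▸ hD.proj_mem v) (fun v hv => hD.proj_eq_self (hV ▸ hv))
  have h2 : Tendsto (bracketCLM G : E → E →L[ℂ] E) (𝓝 0) (𝓝 0) := by
    simpa using (bracketCLM (E := E) G).continuous.tendsto 0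
  filter_upwards [h2.eventually h1] with y hy hyH
  have h3 := hy (fun v hv => by
    rw [← adRep_lieExp]
    exact adRep_mem_of_mem_adNormalizer (hHV hyH) hv)
  -- Testing the invariance under `ad y` on the single element `x` suffices: `[y, x] ∈ V` means `D y
  -- ∈ V`, and `0 ∈ A` then gives `y ∈ V`.
  have h4 : x ∈ toModel V := by
    rw [hV]
    exact mem_spectralSubspace h0 (by simp [bracketCLM_self])
  have h5 := h3 x h4
  rw [bracketCLM_skew, neg_mem_iff, hV] at h5
  rw [hV]
  exact hD.mem_of_apply_mem h0 h5

/-- Elements normalizing the non-negative part and its Levi factor preserve the positive part. -/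
lemma adRep_mem_pos {g : G} (hD : IsRealDiagonalizable (bracketCLM G x))
    (h : ∀ v ∈ spectralSubspace (bracketCLM G x) (Ici 0),
      adRep g v ∈ spectralSubspace (bracketCLM G x) (Ici 0))
    (h0 : ∀ v ∈ spectralSubspace (bracketCLM G x) {0},
      adRep g v ∈ spectralSubspace (bracketCLM G x) {0})
    (h0' : ∀ v ∈ spectralSubspace (bracketCLM G x) {0},
      adRep g⁻¹ v ∈ spectralSubspace (bracketCLM G x) {0})
    {v : E} (hv : v ∈ spectralSubspace (bracketCLM G x) (Ioi 0)) :
    adRep g v ∈ spectralSubspace (bracketCLM G x) (Ioi 0) := by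
  refine spectralSubspace_induction hv (fun r hr w hw => ?_) (by simp) fun v w hv hw => by
    rw [map_add]
    exact add_mem hv hw
  have hx : x ∈ spectralSubspace (bracketCLM G x) {0} :=
    mem_spectralSubspace_singleton_zero.2 (bracketCLM_self x)
  have hw' : adRep g w ∈ spectralSubspace (bracketCLM G x) (Ici 0) :=
    h w (mem_spectralSubspace (mem_Ici.2 (le_of_lt hr)) hw)
  -- Write `Ad(g)w = a + b` with `a` in the zero part and `b` in the positive part. It is an
  -- eigenvector of `ad(Ad(g)x)` for `r > 0`. That operator kills `a`, since `Ad(g⁻¹)a` commutes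
  -- with `x`, and maps `b` into the positive part. Hence `r a` lies in both parts, so `a = 0`.
  have hsum := hD.proj_compl_add (A := {0}) (adRep g w)
  set a := hD.proj {0} (adRep g w) with ha
  set b := hD.proj {0}ᶜ (adRep g w) with hb
  have ha0 : a ∈ spectralSubspace (bracketCLM G x) {0} := hD.proj_mem _
  have hb0 : b ∈ spectralSubspace (bracketCLM G x) (Ioi 0) := by
    refine spectralSubspace_mono ?_ (hD.inter_mem (hD.proj_mem _) (hD.calculus_mem_of_mem _ hw'))
    rintro s ⟨hs, hs'⟩
    exact lt_of_le_of_ne hs' (Ne.symm hs)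
  have h1 : bracketCLM G (adRep g x) (adRep g w) = (r : ℂ) • adRep g w := by
    rw [← adRep_bracketCLM, hw, map_smul]
  have h2 : bracketCLM G (adRep g x) a = 0 := by
    have h3 := mem_spectralSubspace_singleton_zero.1 (h0' a ha0)
    rw [← adRep_apply_inv_self g a, ← adRep_bracketCLM, h3, map_zero]
  have h3 : bracketCLM G (adRep g x) b ∈ spectralSubspace (bracketCLM G x) (Ioi 0) :=
    bracketCLM_mem_spectralSubspace (by simp) (h0 x hx) hb0
  rw [← hsum, map_add, h2, zero_add, smul_add] at h1
  have h4 : (r : ℂ) • a ∈ spectralSubspace (bracketCLM G x) (Ioi 0) := by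
    rw [eq_sub_of_add_eq h1.symm]
    exact sub_mem h3 (Submodule.smul_mem _ _ hb0)
  have h5 : (r : ℂ) • a = 0 :=
    hD.disjoint h4 (Submodule.smul_mem _ _ ha0) (by simp)
  have hr' : (r : ℂ) ≠ 0 := by simpa using (show (0 : ℝ) < r from hr).ne'
  rw [← hsum, (smul_eq_zero.1 h5).resolve_left hr', zero_add]
  exact hb0

end Normalizer

/-! ### Biholomorphic maps from injectivity and local sections. -/

section Biholomorphy

open Filter

variable {E₁ E₂ H₁ H₂ M₁ M₂ : Type*}
  [NormedAddCommGroup E₁] [NormedSpace ℂ E₁] [TopologicalSpace H₁]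
  [NormedAddCommGroup E₂] [NormedSpace ℂ E₂] [TopologicalSpace H₂]
  [TopologicalSpace M₁] [ChartedSpace H₁ M₁] [TopologicalSpace M₂] [ChartedSpace H₂ M₂]
  {I₁ : ModelWithCorners ℂ E₁ H₁} {I₂ : ModelWithCorners ℂ E₂ H₂}

/-- An injective holomorphic map with local holomorphic sections is biholomorphic onto an open
subset. -/
theorem isBiholomorphicOntoOpen_of [Nonempty M₁] {f : M₁ → M₂} (hf : ContMDiff I₁ I₂ ω f)
    (hinj : Function.Injective f)
    (h : ∀ p, ∃ s : M₂ → M₁, ContMDiffAt I₂ I₁ ω s (f p) ∧ ∀ᶠ y in 𝓝 (f p), f (s y) = y) :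
    IsBiholomorphicOntoOpen I₁ I₂ f := by
  refine ⟨isOpen_iff_mem_nhds.2 ?_, hf, Function.invFun f, Function.leftInverse_invFun hinj, ?_⟩
  · rintro _ ⟨p, rfl⟩
    obtain ⟨s, -, hs⟩ := h p
    filter_upwards [hs] with y hy
    exact ⟨_, hy⟩
  · rintro _ ⟨p, rfl⟩
    obtain ⟨s, hs, hs'⟩ := h p
    refine (hs.congr_of_eventuallyEq ?_).contMDiffWithinAt
    filter_upwards [hs'] with y hy
    rw [← hy, Function.leftInverse_invFun hinj, hy]

end Biholomorphy

/-! ### Multiplication maps of triangular decompositions. -/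

section TriangularDecomposition

open Filter

/-- The conjugation action of a subgroup on a subgroup. -/
lemma exists_conjAction {A : Type*} [Group A] {H K : Subgroup A}
    (h : ∀ l ∈ H, ∀ k ∈ K, l * k * l⁻¹ ∈ K) :
    ∃ φ : H →* MulAut K, ∀ l k, (φ l k : A) = l * k * (l : A)⁻¹ := by
  have hle : H ≤ Subgroup.normalizer (K : Set A) := by
    intro l hl
    rw [Subgroup.mem_normalizer_iff]
    refine fun k => ⟨h l hl k, fun hk => ?_⟩
    have h1 := h _ (inv_mem hl) _ hk
    have h2 : l⁻¹ * (l * k * l⁻¹) * l⁻¹⁻¹ = k := by group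
    rwa [h2] at h1
  exact ⟨K.normalizerMonoidHom.comp (Subgroup.inclusion hle), fun l k => rfl⟩

variable {E : Type*} [NormedAddCommGroup E] [NormedSpace ℂ E] [CompleteSpace E]
  {G : Type*} [TopologicalSpace G] [ChartedSpace E G] [Group G] [LieGroup 𝓘(ℂ, E) ω G]
  {N L U P : Subgroup G} {Vn Vl Vu Vp : Submodule ℂ E}
  [ChartedSpace Vn N] [ChartedSpace Vl L] [ChartedSpace Vu U] [ChartedSpace Vp P]

lemma HasLocalRetractions.contMDiffAt {H : Subgroup G} {V : Submodule ℂ E} [ChartedSpace V H]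
    (hH : HasLocalRetractions H V) {F B M : Type*} [NormedAddCommGroup F] [NormedSpace ℂ F]
    [TopologicalSpace B] {I : ModelWithCorners ℂ F B} [TopologicalSpace M] [ChartedSpace B M]
    {f : M → H} {p : M} (hf : ContMDiffAt I 𝓘(ℂ, E) ω (fun q => (f q : G)) p) :
    ContMDiffAt I 𝓘(ℂ, V) ω f p :=
  contMDiffWithinAt_univ.1 (hH.contMDiffWithinAt (mem_univ p) (contMDiffWithinAt_univ.2 hf))

lemma contMDiff_conjAction (hL : ContMDiff 𝓘(ℂ, Vl) 𝓘(ℂ, E) ω (Subtype.val : L → G))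
    (hN : ContMDiff 𝓘(ℂ, Vn) 𝓘(ℂ, E) ω (Subtype.val : N → G)) (hRN : HasLocalRetractions N Vn)
    {φ : L →* MulAut N} (hφ : ∀ l n, (φ l n : G) = l * n * (l : G)⁻¹) :
    ContMDiff (𝓘(ℂ, Vl).prod 𝓘(ℂ, Vn)) 𝓘(ℂ, Vn) ω (fun q : L × N => φ q.1 q.2) := by
  refine hRN.contMDiff ?_
  simp only [hφ]
  exact ((hL.comp contMDiff_fst).mul (hN.comp contMDiff_snd)).mul (hL.comp contMDiff_fst).inv

/-- The multiplication map of a triangular decomposition is biholomorphic onto an open subset. -/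
theorem isBiholomorphicOntoOpen_mul_mul
    (hN : ContMDiff 𝓘(ℂ, Vn) 𝓘(ℂ, E) ω (Subtype.val : N → G)) (hRN : HasLocalRetractions N Vn)
    (hL : ContMDiff 𝓘(ℂ, Vl) 𝓘(ℂ, E) ω (Subtype.val : L → G)) (hRL : HasLocalRetractions L Vl)
    (hU : ContMDiff 𝓘(ℂ, Vu) 𝓘(ℂ, E) ω (Subtype.val : U → G)) (hRU : HasLocalRetractions U Vu)
    (hLN : ∀ l ∈ L, ∀ n ∈ N, l * n * l⁻¹ ∈ N) (hLP : L ≤ P) (hUP : U ≤ P)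
    (hNP : ∀ n ∈ N, n ∈ P → n = 1) (hUL : ∀ u ∈ U, u ∈ L → u = 1) {a b c : G → G}
    (ha : ∀ g, a g ∈ N) (hb : ∀ g, b g ∈ L) (hc : ∀ g, c g ∈ U)
    (ha' : ContMDiffAt 𝓘(ℂ, E) 𝓘(ℂ, E) ω a 1) (hb' : ContMDiffAt 𝓘(ℂ, E) 𝓘(ℂ, E) ω b 1)
    (hc' : ContMDiffAt 𝓘(ℂ, E) 𝓘(ℂ, E) ω c 1) (habc : ∀ᶠ g in 𝓝 (1 : G), a g * b g * c g = g) :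
    IsBiholomorphicOntoOpen (𝓘(ℂ, Vn).prod (𝓘(ℂ, Vl).prod 𝓘(ℂ, Vu))) 𝓘(ℂ, E)
      (fun q : N × L × U => (q.1 : G) * (q.2.1 : G) * (q.2.2 : G)) := by
  refine isBiholomorphicOntoOpen_of ?_ ?_ ?_
  · exact ((hN.comp contMDiff_fst).mul (hL.comp (contMDiff_fst.comp contMDiff_snd))).mul
      (hU.comp (contMDiff_snd.comp contMDiff_snd))
  · rintro ⟨⟨n, hn⟩, ⟨l, hl⟩, ⟨u, hu⟩⟩ ⟨⟨n', hn'⟩, ⟨l', hl'⟩, ⟨u', hu'⟩⟩ h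
    simp only at h
    -- The left side lies in `N` and the right side in `P`, so both are `1`; the remaining ambiguity
    -- lies in `U ∩ L`, which is also trivial.
    have h1 : n'⁻¹ * n = l' * u' * u⁻¹ * l⁻¹ := by
      calc n'⁻¹ * n = n'⁻¹ * (n * l * u) * u⁻¹ * l⁻¹ := by group
        _ = l' * u' * u⁻¹ * l⁻¹ := by rw [h]; group
    have h2 : n'⁻¹ * n = 1 := by
      refine hNP _ (mul_mem (inv_mem hn') hn) ?_
      rw [h1]
      exact mul_mem (mul_mem (mul_mem (hLP hl') (hUP hu')) (inv_mem (hUP hu))) (inv_mem (hLP hl))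
    obtain rfl : n' = n := inv_mul_eq_one.1 h2
    rw [mul_assoc, mul_assoc, mul_right_inj] at h
    have h3 : l'⁻¹ * l = u' * u⁻¹ := by
      rw [inv_mul_eq_iff_eq_mul, ← mul_assoc, ← h, mul_inv_cancel_right]
    have h4 : u' * u⁻¹ = 1 := by
      refine hUL _ (mul_mem hu' (inv_mem hu)) ?_
      rw [← h3]
      exact mul_mem (inv_mem hl') hl
    obtain rfl : u' = u := mul_inv_eq_one.1 h4
    obtain rfl : l = l' := mul_right_cancel h
    rfl
  · rintro ⟨n, l, u⟩
    -- With `w = n l r(w) u` and `r(w) = abc` near `1`, the factorization `w = n(l a l⁻¹) · (l b) ·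
    -- (c u)` regroups the factors, using that `L` normalizes `N`.
    let r : G → G := fun w => (l : G)⁻¹ * (n : G)⁻¹ * w * (u : G)⁻¹
    have hr : ContMDiff 𝓘(ℂ, E) 𝓘(ℂ, E) ω r :=
      (contMDiff_const.mul contMDiff_id).mul contMDiff_const
    have hr1 : r (n * l * u) = 1 := by
      simp only [r]
      group
    have hcomp {f : G → G} (hf : ContMDiffAt 𝓘(ℂ, E) 𝓘(ℂ, E) ω f 1) :
        ContMDiffAt 𝓘(ℂ, E) 𝓘(ℂ, E) ω (fun w => f (r w)) ((n : G) * l * u) :=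
      ContMDiffAt.comp (g := f) (f := r) _ (by rwa [hr1]) hr.contMDiffAt
    refine ⟨fun w => (n * ⟨l * a (r w) * (l : G)⁻¹, hLN l l.2 _ (ha _)⟩, l * ⟨b (r w), hb _⟩,
      ⟨c (r w), hc _⟩ * u), ?_, ?_⟩
    · refine (hRN.contMDiffAt ?_).prodMk ((hRL.contMDiffAt ?_).prodMk (hRU.contMDiffAt ?_))
      · exact contMDiffAt_const.mul ((contMDiffAt_const.mul (hcomp ha')).mul contMDiffAt_const)
      · exact contMDiffAt_const.mul (hcomp hb')
      · exact (hcomp hc').mul contMDiffAt_const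
    · have h1 : ∀ᶠ w in 𝓝 ((n : G) * l * u), a (r w) * b (r w) * c (r w) = r w := by
        have := (hr.continuous.tendsto ((n : G) * l * u)).eventually (by rwa [hr1])
        exact this
      filter_upwards [h1] with w hw
      calc (n : G) * (l * a (r w) * (l : G)⁻¹) * (l * b (r w)) * (c (r w) * u)
          = n * l * (a (r w) * b (r w) * c (r w)) * u := by group
        _ = w := by
          rw [hw]
          simp only [r]
          group

/-- The multiplication map of a parabolic subgroup is biholomorphic onto an open subset. -/
theorem isBiholomorphicOntoOpen_mul
    (hL : ContMDiff 𝓘(ℂ, Vl) 𝓘(ℂ, E) ω (Subtype.val : L → G)) (hRL : HasLocalRetractions L Vl)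
    (hU : ContMDiff 𝓘(ℂ, Vu) 𝓘(ℂ, E) ω (Subtype.val : U → G)) (hRU : HasLocalRetractions U Vu)
    (hPi : ContMDiff 𝓘(ℂ, Vp) 𝓘(ℂ, E) ω (Subtype.val : P → G)) (hRP : HasLocalRetractions P Vp)
    (hLU : ∀ l ∈ L, ∀ u ∈ U, l * u * l⁻¹ ∈ U) (hLP : L ≤ P) (hUP : U ≤ P)
    (hNP : ∀ n ∈ N, n ∈ P → n = 1) (hUL : ∀ u ∈ U, u ∈ L → u = 1) {a b c : G → G}
    (ha : ∀ g, a g ∈ N) (hb : ∀ g, b g ∈ L) (hc : ∀ g, c g ∈ U)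
    (hb' : ContMDiffAt 𝓘(ℂ, E) 𝓘(ℂ, E) ω b 1)
    (hc' : ContMDiffAt 𝓘(ℂ, E) 𝓘(ℂ, E) ω c 1) (habc : ∀ᶠ g in 𝓝 (1 : G), a g * b g * c g = g)
    {f : U × L → P} (hf : ∀ q, (f q : G) = q.1 * q.2) :
    IsBiholomorphicOntoOpen (𝓘(ℂ, Vu).prod 𝓘(ℂ, Vl)) 𝓘(ℂ, Vp) f := by
  refine isBiholomorphicOntoOpen_of (hRP.contMDiff ?_) ?_ ?_
  · simp only [hf]
    exact (hU.comp contMDiff_fst).mul (hL.comp contMDiff_snd)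
  · rintro ⟨⟨u, hu⟩, ⟨l, hl⟩⟩ ⟨⟨u', hu'⟩, ⟨l', hl'⟩⟩ h
    have h1 := congrArg Subtype.val h
    simp only [hf] at h1
    have h2 : u'⁻¹ * u = l' * l⁻¹ := by
      rw [inv_mul_eq_iff_eq_mul, ← mul_assoc, ← h1, mul_inv_cancel_right]
    have h3 : u'⁻¹ * u = 1 := by
      refine hUL _ (mul_mem (inv_mem hu') hu) ?_
      rw [h2]
      exact mul_mem hl' (inv_mem hl)
    obtain rfl : u' = u := inv_mul_eq_one.1 h3
    obtain rfl : l = l' := mul_left_cancel h1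
    rfl
  · rintro ⟨u, l⟩
    let r : P → G := fun p => (u : G)⁻¹ * p * (l : G)⁻¹
    have hr : ContMDiff 𝓘(ℂ, Vp) 𝓘(ℂ, E) ω r := (contMDiff_const.mul hPi).mul contMDiff_const
    have hr1 : r (f (u, l)) = 1 := by
      simp only [r, hf]
      group
    have hcomp {h : G → G} (hh : ContMDiffAt 𝓘(ℂ, E) 𝓘(ℂ, E) ω h 1) :
        ContMDiffAt 𝓘(ℂ, Vp) 𝓘(ℂ, E) ω (fun p => h (r p)) (f (u, l)) :=
      ContMDiffAt.comp (g := h) (f := r) _ (by rwa [hr1]) hr.contMDiffAt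
    -- The coordinates at `1` come in the order `b c`; rewriting this as `(b c b⁻¹) b` puts the
    -- factor in `U` first.
    refine ⟨fun p => (u * ⟨b (r p) * c (r p) * (b (r p))⁻¹, hLU _ (hb _) _ (hc _)⟩,
      ⟨b (r p), hb _⟩ * l), ?_, ?_⟩
    · refine (hRU.contMDiffAt ?_).prodMk (hRL.contMDiffAt ?_)
      · exact contMDiffAt_const.mul (((hcomp hb').mul (hcomp hc')).mul (hcomp hb').inv)
      · exact (hcomp hb').mul contMDiffAt_const
    · have h1 : ∀ᶠ p in 𝓝 (f (u, l)), a (r p) * b (r p) * c (r p) = r p := by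
        have := (hr.continuous.tendsto (f (u, l))).eventually (by rwa [hr1])
        exact this
      filter_upwards [h1] with p hp
      -- As `r p`, `b` and `c` all lie in `P`, the first factor lies in `N ∩ P`.
      have h2 : a (r p) = 1 := by
        refine hNP _ (ha _) ?_
        have h3 : a (r p) = r p * (c (r p))⁻¹ * (b (r p))⁻¹ := by
          rw [eq_mul_inv_iff_mul_eq, eq_mul_inv_iff_mul_eq, hp]
        rw [h3]
        exact mul_mem (mul_mem (mul_mem (mul_mem (inv_mem (hUP u.2)) p.2) (inv_mem (hLP l.2)))
          (inv_mem (hUP (hc _)))) (inv_mem (hLP (hb _)))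
      rw [h2, one_mul] at hp
      ext
      rw [hf]
      calc (u : G) * (b (r p) * c (r p) * (b (r p))⁻¹) * (b (r p) * l)
          = u * (b (r p) * c (r p)) * l := by group
        _ = p := by
          rw [hp]
          simp only [r]
          group

end TriangularDecomposition

/-! ### The structure theorem in terms of the spectrum of `ad x`. -/

section Parabolic

open Filter

variable {E : Type*} [NormedAddCommGroup E] [NormedSpace ℂ E] [CompleteSpace E]
  {G : Type*} [TopologicalSpace G] [ChartedSpace E G] [Group G] [LieGroup 𝓘(ℂ, E) ω G] {x : E}

lemma IsRealDiagonalizable.neg_bracket (hD : IsRealDiagonalizable (bracketCLM G x)) :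
    IsRealDiagonalizable (bracketCLM G (-x)) := by
  rw [map_neg]
  exact hD.neg

lemma spectralSubspace_neg_bracket {A : Set ℝ} :
    spectralSubspace (bracketCLM G (-x)) A = spectralSubspace (bracketCLM G x) (-A) := by
  rw [map_neg, spectralSubspace_neg]

/-- Unipotent subgroups meet normalizers of complementary spectral subspaces trivially. -/
lemma eq_one_of_mem_unipotentSubgroup (hD : IsRealDiagonalizable (bracketCLM G x))
    {V : Submodule ℂ (GroupLieAlgebra 𝓘(ℂ, E) G)} {A : Set ℝ}
    (hV : toModel V = spectralSubspace (bracketCLM G x) A) (h0 : (0 : ℝ) ∈ A)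
    (hA : Disjoint A (Ioi 0)) {g : G} (hg : g ∈ unipotentSubgroup hD)
    (hg' : g ∈ adNormalizer V) : g = 1 := by
  refine unipotentSubgroup_eq_one hD hg ?_
  have hx : x ∈ toModel V := by
    rw [hV]
    exact mem_spectralSubspace h0 (by simp [bracketCLM_self])
  have h1 := sub_mem (adRep_mem_of_mem_adNormalizer hg' hx) hx
  rw [hV] at h1
  exact sub_eq_zero.1 (hD.disjoint h1 (adRep_sub_mem_of_mem_unipotentSubgroup hD hg) hA)

/-- Conjugation by `g` preserves a unipotent subgroup if `Ad(g)` preserves its Lie algebra. -/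
lemma conj_mem_unipotentSubgroup (hD : IsRealDiagonalizable (bracketCLM G x)) {g u : G}
    (hg : ∀ v ∈ spectralSubspace (bracketCLM G x) (Ioi 0),
      adRep g v ∈ spectralSubspace (bracketCLM G x) (Ioi 0))
    (hu : u ∈ unipotentSubgroup hD) : g * u * g⁻¹ ∈ unipotentSubgroup hD := by
  obtain ⟨v, hv, rfl⟩ := hu
  exact ⟨_, hg v hv, lieExp_adRep g v⟩

variable {Vn Vl Vu Vp : Submodule ℂ (GroupLieAlgebra 𝓘(ℂ, E) G)}

/-- The structure of parabolic subgroups. -/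
theorem exists_parabolic_structure (hD : IsRealDiagonalizable (bracketCLM G x))
    (hn : toModel Vn = spectralSubspace (bracketCLM G x) (Iio 0))
    (hl : toModel Vl = spectralSubspace (bracketCLM G x) {0})
    (hu : toModel Vu = spectralSubspace (bracketCLM G x) (Ioi 0))
    (hp : toModel Vp = spectralSubspace (bracketCLM G x) (Ici 0)) {P L : Subgroup G}
    (hP : P ≤ adNormalizer Vp)
    (hPo : IsOpen (P.subgroupOf (adNormalizer Vp) : Set (adNormalizer Vp)))
    (hL : L = P ⊓ adNormalizer Vl ⊓ adNormalizer Vn) :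
    ∃ (U N : Subgroup G) (_ : ChartedSpace (toModel Vu) U) (_ : ChartedSpace (toModel Vn) N)
      (_ : ChartedSpace (toModel Vl) L) (_ : ChartedSpace (toModel Vp) P),
      (U : Set G) = lieExp G '' (toModel Vu : Set E) ∧
      (N : Set G) = lieExp G '' (toModel Vn : Set E) ∧
      IsLieSubgroup P Vp ∧ IsLieSubgroupAtlas P Vp ∧
      (IsLieSubgroup U Vu ∧ IsLieSubgroupAtlas U Vu ∧
        (∀ v : toModel Vu, (lieExp U v : G) = lieExp G (v : E)) ∧
        IsBiholomorphic 𝓘(ℂ, toModel Vu) 𝓘(ℂ, toModel Vu) (lieExp U : toModel Vu → U)) ∧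
      (IsLieSubgroup N Vn ∧ IsLieSubgroupAtlas N Vn ∧
        (∀ v : toModel Vn, (lieExp N v : G) = lieExp G (v : E)) ∧
        IsBiholomorphic 𝓘(ℂ, toModel Vn) 𝓘(ℂ, toModel Vn) (lieExp N : toModel Vn → N)) ∧
      (IsLieSubgroup L Vl ∧ IsLieSubgroupAtlas L Vl ∧
        ∃ (φN : L →* MulAut N) (φU : L →* MulAut U),
          (∀ l n, (φN l n : G) = l * n * (l : G)⁻¹) ∧
          (∀ l u, (φU l u : G) = l * u * (l : G)⁻¹) ∧
          ContMDiff (𝓘(ℂ, toModel Vl).prod 𝓘(ℂ, toModel Vn)) 𝓘(ℂ, toModel Vn) ω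
            (fun q : L × N => φN q.1 q.2) ∧
          ContMDiff (𝓘(ℂ, toModel Vl).prod 𝓘(ℂ, toModel Vu)) 𝓘(ℂ, toModel Vu) ω
            (fun q : L × U => φU q.1 q.2) ∧
          ∃ m : U ⋊[φU] L →* P,
            (∀ s, (m s : G) = s.left * s.right) ∧
            IsBiholomorphicOntoOpen (𝓘(ℂ, toModel Vu).prod 𝓘(ℂ, toModel Vl)) 𝓘(ℂ, toModel Vp)
              (fun q : U × L => m ⟨q.1, q.2⟩)) ∧
      IsBiholomorphicOntoOpen
        (𝓘(ℂ, toModel Vn).prod (𝓘(ℂ, toModel Vl).prod 𝓘(ℂ, toModel Vu))) 𝓘(ℂ, E)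
        (fun q : N × L × U => (q.1 : G) * (q.2.1 : G) * (q.2.2 : G)) := by
  have htop := topologicalGroup_of_lieGroup 𝓘(ℂ, E) ω (G := G)
  have hD' := hD.neg_bracket
  have hn' : toModel Vn = spectralSubspace (bracketCLM G (-x)) (Ioi 0) := by
    rw [spectralSubspace_neg_bracket, hn]
    simp
  have hcl {V : Submodule ℂ (GroupLieAlgebra 𝓘(ℂ, E) G)} {A : Set ℝ}
      (hV : toModel V = spectralSubspace (bracketCLM G x) A) : IsClosed (toModel V : Set E) :=
    hV ▸ hD.isClosed A
  -- brackets
  have hbr {V W : Submodule ℂ (GroupLieAlgebra 𝓘(ℂ, E) G)} {A B : Set ℝ}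
      (hV : toModel V = spectralSubspace (bracketCLM G x) A)
      (hW : toModel W = spectralSubspace (bracketCLM G x) B) (h : ∀ a ∈ A, ∀ b ∈ B, a + b ∈ B)
      (v : E) (hv : v ∈ toModel V) (w : E) (hw : w ∈ toModel W) :
      bracketCLM G v w ∈ toModel W := by
    rw [hW]
    exact bracketCLM_mem_spectralSubspace h (hV ▸ hv) (hW ▸ hw)
  have hlp : ∀ v ∈ toModel Vl, v ∈ toModel Vp := by
    rw [hl, hp]
    exact fun v hv => spectralSubspace_mono (by simp) hv
  have hup : ∀ v ∈ toModel Vu, v ∈ toModel Vp := by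
    rw [hu, hp]
    exact fun v hv => spectralSubspace_mono Ioi_subset_Ici_self hv
  -- the parabolic subgroup
  have hPcl : IsClosed (P : Set G) :=
    isClosed_of_isOpen_subgroupOf hP (isClosed_adNormalizer (hcl hp)) hPo
  have hPexp : ∀ v ∈ toModel Vp, lieExp G v ∈ P := fun v hv =>
    lieExp_mem_of_isOpen_subgroupOf hPo fun t => by
      refine lieExp_mem_adNormalizer (hcl hp)
        (hbr hp hp (fun a ha b hb => mem_Ici.2 (add_nonneg ha hb)) _ ?_)
      rw [← Complex.coe_smul]
      exact (toModel Vp).smul_mem _ hv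
  have hPl : IsLieSubgroup P Vp :=
    isLieSubgroup_of_le_adNormalizer hD hp (mem_Ici.2 le_rfl) hPcl hP hPexp
  -- the Levi subgroup
  have hLP : L ≤ P := hL ▸ inf_le_left.trans inf_le_left
  have hLl : L ≤ adNormalizer Vl := hL ▸ inf_le_left.trans inf_le_right
  have hLn : L ≤ adNormalizer Vn := hL ▸ inf_le_right
  have hLcl : IsClosed (L : Set G) := by
    rw [hL]
    exact (hPcl.inter (isClosed_adNormalizer (hcl hl))).inter (isClosed_adNormalizer (hcl hn))
  have hLexp : ∀ v ∈ toModel Vl, lieExp G v ∈ L := fun v hv => by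
    rw [hL]
    exact ⟨⟨hPexp v (hlp v hv),
      lieExp_mem_adNormalizer (hcl hl) (hbr hl hl (by simp) v hv)⟩,
      lieExp_mem_adNormalizer (hcl hn) (hbr hl hn (by simp) v hv)⟩
  have hLL : IsLieSubgroup L Vl :=
    isLieSubgroup_of_le_adNormalizer hD hl (mem_singleton _) hLcl hLl hLexp
  -- the unipotent subgroups
  have hUL : IsLieSubgroup (unipotentSubgroup hD) Vu := isLieSubgroup_unipotentSubgroup hD hu
  have hNL : IsLieSubgroup (unipotentSubgroup hD') Vn := isLieSubgroup_unipotentSubgroup hD' hn'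
  have hUP : unipotentSubgroup hD ≤ P := by
    rintro _ ⟨v, hv, rfl⟩
    exact hPexp v (hup v (hu ▸ hv))
  -- conjugation
  have hLU : ∀ l ∈ L, ∀ u ∈ unipotentSubgroup hD, l * u * l⁻¹ ∈ unipotentSubgroup hD := by
    intro l hlL u huU
    -- The definition of `L` does not mention `𝔲`; its invariance follows from that of `𝔭` and `𝔩`.
    refine conj_mem_unipotentSubgroup hD (fun v hv => adRep_mem_pos hD ?_ ?_ ?_ hv) huU
    · rw [← hp]
      exact fun v => adRep_mem_of_mem_adNormalizer (hP (hLP hlL))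
    · rw [← hl]
      exact fun v => adRep_mem_of_mem_adNormalizer (hLl hlL)
    · rw [← hl]
      exact fun v => adRep_mem_of_mem_adNormalizer (hLl (inv_mem hlL))
  have hLN : ∀ l ∈ L, ∀ n ∈ unipotentSubgroup hD', l * n * l⁻¹ ∈ unipotentSubgroup hD' := by
    intro l hlL n hnN
    refine conj_mem_unipotentSubgroup hD' ?_ hnN
    rw [← hn']
    exact fun v => adRep_mem_of_mem_adNormalizer (hLn hlL)
  -- intersections
  have hNP : ∀ n ∈ unipotentSubgroup hD', n ∈ P → n = 1 := fun n hnN hnP => by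
    -- With respect to `-x`, the subspace `𝔭` belongs to the eigenvalues `≤ 0` and `𝔫` to those `>
    -- 0`.
    refine eq_one_of_mem_unipotentSubgroup hD' (V := Vp) (A := Iic 0) ?_ (mem_Iic.2 le_rfl)
      (Iic_disjoint_Ioi le_rfl) hnN (hP hnP)
    rw [hp, spectralSubspace_neg_bracket]
    simp
  have hULt : ∀ u ∈ unipotentSubgroup hD, u ∈ L → u = 1 := fun u huU huL =>
    eq_one_of_mem_unipotentSubgroup hD hl (mem_singleton _) (by simp) huU (hLl huL)
  -- analytic coordinates
  obtain ⟨s, hs, hs'⟩ := exists_triangular_coordinate hD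
  have hsm (T : E →L[ℂ] E) :
      ContMDiffAt 𝓘(ℂ, E) 𝓘(ℂ, E) ω (fun g => lieExp G (T (s g))) 1 :=
    ContMDiffAt.comp (g := fun v => lieExp G (T v)) (f := s) 1
      (contMDiff_lieExp.comp T.contMDiff).contMDiffAt hs.self_of_nhds
  have ha (g : G) : lieExp G (hD.proj (Iio 0) (s g)) ∈ unipotentSubgroup hD' :=
    ⟨_, by rw [← hn', hn]; exact hD.proj_mem _, rfl⟩
  have hb (g : G) : lieExp G (hD.proj {0} (s g)) ∈ L := hLexp _ (hl ▸ hD.proj_mem _)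
  have hc (g : G) : lieExp G (hD.proj (Ioi 0) (s g)) ∈ unipotentSubgroup hD :=
    ⟨_, hD.proj_mem _, rfl⟩
  -- atlases
  have hatlas {H : Subgroup G} {V : Submodule ℂ (GroupLieAlgebra 𝓘(ℂ, E) G)} {A : Set ℝ}
      (hV : toModel V = spectralSubspace (bracketCLM G x) A) (hH : IsLieSubgroup H V) :
      ∃ _ : ChartedSpace (toModel V) H, IsLieSubgroupAtlas H V ∧
        HasLocalRetractions H (toModel V) :=
    hH.exists_atlas ((hD.proj A).codRestrict (toModel V) fun v => hV ▸ hD.proj_mem v)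
      fun v => Subtype.ext (hD.proj_eq_self (hV ▸ v.2))
  obtain ⟨cU, hUa, hUR⟩ := hatlas hu hUL
  obtain ⟨cN, hNa, hNR⟩ := hatlas hn hNL
  obtain ⟨cL, hLa, hLR⟩ := hatlas hl hLL
  obtain ⟨cP, hPa, hPR⟩ := hatlas hp hPl
  obtain ⟨φN, hφN⟩ := exists_conjAction hLN
  obtain ⟨φU, hφU⟩ := exists_conjAction hLU
  let m : unipotentSubgroup hD ⋊[φU] L →* P :=
    (SemidirectProduct.lift (unipotentSubgroup hD).subtype L.subtype fun l => by
      ext u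
      simp [hφU]).codRestrict P fun q => mul_mem (hUP q.left.2) (hLP q.right.2)
  refine ⟨unipotentSubgroup hD, unipotentSubgroup hD', cU, cN, cL, cP, by
    rw [hu, coe_unipotentSubgroup], by rw [hn', coe_unipotentSubgroup], hPl, hPa,
    ⟨hUL, hUa, hUL.lieExp_eq hUa hUR, isBiholomorphic_lieExp_unipotentSubgroup hD hu hUa hUR⟩,
    ⟨hNL, hNa, hNL.lieExp_eq hNa hNR, isBiholomorphic_lieExp_unipotentSubgroup hD' hn' hNa hNR⟩,
    ⟨hLL, hLa, φN, φU, hφN, hφU,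
      contMDiff_conjAction hLa.contMDiff_incl hNa.contMDiff_incl hNR hφN,
      contMDiff_conjAction hLa.contMDiff_incl hUa.contMDiff_incl hUR hφU, m, fun q => rfl, ?_⟩, ?_⟩
  · exact isBiholomorphicOntoOpen_mul hLa.contMDiff_incl hLR hUa.contMDiff_incl hUR
      hPa.contMDiff_incl hPR hLU hLP hUP hNP hULt ha hb hc (hsm _) (hsm _) hs' fun q => rfl
  · exact isBiholomorphicOntoOpen_mul_mul hNa.contMDiff_incl hNR hLa.contMDiff_incl hLR
      hUa.contMDiff_incl hUR hLN hLP hUP hNP hULt ha hb hc (hsm _) (hsm _) (hsm _) hs'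

end Parabolic

/-! ### From root spaces to spectral subspaces of `ad x`. -/

section RootGrading

namespace WeakRootGrading

lemma eq_top_of_forall_weightSubspace_le {𝔤 : Type*} [LieRing 𝔤] [LieAlgebra ℂ 𝔤]
    (Γ : WeakRootGrading 𝔤) {X : Submodule ℂ 𝔤} (h0 : weightSubspace Γ.𝔥 0 ≤ X)
    (h : ∀ α ∈ Γ.roots, weightSubspace Γ.𝔥 α ≤ X) : X = ⊤ := by
  rw [eq_top_iff, ← Γ.iSup_weights]
  refine iSup_le fun α => ?_
  by_cases hα : α = 0
  · exact hα ▸ h0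
  · by_cases hb : weightSubspace Γ.𝔥 α = ⊥
    · rw [hb]
      exact bot_le
    · exact h α ⟨hα, hb⟩

variable {E : Type*} [NormedAddCommGroup E] [NormedSpace ℂ E] [CompleteSpace E]
  {G : Type*} [TopologicalSpace G] [ChartedSpace E G] [Group G] [LieGroup 𝓘(ℂ, E) ω G]
  (Γ : WeakRootGrading (GroupLieAlgebra 𝓘(ℂ, E) G)) (x : Γ.𝔥)

/-- An element of the Cartan subalgebra as an element of the model space. -/
def modelElement : E := (((x : Γ.𝔤Δ) : GroupLieAlgebra 𝓘(ℂ, E) G) : E)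

/-- The spectral subspaces of `ad x` as subspaces of the Lie algebra. -/
noncomputable def spectralPart (A : Set ℝ) : Submodule ℂ (GroupLieAlgebra 𝓘(ℂ, E) G) :=
  (spectralSubspace (bracketCLM G (Γ.modelElement x)) A : Submodule ℂ E)

variable {x}

/-- On `𝔤_α` the element `x` acts by the scalar `α(x)`, which is real by assumption. -/
lemma weightSubspace_le_spectralPart {α : Module.Dual ℂ Γ.𝔥} (hα : (α x).im = 0) {A : Set ℝ}
    (hA : (α x).re ∈ A) : weightSubspace Γ.𝔥 α ≤ Γ.spectralPart x A := by
  intro v hv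
  refine mem_spectralSubspace (D := bracketCLM G (Γ.modelElement x)) (v := (v : E)) hA ?_
  have h1 : ((α x).re : ℂ) = α x := Complex.ext rfl (by simp [hα])
  rw [h1]
  exact (bracket_eq_bracketCLM (Γ.modelElement x) v).symm.trans (hv x)

lemma weightSubspace_zero_le_spectralPart {A : Set ℝ} (hA : (0 : ℝ) ∈ A) :
    weightSubspace Γ.𝔥 0 ≤ Γ.spectralPart x A :=
  Γ.weightSubspace_le_spectralPart (by simp) (by simpa using hA)

lemma isRealDiagonalizable (hx : Γ.IsReal x) :
    IsRealDiagonalizable (bracketCLM G (Γ.modelElement x)) := by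
  classical
  -- The value `0` is inserted so that `𝔤₀` is covered without deciding whether it is non-zero.
  let S : Finset ℝ := insert 0 (Γ.finite_weights.toFinset.image fun α => (α x).re)
  have h : Γ.spectralPart x (S : Set ℝ) = ⊤ := by
    refine Γ.eq_top_of_forall_weightSubspace_le
      (Γ.weightSubspace_zero_le_spectralPart (by simp [S])) fun α hα =>
      Γ.weightSubspace_le_spectralPart (hx α hα) ?_
    simp only [S, Finset.coe_insert, Finset.coe_image, Finite.coe_toFinset]
    exact Or.inr ⟨α, hα.2, rfl⟩
  exact ⟨S, h⟩

lemma parabolic_le (hx : Γ.IsReal x) : Γ.parabolic x ≤ Γ.spectralPart x (Ici 0) :=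
  sup_le (Γ.weightSubspace_zero_le_spectralPart (mem_Ici.2 le_rfl))
    (iSup₂_le fun α hα => Γ.weightSubspace_le_spectralPart (hx α hα.1) hα.2)

lemma levi_le (hx : Γ.IsReal x) : Γ.levi x ≤ Γ.spectralPart x {0} :=
  sup_le (Γ.weightSubspace_zero_le_spectralPart (mem_singleton _))
    (iSup₂_le fun α hα => Γ.weightSubspace_le_spectralPart (hx α hα.1) hα.2)

lemma nilPos_le (hx : Γ.IsReal x) : Γ.nilPos x ≤ Γ.spectralPart x (Ioi 0) :=
  iSup₂_le fun α hα => Γ.weightSubspace_le_spectralPart (hx α hα.1) hα.2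

lemma nilNeg_le (hx : Γ.IsReal x) : Γ.nilNeg x ≤ Γ.spectralPart x (Iio 0) :=
  iSup₂_le fun α hα => Γ.weightSubspace_le_spectralPart (hx α hα.1) hα.2

lemma spectralPart_mono {A B : Set ℝ} (h : A ⊆ B) : Γ.spectralPart x A ≤ Γ.spectralPart x B :=
  spectralSubspace_mono h

lemma weightSubspace_le_nilNeg {α : Module.Dual ℂ Γ.𝔥} (hα : α ∈ Γ.systemNeg x) :
    weightSubspace Γ.𝔥 α ≤ Γ.nilNeg x :=
  le_iSup₂_of_le α hα le_rfl

lemma weightSubspace_le_nilPos {α : Module.Dual ℂ Γ.𝔥} (hα : α ∈ Γ.systemPos x) :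
    weightSubspace Γ.𝔥 α ≤ Γ.nilPos x :=
  le_iSup₂_of_le α hα le_rfl

lemma weightSubspace_le_levi {α : Module.Dual ℂ Γ.𝔥} (hα : α ∈ Γ.systemZero x) :
    weightSubspace Γ.𝔥 α ≤ Γ.levi x :=
  le_sup_of_le_right (le_iSup₂_of_le α hα le_rfl)

lemma parabolic_sup_nilNeg : Γ.parabolic x ⊔ Γ.nilNeg x = ⊤ := by
  refine Γ.eq_top_of_forall_weightSubspace_le (le_sup_left.trans le_sup_left) fun α hα => ?_
  rcases le_or_gt 0 (α x).re with h | h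
  · exact le_sup_of_le_left (le_sup_of_le_right (le_iSup₂_of_le α ⟨hα, h⟩ le_rfl))
  · exact le_sup_of_le_right (Γ.weightSubspace_le_nilNeg ⟨hα, h⟩)

lemma levi_sup_nilPos_sup_nilNeg : Γ.levi x ⊔ (Γ.nilPos x ⊔ Γ.nilNeg x) = ⊤ := by
  refine Γ.eq_top_of_forall_weightSubspace_le (le_sup_left.trans le_sup_left) fun α hα => ?_
  rcases lt_trichotomy (α x).re 0 with h | h | h
  · exact le_sup_of_le_right (le_sup_of_le_right (Γ.weightSubspace_le_nilNeg ⟨hα, h⟩))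
  · exact le_sup_of_le_left (Γ.weightSubspace_le_levi ⟨hα, h⟩)
  · exact le_sup_of_le_right (le_sup_of_le_left (Γ.weightSubspace_le_nilPos ⟨hα, h⟩))

/-- Subspaces contained in complementary spectral parts that together span everything must fill
those parts. So each of the four identifications below needs only inclusions and a spanning
statement. -/
lemma eq_spectralPart (hx : Γ.IsReal x) {A : Set ℝ}
    {V V' : Submodule ℂ (GroupLieAlgebra 𝓘(ℂ, E) G)} (hV : V ≤ Γ.spectralPart x A)
    (hV' : V' ≤ Γ.spectralPart x Aᶜ) (h : V ⊔ V' = ⊤) :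
    toModel V = spectralSubspace (bracketCLM G (Γ.modelElement x)) A :=
  (Γ.isRealDiagonalizable hx).eq_spectralSubspace (V := toModel V) (V' := toModel V') hV hV' h

lemma toModel_parabolic (hx : Γ.IsReal x) : toModel (Γ.parabolic x) =
    spectralSubspace (bracketCLM G (Γ.modelElement x)) (Ici 0) :=
  Γ.eq_spectralPart hx (Γ.parabolic_le hx)
    ((Γ.nilNeg_le hx).trans (Γ.spectralPart_mono (by simp))) Γ.parabolic_sup_nilNeg

lemma toModel_nilNeg (hx : Γ.IsReal x) : toModel (Γ.nilNeg x) =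
    spectralSubspace (bracketCLM G (Γ.modelElement x)) (Iio 0) :=
  Γ.eq_spectralPart hx (Γ.nilNeg_le hx)
    ((Γ.parabolic_le hx).trans (Γ.spectralPart_mono (by simp)))
    (by rw [sup_comm]; exact Γ.parabolic_sup_nilNeg)

lemma toModel_levi (hx : Γ.IsReal x) : toModel (Γ.levi x) =
    spectralSubspace (bracketCLM G (Γ.modelElement x)) {0} :=
  Γ.eq_spectralPart hx (Γ.levi_le hx)
    (sup_le ((Γ.nilPos_le hx).trans (Γ.spectralPart_mono (by simp)))
      ((Γ.nilNeg_le hx).trans (Γ.spectralPart_mono (by simp))))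
    Γ.levi_sup_nilPos_sup_nilNeg

lemma toModel_nilPos (hx : Γ.IsReal x) : toModel (Γ.nilPos x) =
    spectralSubspace (bracketCLM G (Γ.modelElement x)) (Ioi 0) :=
  Γ.eq_spectralPart hx (V' := Γ.levi x ⊔ Γ.nilNeg x) (Γ.nilPos_le hx)
    (sup_le ((Γ.levi_le hx).trans (Γ.spectralPart_mono (by simp)))
      ((Γ.nilNeg_le hx).trans (Γ.spectralPart_mono (by simp))))
    (by rw [sup_left_comm]; exact Γ.levi_sup_nilPos_sup_nilNeg)

end WeakRootGrading

end RootGrading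

theorem mainTheorem12 {E : Type*} [NormedAddCommGroup E] [NormedSpace ℂ E] [CompleteSpace E]
    {G : Type*} [TopologicalSpace G] [ChartedSpace E G] [Group G] [LieGroup 𝓘(ℂ, E) ω G]
    (Γ : WeakRootGrading (GroupLieAlgebra 𝓘(ℂ, E) G)) (x : Γ.𝔥) (hx : Γ.IsReal x)
    (P : Subgroup G) (hP : IsParabolicSubgroup Γ x P) :
    ∃ (U N : Subgroup G)
      (_ : ChartedSpace (toModel (Γ.nilPos x)) U)
      (_ : ChartedSpace (toModel (Γ.nilNeg x)) N)
      (_ : ChartedSpace (toModel (Γ.levi x)) (leviSubgroup Γ x P))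
      (_ : ChartedSpace (toModel (Γ.parabolic x)) P),
      (U : Set G) = lieExp G '' (toModel (Γ.nilPos x) : Set E) ∧
      (N : Set G) = lieExp G '' (toModel (Γ.nilNeg x) : Set E) ∧
      IsLieSubgroup P (Γ.parabolic x) ∧ IsLieSubgroupAtlas P (Γ.parabolic x) ∧
      -- (a)
      (IsLieSubgroup U (Γ.nilPos x) ∧ IsLieSubgroupAtlas U (Γ.nilPos x) ∧
        (∀ v : toModel (Γ.nilPos x), (lieExp U v : G) = lieExp G (v : E)) ∧
        IsBiholomorphic 𝓘(ℂ, toModel (Γ.nilPos x)) 𝓘(ℂ, toModel (Γ.nilPos x))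
          (lieExp U : toModel (Γ.nilPos x) → U)) ∧
      -- (b)
      (IsLieSubgroup N (Γ.nilNeg x) ∧ IsLieSubgroupAtlas N (Γ.nilNeg x) ∧
        (∀ v : toModel (Γ.nilNeg x), (lieExp N v : G) = lieExp G (v : E)) ∧
        IsBiholomorphic 𝓘(ℂ, toModel (Γ.nilNeg x)) 𝓘(ℂ, toModel (Γ.nilNeg x))
          (lieExp N : toModel (Γ.nilNeg x) → N)) ∧
      -- (c)
      (IsLieSubgroup (leviSubgroup Γ x P) (Γ.levi x) ∧
        IsLieSubgroupAtlas (leviSubgroup Γ x P) (Γ.levi x) ∧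
        ∃ (φN : leviSubgroup Γ x P →* MulAut N) (φU : leviSubgroup Γ x P →* MulAut U),
          (∀ l n, (φN l n : G) = l * n * (l : G)⁻¹) ∧
          (∀ l u, (φU l u : G) = l * u * (l : G)⁻¹) ∧
          ContMDiff (𝓘(ℂ, toModel (Γ.levi x)).prod 𝓘(ℂ, toModel (Γ.nilNeg x)))
            𝓘(ℂ, toModel (Γ.nilNeg x)) ω
            (fun q : leviSubgroup Γ x P × N => φN q.1 q.2) ∧
          ContMDiff (𝓘(ℂ, toModel (Γ.levi x)).prod 𝓘(ℂ, toModel (Γ.nilPos x)))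
            𝓘(ℂ, toModel (Γ.nilPos x)) ω
            (fun q : leviSubgroup Γ x P × U => φU q.1 q.2) ∧
          -- (d)
          ∃ m : U ⋊[φU] (leviSubgroup Γ x P) →* P,
            (∀ s, (m s : G) = s.left * s.right) ∧
            IsBiholomorphicOntoOpen
              (𝓘(ℂ, toModel (Γ.nilPos x)).prod 𝓘(ℂ, toModel (Γ.levi x)))
              𝓘(ℂ, toModel (Γ.parabolic x))
              (fun q : U × leviSubgroup Γ x P => m ⟨q.1, q.2⟩)) ∧
      -- (e)
      IsBiholomorphicOntoOpen
        (𝓘(ℂ, toModel (Γ.nilNeg x)).prod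
          (𝓘(ℂ, toModel (Γ.levi x)).prod 𝓘(ℂ, toModel (Γ.nilPos x))))
        𝓘(ℂ, E)
        (fun q : N × leviSubgroup Γ x P × U => (q.1 : G) * (q.2.1 : G) * (q.2.2 : G)) :=
  exists_parabolic_structure (Γ.isRealDiagonalizable hx) (Γ.toModel_nilNeg hx) (Γ.toModel_levi hx)
    (Γ.toModel_nilPos hx) (Γ.toModel_parabolic hx) hP.1 hP.2 rfl
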